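/- All logarithms are to base 2, $\mathbf U^n$ is the uniform distribution on $\{0,1\}^n$, and $\|\mathbf P-\mathbf R\|=\frac12\sum_x|\mathbf P(x)-\mathbf R(x)|$ is total variation distance. **Isolators.** $\mathsf{Iso}\colon\{0,1\}^\ell\to\{0,1\}$ is an $(\alpha,\beta,k)$-isolator for a class $\mathcal Y$ of distributions on $\{0,1\}^\ell$ if $\Pr[\mathsf{Iso}(\mathbf U^\ell)=1]\ge\alpha$ and, for every $\mathbf Y\in\mathcal Y$, $\Pr_{y\sim\mathbf Y}[\mathbf Y(y)\le 2^{-k}\text{ and }\mathsf{Iso}(y)=1]\le\beta$. **Communication sources.** A communication source of cost at most $c$ on $\{0,1\}^{a}\times\{0,1\}^{a'}$ is the distribution of the pair of outputs of Alice and Bob in a two-party protocol exchanging at most $c$ bits, where the two parties hold independent private randomness (and no input), every message bit depends on the transcript so far and the sender's private randomness, and each output depends on the transcript and the private randomness of the party. **Turing-machine sources.** Consider randomized Turing machines with $Q$ states, one read-write tape (one-way infinite, a left move on its first cell leaving the head there; or two-way infinite) and one head, with alphabet $\{0,1\}$. The tape is initially all zeros and the head is on cell $0$. In one step, depending on a fresh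 uniform random bit, the state and the scanned symbol, the machine writes a symbol, changes its state, and moves the head to an adjacent cell. A Turing-machine source on $\ell$ bits with $Q$ states and time $T$ is the distribution of the contents of cells $0,\dots,\ell-1$ after exactly $T$ steps of such a machine. **Statement.** There are constants $\delta,\delta_1,C,K,\gamma>0$, integers $n=n(N,b)$, $t=t(N,b)$, $m=m(N,b)$, functions $\mathsf{Iso}_{n,m}\colon\{0,1\}^n\times\{0,1\}^n\to\{0,1\}$ that are explicit (one algorithm computes $\mathsf{Iso}_{n,m}(x,y)$ from $1^n,1^m,x,y$ in time polynomial in $n+m$), and functions $\tilde{\mathsf{Iso}}=\tilde{\mathsf{Iso}}_{N,b}\colon\{0,1\}^n\to\{0,1\}$, such that the following holds. Let $Q,T\ge1$ and $N\ge2$ be integers, let $s=\sqrt{\log Q\cdot T\log T}$ and $b=\lceil s\rceil$, and suppose that $C\log N\le b\le\delta_1N$. Let $n,t,m$ be the values at $(N,b)$, and $\mathsf{Iso}=\mathsf{Iso}_{n,m}$. Then: 1. $n,t\ge1$, $nt\le N$, $m$ is the largest integer with $m2^m\le t$, $m\le\delta n$, and $\mathsf{Iso}$ is a $(2^{-m}-2^{-\gamma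 n},\,2^{-m}+2^{-\gamma n},\,(1-\gamma)2n)$-isolator for the class of communication sources of cost at most $\delta n$ on $(\{0,1\}^n)^2$. 2. Let $$\mathbf D=\big(\mathbf U_1^A,\dots,\mathbf U_t^A,\mathbf U_1^B,\dots,\mathbf U_t^B,\mathsf{Iso}(\mathbf U_1^A,\mathbf U_1^B),\dots,\mathsf{Iso}(\mathbf U_t^A,\mathbf U_t^B)\big),$$ where $\mathbf U_1^A,\dots,\mathbf U_t^A,\mathbf U_1^B,\dots,\mathbf U_t^B$ are independent copies of $\mathbf U^n$. Every Turing-machine source $\mathbf X$ on $(2n+1)t$ bits with $Q$ states and time $T$ satisfies $$\|\mathbf D-\mathbf X\|\ \ge\ 1-K\cdot\frac{s}{N}\log\frac{N}{s}.$$ 3. $\tilde{\mathsf{Iso}}$ is a $(\frac12-2^{-\gamma n},\frac12+2^{-\gamma n},(1-\gamma)n)$-isolator for the class of communication sources of cost at most $\delta n$ on $\{0,1\}^{\lfloor n/2\rfloor}\times\{0,1\}^{\lceil n/2\rceil}=\{0,1\}^n$, and with $\tilde{\mathbf D}=(\mathbf U^n,\tilde{\mathsf{Iso}}(\mathbf U^n))$,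 every Turing-machine source $\mathbf Y$ on $n+1$ bits with $Q$ states and time $T$ satisfies $\|\tilde{\mathbf D}-\mathbf Y\|\ge\frac14-2^{-\gamma n}$. Moreover, $\mathbf D$ can be sampled in $\mathsf{poly}(N)$ time, and so can $\tilde{\mathbf D}$: for each of the two there is one randomized algorithm that, for all integers $N\ge2$ and $b$ with $C\log N\le b\le\delta_1N$, on input $1^N,1^b$ outputs a sample with exactly this distribution in time polynomial in $N$. -/

import Mathlib

/-! ### Bit strings, probabilities, total variation distance -/

/-- Bit strings of length `n`, i.e. `{0,1}^n`. -/
abbrev BitStr (n : ℕ) : Type := Fin n → Bool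

/-- The probability that the discrete distribution `X` gives to the event `S`. -/
noncomputable def prob {Ω : Type} (X : PMF Ω) (S : Set Ω) : ℝ := (X.toOuterMeasure S).toReal

/-- Total variation distance `½ ∑ₓ |P(x) - R(x)|` of two distributions on a finite set. -/
noncomputable def tvDist {Ω : Type} [Fintype Ω] (P R : PMF Ω) : ℝ :=
  (1 / 2) * ∑ x, |(P x).toReal - (R x).toReal|

/-! ### Isolators -/

/-- `Iso` is an `(α, β, k)`-isolator for the class `𝒳` of distributions on the finite set `Ω`
(a set of bit strings): it accepts a uniform string with probability at least `α`, and for every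
`X ∈ 𝒳` the probability that `X` is a light point (of probability at most `2^{-k}`) that
`Iso` accepts is at most `β`. -/
def IsIsolator {Ω : Type} [Fintype Ω] [Nonempty Ω] (α β k : ℝ) (Iso : Ω → Bool)
    (𝒳 : Set (PMF Ω)) : Prop :=
  α ≤ prob (PMF.uniformOfFintype Ω) {x | Iso x = true} ∧
    ∀ X ∈ 𝒳, prob X {x | (X x).toReal ≤ (2 : ℝ) ^ (-k) ∧ Iso x = true} ≤ β

/-! ### Communication sources -/

/-- Two-party protocol trees. Alice holds `a : A`, Bob holds `b : B`. At an inner node one of the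
parties sends a bit depending on its own randomness; the node reached is the transcript so far.
At a leaf, Alice outputs an element of `X` and Bob an element of `Y`, each depending on the
transcript (the leaf) and on their own randomness. -/
inductive Protocol (A B X Y : Type) : Type where
  | output (outA : A → X) (outB : B → Y) : Protocol A B X Y
  | alice (msg : A → Bool) (next : Bool → Protocol A B X Y) : Protocol A B X Y
  | bob (msg : B → Bool) (next : Bool → Protocol A B X Y) : Protocol A B X Y

/-- The cost of a protocol: the largest number of bits exchanged. -/
def Protocol.cost {A B X Y : Type} : Protocol A B X Y → ℕ
  | .output _ _ => 0
  | .alice _ next => 1 + max (next false).cost (next true).cost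
  | .bob _ next => 1 + max (next false).cost (next true).cost

/-- The pair of outputs of a protocol on the private random values `a` and `b`. -/
def Protocol.run {A B X Y : Type} : Protocol A B X Y → A → B → X × Y
  | .output outA outB, a, b => (outA a, outB b)
  | .alice msg next, a, b => (next (msg a)).run a b
  | .bob msg next, a, b => (next (msg b)).run a b

/-- The communication sources of cost at most `c` on `X × Y`: the output distributions of
protocols of cost at most `c` on independent private random values. -/
def commSources (X Y : Type) (c : ℝ) : Set (PMF (X × Y)) :=
  {P | ∃ (A B : Type) (μ : PMF A) (ν : PMF B) (π : Protocol A B X Y),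
      (π.cost : ℝ) ≤ c ∧ P = μ.bind fun a => ν.map fun b => π.run a b}

/-- The first `⌊n/2⌋` and the last `⌈n/2⌉` bits of a string. -/
def halves (n : ℕ) (x : BitStr n) : BitStr (n / 2) × BitStr (n - n / 2) :=
  (fun i => x ⟨i, by omega⟩, fun i => x ⟨n / 2 + i, by omega⟩)

/-- Communication sources of cost at most `c` on `{0,1}^n`, Alice producing the first `⌊n/2⌋`
bits and Bob the remaining ones. -/
def halvesCommSources (n : ℕ) (c : ℝ) : Set (PMF (BitStr n)) :=
  {Y | Y.map (halves n) ∈ commSources (BitStr (n / 2)) (BitStr (n - n / 2)) c}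

/-! ### Turing-machine sources -/

/-- A randomized one-tape, one-head Turing machine with `Q` states and alphabet `{0,1}`: from a
random bit, the current state and the scanned symbol, it determines the symbol written, the next
state and the direction in which the head moves. There is no halting. -/
structure RandTM (Q : ℕ) where
  start : Fin Q
  trans : Bool → Fin Q → Bool → Bool × Fin Q × Turing.Dir

/-- A configuration: state, head position and tape contents. The cells are numbered by integers;
on a one-way infinite tape, only the cells `0, 1, 2, …` are ever visited. -/
structure TMConfig (Q : ℕ) where
  state : Fin Q
  head : ℤ
  tape : ℤ → Bool

/-- Head moves. If the tape is one-way infinite, a move to the left from its first cell `0` leaves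
the head there. -/
def moveHead (twoWay : Bool) (h : ℤ) : Turing.Dir → ℤ
  | .right => h + 1
  | .left => if twoWay then h - 1 else max 0 (h - 1)

/-- One step of the machine, using the random bit `r`. -/
def RandTM.step {Q : ℕ} (M : RandTM Q) (twoWay : Bool) (c : TMConfig Q) (r : Bool) : TMConfig Q :=
  let a := M.trans r c.state (c.tape c.head)
  { state := a.2.1
    head := moveHead twoWay c.head a.2.2
    tape := Function.update c.tape c.head a.1 }

/-- The configuration reached from the all-zero tape with the head on cell `0`, using one random
bit of `ω` per step. -/
def RandTM.run {Q : ℕ} (M : RandTM Q) (twoWay : Bool) (ω : List Bool) : TMConfig Q :=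
  ω.foldl (M.step twoWay) { state := M.start, head := 0, tape := fun _ => false }

/-- The first `ℓ` bits on the tape after `T` steps with independent uniform random bits. -/
noncomputable def RandTM.source {Q : ℕ} (M : RandTM Q) (twoWay : Bool) (T ℓ : ℕ) :
    PMF (BitStr ℓ) :=
  (PMF.uniformOfFintype (BitStr T)).map fun ω i => (M.run twoWay (List.ofFn ω)).tape (i.val : ℤ)

/-- Turing-machine sources on `ℓ` bits with `Q` states and running time `T`; the tape may be
one-way or two-way infinite. -/
def tmSources (Q T ℓ : ℕ) : Set (PMF (BitStr ℓ)) :=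
  {X | ∃ (twoWay : Bool) (M : RandTM Q), X = M.source twoWay T ℓ}

/-- The quantity `√(log Q · T log T)`, logarithms to base 2. -/
noncomputable def tmParam (Q T : ℕ) : ℝ :=
  Real.sqrt (Real.logb 2 Q * (T * Real.logb 2 T))

/-! ### The hard distributions -/

/-- Concatenation of `t` strings of length `n`. -/
def concatBits {t n : ℕ} (x : Fin t → BitStr n) : BitStr (t * n) :=
  fun i => x i.divNat i.modNat

/-- The distribution `(U₁ᴬ, …, U_tᴬ, U₁ᴮ, …, U_tᴮ, Iso(U₁ᴬ, U₁ᴮ), …, Iso(U_tᴬ, U_tᴮ))` with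
independent uniform `n`-bit strings `Uᵢᴬ`, `Uᵢᴮ`. -/
noncomputable def hardDist (n t : ℕ) (Iso : BitStr n × BitStr n → Bool) :
    PMF (BitStr (t * n + t * n + t)) :=
  (PMF.uniformOfFintype ((Fin t → BitStr n) × (Fin t → BitStr n))).map fun u =>
    Fin.append (Fin.append (concatBits u.1) (concatBits u.2)) fun i => Iso (u.1 i, u.2 i)

/-- The distribution `(U, Iso(U))` with a uniform `n`-bit string `U`. -/
noncomputable def hardDistOne (n : ℕ) (Iso : BitStr n → Bool) : PMF (BitStr (n + 1)) :=
  (PMF.uniformOfFintype (BitStr n)).map fun u => Fin.append u fun _ : Fin 1 => Iso u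

/-! ### Polynomial time -/

/-- The input `(1^a, 1^b, w)` written as the word `1^a # 1^b # w`, the separator being `none`. -/
def encodeInput (p : ℕ × ℕ × List Bool) : List (Option Bool) :=
  List.replicate p.1 (some true) ++ none ::
    (List.replicate p.2.1 (some true) ++ none :: p.2.2.map some)

/-- `f` is computed by a deterministic multi-stack Turing machine in time polynomial in the length
of the input `(1^a, 1^b, w)`. -/
def IsPolyTime (f : ℕ × ℕ × List Bool → List Bool) : Prop :=
  Nonempty (Turing.TM2ComputableInPolyTime encodeInput (id : List Bool → List Bool) f)

/-- The functions `Iso n m` are explicit: one algorithm computes `Iso n m (x, y)` from `1^n`,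
`1^m`, `x`, `y` in time polynomial in `n + m`. -/
def IsExplicit (Iso : (n m : ℕ) → BitStr n × BitStr n → Bool) : Prop :=
  ∃ f, IsPolyTime f ∧
    ∀ (n m : ℕ) (x y : BitStr n), f (n, m, List.ofFn x ++ List.ofFn y) = [Iso n m (x, y)]

/-- The distributions `D N b`, for the pairs `(N, b)` in `S`, can be sampled by one randomized
algorithm that gets `1^N` and `1^b` as input and runs in polynomial time: a deterministic
polynomial-time algorithm that is given in addition a string of `p(N)` independent uniform bits,
with `p` a polynomial, outputs exactly the distribution `D N b`. -/
def IsPolySamplable (S : ℕ → ℕ → Prop) (len : ℕ → ℕ → ℕ)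
    (D : (N b : ℕ) → PMF (BitStr (len N b))) : Prop :=
  ∃ (f : ℕ × ℕ × List Bool → List Bool) (p : Polynomial ℕ), IsPolyTime f ∧
    ∀ N b, S N b →
      (PMF.uniformOfFintype (BitStr (p.eval N))).map (fun r => f (N, b, List.ofFn r)) =
        (D N b).map List.ofFn

/-- The range of parameters `C log N ≤ b ≤ δ₁ N`, with `N ≥ 2`. -/
def Admissible (C δ₁ : ℝ) (N b : ℕ) : Prop :=
  2 ≤ N ∧ C * Real.logb 2 N ≤ b ∧ (b : ℝ) ≤ δ₁ * N

/-!
The isolator `isoFun n m` accepts `(x, y)` if the inner products modulo 2 of `y` with `x` and its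
first `m - 1` shifts all vanish. A nontrivial sum of these shifts determines `x` up to `m` bits, so
the indicator function of acceptance is `2^{-m}` plus a combination of nontrivial characters whose
sums over product functions without heavy points are small by the inequality of Cauchy and Schwarz.
This is the notion `Mixes`, proved in `mixes_isoFun`. A communication source of cost `c` is a sum of
`2^c` product functions, and a light point of the source can be heavy for one factor of a product
only if it is very light for the other one; hence mixing functions are isolators
(`Mixes.isIsolator`). For single strings of length `n = 96 b`, the isolator `isoThirds` is the inner
product of the first and the last third; it factors through the two halves, and the middle third
leaves room for a cut.

A Turing machine is turned into such a sum by cutting its tape. For one of many possible cuts, the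
head crosses the cut rarely on average, so by Markov's inequality rarely with high probability. If
the random bits used on the two sides of the cut are independent, then the runs with a given
sequence of crossings form a rectangle, by cutting and pasting two runs (`Glued.run`), and there are
at most `(T Q + 1)^q` sequences with at most `q` crossings. This gives `RandTM.exists_products`.

A test that distinguishes `(x, y, z)`, `z` consisting of isolator values, from such a source checks
that the values are right and that no block is heavy for any of the products. For a single block the
source passes with probability about one half (`quarter_le_tvDist_hardDistOne`). For `t` blocks the
test considers seven eighths of them, and also demands that one of the values is one
(`le_tvDist_hardDist`). The hard distribution fails this with probability about
`(1 - 2^{-m})^{7t/8}`, and the source passes with probability about `2^{-m}`, since the index of a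
block with value one is known on one side of the cut. As `t = m 2^m`, both are of order `m / t`,
that is, of order `(s / N) log (N / s)`.

The polynomial-time claims refer to multi-stack Turing machines. They are obtained from a small
language `Prog` whose only loop repeats its body as often as the input has symbols, so that every
program with bounded nesting of loops runs in polynomial time (`Prog.isPolyTime`); the isolator and
the two samplers are programs of this language.
-/

/-! ### Structured stack programs and their compilation to Turing machines -/

/-- The alphabet of the working stacks: two bits and a separator. -/
abbrev StackSym : Type := Option Bool

/-- Structured programs over stacks indexed by `κ`, with a write-only output stack of bits. The
program `pop i k` pops a symbol from stack `i` and continues according to the result, and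
`loop i k` repeats `k a` for the symbol `a` popped from stack `i` until that stack is empty. -/
inductive Cmd (κ : Type) : Type
  | skip : Cmd κ
  | push (i : κ) (a : StackSym) : Cmd κ
  | emit (b : Bool) : Cmd κ
  | seq (p q : Cmd κ) : Cmd κ
  | pop (i : κ) (k : Option StackSym → Cmd κ) : Cmd κ
  | loop (i : κ) (k : StackSym → Cmd κ) : Cmd κ

namespace Cmd

variable {κ : Type}

/-- The contents of the working stacks and of the output stack. -/
abbrev Store (κ : Type) : Type := (κ → List StackSym) × List Bool

/-- `Exec c s s' n`: the program `c` leads from the store `s` to the store `s'` in `n` steps. -/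
inductive Exec [DecidableEq κ] : Cmd κ → Store κ → Store κ → ℕ → Prop
  | skip (s : Store κ) : Exec .skip s s 1
  | push (i : κ) (a : StackSym) (s : κ → List StackSym) (o : List Bool) :
      Exec (.push i a) (s, o) (Function.update s i (a :: s i), o) 1
  | emit (b : Bool) (s : κ → List StackSym) (o : List Bool) : Exec (.emit b) (s, o) (s, b :: o) 1
  | seq {p q : Cmd κ} {s s₁ s₂ : Store κ} {m n : ℕ} :
      Exec p s s₁ m → Exec q s₁ s₂ n → Exec (.seq p q) s s₂ (m + n)
  | pop {i : κ} {k : Option StackSym → Cmd κ} {s : κ → List StackSym} {o : List Bool} {s₂ : Store κ} {n : ℕ} :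
      Exec (k (s i).head?) (Function.update s i (s i).tail, o) s₂ n →
        Exec (.pop i k) (s, o) s₂ (n + 1)
  | loop_nil {i : κ} {k : StackSym → Cmd κ} {s : κ → List StackSym} {o : List Bool} :
      s i = [] → Exec (.loop i k) (s, o) (s, o) 1
  | loop_cons {i : κ} {k : StackSym → Cmd κ} {s : κ → List StackSym} {o : List Bool} {a : StackSym}
      {l : List StackSym} {s₁ s₂ : Store κ} {m n : ℕ} :
      s i = a :: l → Exec (k a) (Function.update s i l, o) s₁ m → Exec (.loop i k) s₁ s₂ n →
        Exec (.loop i k) (s, o) s₂ (m + n + 1)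

/-- The control points of a program. -/
def Pos : Cmd κ → Type
  | .skip => Unit
  | .push _ _ => Unit
  | .emit _ => Unit
  | .seq p q => Pos p ⊕ Pos q
  | .pop _ k => Unit ⊕ Σ a, Pos (k a)
  | .loop _ k => Unit ⊕ Σ a, Pos (k a)

theorem nonempty_fintype_pos : ∀ c : Cmd κ, Nonempty (Fintype (Pos c))
  | .skip => ⟨inferInstanceAs (Fintype Unit)⟩
  | .push _ _ => ⟨inferInstanceAs (Fintype Unit)⟩
  | .emit _ => ⟨inferInstanceAs (Fintype Unit)⟩
  | .seq p q => by
    obtain ⟨_⟩ := nonempty_fintype_pos p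
    obtain ⟨_⟩ := nonempty_fintype_pos q
    exact ⟨inferInstanceAs (Fintype (Pos p ⊕ Pos q))⟩
  | .pop _ k => by
    have := fun a => Classical.choice (nonempty_fintype_pos (k a))
    exact ⟨inferInstanceAs (Fintype (Unit ⊕ Σ a, Pos (k a)))⟩
  | .loop _ k => by
    have := fun a => Classical.choice (nonempty_fintype_pos (k a))
    exact ⟨inferInstanceAs (Fintype (Unit ⊕ Σ a, Pos (k a)))⟩

/-- The control point at which the execution of a program starts. -/
def entry : (c : Cmd κ) → Pos c
  | .skip => ()
  | .push _ _ => ()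
  | .emit _ => ()
  | .seq p _ => Sum.inl (entry p)
  | .pop _ _ => Sum.inl ()
  | .loop _ _ => Sum.inl ()

/-- The stack alphabets of the compiled machine; the output stack has index `none`. -/
abbrev Alph (κ : Type) : Option κ → Type
  | none => Bool
  | some _ => StackSym

/-- The stacks of the compiled machine. -/
def tmStacks (s : Store κ) : (k : Option κ) → List (Alph κ k)
  | none => s.2
  | some i => s.1 i

/-- The statement at a control point of a program that is placed into a larger machine by `f` and
continues at the label `e`. The local variable of the machine holds the symbol popped last. -/
def code {Λ : Type} : (c : Cmd κ) → (Pos c → Λ) → Λ → Pos c →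
    Turing.TM2.Stmt (Alph κ) Λ (Option StackSym)
  | .skip, _, e, _ => .goto fun _ => e
  | .push i a, _, e, _ => .push (some i) (fun _ => a) (.goto fun _ => e)
  | .emit b, _, e, _ => .push none (fun _ => b) (.goto fun _ => e)
  | .seq p q, f, _, .inl l => code p (fun l => f (.inl l)) (f (.inr (entry q))) l
  | .seq _ q, f, e, .inr l => code q (fun l => f (.inr l)) e l
  | .pop i k, f, _, .inl _ =>
    .pop (some i) (fun _ a => a) (.goto fun v => f (.inr ⟨v, entry (k v)⟩))
  | .pop _ k, f, e, .inr ⟨a, l⟩ => code (k a) (fun l => f (.inr ⟨a, l⟩)) e l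
  | .loop i k, f, e, .inl _ =>
    .pop (some i) (fun _ a => a) (.goto fun v => v.elim e fun a => f (.inr ⟨a, entry (k a)⟩))
  | .loop _ k, f, _, .inr ⟨a, l⟩ => code (k a) (fun l => f (.inr ⟨a, l⟩)) (f (.inl ())) l

/-- Reachability in exactly `n` steps. -/
def StepsTo {σ : Type} (f : σ → Option σ) (n : ℕ) (a b : σ) : Prop :=
  (flip bind f)^[n] (some a) = some b

theorem StepsTo.trans {σ : Type} {f : σ → Option σ} {m n : ℕ} {a b c : σ} (h : StepsTo f m a b)
    (h' : StepsTo f n b c) : StepsTo f (m + n) a c := by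
  rw [StepsTo, add_comm, Function.iterate_add_apply, h, h']

variable [DecidableEq κ]

theorem tmStacks_update_some (s : κ → List StackSym) (o : List Bool) (i : κ)
    (l : List StackSym) :
    Function.update (β := fun k => List (Alph κ k)) (tmStacks (s, o)) (some i) l =
      tmStacks (Function.update s i l, o) := by
  funext k
  cases k with
  | none => exact Function.update_of_ne (by simp) _ _
  | some j =>
    by_cases h : j = i
    · subst h
      rw [Function.update_self]
      exact (Function.update_self (f := s) ..).symm
    · rw [Function.update_of_ne (by simpa using h)]
      exact (Function.update_of_ne h _ _).symm

theorem tmStacks_update_none (s : κ → List StackSym) (o l : List Bool) :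
    Function.update (β := fun k => List (Alph κ k)) (tmStacks (s, o)) none l =
      tmStacks (s, l) := by
  funext k
  cases k with
  | none => exact Function.update_self ..
  | some j => exact Function.update_of_ne (by simp) _ _

theorem stepsTo_one {Λ : Type} (M : Λ → Turing.TM2.Stmt (Alph κ) Λ (Option StackSym)) (l : Λ)
    (q : Turing.TM2.Stmt (Alph κ) Λ (Option StackSym)) (hq : M l = q) (v : Option StackSym)
    (S : (k : Option κ) → List (Alph κ k)) (c : Turing.TM2.Cfg (Alph κ) Λ (Option StackSym))
    (h : Turing.TM2.stepAux q v S = c) :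
    StepsTo (Turing.TM2.step M) 1 ⟨some l, v, S⟩ c := by
  subst hq h
  rfl

/-- A machine that contains the code of a program follows its execution. -/
theorem Exec.stepsTo {Λ : Type} (M : Λ → Turing.TM2.Stmt (Alph κ) Λ (Option StackSym)) {c : Cmd κ}
    {s s' : Store κ} {n : ℕ} (h : Exec c s s' n) :
    ∀ (f : Pos c → Λ) (e : Λ), (∀ l, M (f l) = code c f e l) → ∀ v, ∃ v',
      StepsTo (Turing.TM2.step M) n ⟨some (f (entry c)), v, tmStacks s⟩ ⟨some e, v', tmStacks s'⟩ := by
  induction h with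
  | skip s =>
    intro f e hf v
    exact ⟨v, stepsTo_one M _ _ (hf _) _ _ _ rfl⟩
  | push i a s o =>
    intro f e hf v
    refine ⟨v, stepsTo_one M _ _ (hf _) _ _ _ ?_⟩
    rw [← tmStacks_update_some]; rfl
  | emit b s o =>
    intro f e hf v
    refine ⟨v, stepsTo_one M _ _ (hf _) _ _ _ ?_⟩
    rw [← tmStacks_update_none s o (b :: o)]; rfl
  | @seq p q s s₁ s₂ m n _ _ ih₁ ih₂ =>
    intro f e hf v
    obtain ⟨v₁, h₁⟩ := ih₁ (fun l => f (.inl l)) (f (.inr (entry q))) (fun l => hf (.inl l)) v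
    obtain ⟨v₂, h₂⟩ := ih₂ (fun l => f (.inr l)) e (fun l => hf (.inr l)) v₁
    exact ⟨v₂, h₁.trans h₂⟩
  | @pop i k s o s₂ n _ ih =>
    intro f e hf v
    obtain ⟨v', h⟩ := ih (fun l => f (.inr ⟨_, l⟩)) e (fun l => hf (.inr ⟨_, l⟩)) (s i).head?
    refine ⟨v', ?_⟩
    rw [add_comm]
    refine StepsTo.trans (stepsTo_one M _ _ (hf _) _ _ _ ?_) h
    rw [← tmStacks_update_some]; rfl
  | @loop_nil i k s o hs =>
    intro f e hf v
    refine ⟨none, stepsTo_one M _ _ (hf _) _ _ _ ?_⟩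
    have h1 : tmStacks (s, o) (some i) = [] := hs
    have h2 : Function.update (β := fun k => List (Alph κ k)) (tmStacks (s, o)) (some i)
        [] = tmStacks (s, o) := by
      rw [← h1, Function.update_eq_self]
    change Turing.TM2.Cfg.mk (some (((tmStacks (s, o) (some i)).head?).elim e _))
      ((tmStacks (s, o) (some i)).head?) (Function.update (β := fun k => List (Alph κ k))
        (tmStacks (s, o)) (some i) (tmStacks (s, o) (some i)).tail) = _
    rw [h1, List.tail_nil, h2]
    rfl
  | @loop_cons i k s o a l s₁ s₂ m n hs _ _ ih₁ ih₂ =>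
    intro f e hf v
    obtain ⟨v₁, h₁⟩ := ih₁ (fun l => f (.inr ⟨a, l⟩)) (f (.inl ())) (fun l => hf (.inr ⟨a, l⟩))
      (some a)
    obtain ⟨v₂, h₂⟩ := ih₂ f e hf v₁
    refine ⟨v₂, ?_⟩
    rw [add_comm]
    refine StepsTo.trans (stepsTo_one M _ _ (hf _) _ _ _ ?_) (h₁.trans h₂)
    have h1 : tmStacks (s, o) (some i) = a :: l := hs
    change Turing.TM2.Cfg.mk (some (((tmStacks (s, o) (some i)).head?).elim e _))
      ((tmStacks (s, o) (some i)).head?) (Function.update (β := fun k => List (Alph κ k))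
        (tmStacks (s, o)) (some i) (tmStacks (s, o) (some i)).tail) = _
    rw [h1, ← tmStacks_update_some]
    rfl

theorem Exec.length_le {c : Cmd κ} {s s' : Store κ} {n : ℕ} (h : Exec c s s' n) (i : κ) :
    (s'.1 i).length ≤ (s.1 i).length + n := by
  induction h with
  | skip s => simp
  | push j a s o =>
    by_cases h : i = j
    · subst h; simp
    · simp [h]
  | emit b s o => simp
  | seq _ _ ih₁ ih₂ => omega
  | @pop j k s o s₂ n _ ih =>
    by_cases h : i = j
    · subst h; simp at ih ⊢; omega
    · simp [h] at ih ⊢; omega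
  | loop_nil hs => simp
  | @loop_cons j k s o a l s₁ s₂ m n hs _ _ ih₁ ih₂ =>
    by_cases h : i = j
    · subst h; simp [hs] at ih₁ ih₂ ⊢; omega
    · simp [h] at ih₁ ih₂ ⊢; omega

/-- The program that empties the stacks in the given list. -/
def clear (L : List κ) : Cmd κ := L.foldr (fun i c => .seq (.loop i fun _ => .skip) c) .skip

theorem exec_clear_loop (i : κ) (l : List StackSym) : ∀ (s : κ → List StackSym) (o : List Bool), s i = l →
    Exec (.loop i fun _ => .skip) (s, o) (Function.update s i [], o) (2 * l.length + 1) := by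
  induction l with
  | nil =>
    intro s o h
    rw [← h, Function.update_eq_self, h]
    exact .loop_nil h
  | cons a l ih =>
    intro s o h
    have := Exec.loop_cons (k := fun _ => .skip) h (.skip (Function.update s i l, o))
      (ih (Function.update s i l) o (by simp))
    rw [Function.update_idem] at this
    convert this using 1
    simp; ring

theorem exec_clear (L : List κ) (B : ℕ) : ∀ (s : κ → List StackSym) (o : List Bool),
    (∀ i, (s i).length ≤ B) →
    ∃ n ≤ L.length * (2 * B + 1) + 1,
      Exec (clear L) (s, o) (fun i => if i ∈ L then [] else s i, o) n := by
  induction L with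
  | nil => intro s o _; exact ⟨1, by simp, by simpa [clear] using Exec.skip _⟩
  | cons j L ih =>
    intro s o hs
    obtain ⟨n, hn, h⟩ := ih (Function.update s j []) o (by
      intro i
      by_cases h : i = j
      · subst h; simp
      · simpa [h] using hs i)
    refine ⟨2 * (s j).length + 1 + n, ?_, ?_⟩
    · have := hs j
      simp only [List.length_cons]
      nlinarith
    · refine Exec.seq (exec_clear_loop j _ s o rfl) ?_
      have e : (fun i => if i ∈ j :: L then [] else s i) =
          fun i => if i ∈ L then [] else Function.update s j [] i := by
        funext i
        by_cases h : i = j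
        · subst h; simp
        · simp [h]
      rw [e]
      exact h

/-- The program that moves stack `i`, in reverse order, to the output stack. -/
def flush (i : κ) : Cmd κ := .loop i fun a => .emit (a.getD false)

theorem exec_flush (i : κ) (l : List StackSym) : ∀ (s : κ → List StackSym) (o : List Bool), s i = l →
    Exec (flush i) (s, o) (Function.update s i [], (l.map (·.getD false)).reverse ++ o)
      (2 * l.length + 1) := by
  induction l with
  | nil =>
    intro s o h
    rw [← h, Function.update_eq_self, h]
    exact .loop_nil h
  | cons a l ih =>
    intro s o h
    have := Exec.loop_cons (k := fun a => .emit (a.getD false)) h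
      (.emit (a.getD false) (Function.update s i l) o)
      (ih (Function.update s i l) _ (by simp))
    rw [Function.update_idem] at this
    rw [List.map_cons, List.reverse_cons, List.append_assoc, List.length_cons,
      show 2 * (l.length + 1) + 1 = 1 + (2 * l.length + 1) + 1 by ring]
    exact this

end Cmd

/-! ### Clocked programs run in polynomial time -/

/-- Programs over registers indexed by `ι`: `pop` branches on the symbol removed, and `rep j p` repeats `p` as
often as the input is long. The iterations are counted with the help of the clock `j`, one of `D`
clocks. -/
inductive Prog (ι : Type) (D : ℕ) : Type
  | skip : Prog ι D
  | push (i : ι) (a : StackSym) : Prog ι D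
  | seq (p q : Prog ι D) : Prog ι D
  | pop (i : ι) (k : Option StackSym → Prog ι D) : Prog ι D
  | rep (j : Fin D) (p : Prog ι D) : Prog ι D

namespace Prog

variable {ι : Type} [DecidableEq ι] {D : ℕ}

/-- The contents of the registers. -/
abbrev Regs (ι : Type) : Type := ι → List StackSym

/-- The effect of a program on the registers, for inputs of length `B`. -/
def eval (B : ℕ) : Prog ι D → Regs ι → Regs ι
  | .skip, s => s
  | .push i a, s => Function.update s i (a :: s i)
  | .seq p q, s => eval B q (eval B p s)
  | .pop i k, s => eval B (k (s i).head?) (Function.update s i (s i).tail)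
  | .rep _ p, s => (eval B p)^[B] s

/-- A program is well formed up to `d` if it uses only the clocks below `d`, and nested repetitions
use decreasing clocks. -/
def WF : Prog ι D → ℕ → Prop
  | .skip, _ => True
  | .push _ _, _ => True
  | .seq p q, d => WF p d ∧ WF q d
  | .pop _ k, d => ∀ a, WF (k a) d
  | .rep j p, d => j < d ∧ WF p j

/-- The working stacks of the machine: the input stack, the registers, and two stacks for each
clock, on which the expired and the remaining ticks are stored. -/
abbrev Cell (ι : Type) (D : ℕ) : Type := Unit ⊕ ι ⊕ (Fin D × Bool)

/-- A register as a stack. -/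
abbrev reg (i : ι) : Cell ι D := .inr (.inl i)

/-- A clock stack; `true` stands for the ticks that remain. -/
abbrev clk (j : Fin D) (b : Bool) : Cell ι D := .inr (.inr (j, b))

/-- The translation into structured stack programs. -/
def toCmd : Prog ι D → Cmd (Cell ι D)
  | .skip => .skip
  | .push i a => .push (reg i) a
  | .seq p q => .seq (toCmd p) (toCmd q)
  | .pop i k => .pop (reg i) fun a => toCmd (k a)
  | .rep j p =>
    .seq (.loop (clk j true) fun a => .seq (.push (clk j false) a) (toCmd p))
      (.loop (clk j false) fun a => .push (clk j true) a)

/-- The stacks with the given input stack, registers and clocks. -/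
def join (w : List StackSym) (s : Regs ι) (c : Fin D × Bool → List StackSym) :
    Cell ι D → List StackSym
  | .inl _ => w
  | .inr (.inl i) => s i
  | .inr (.inr x) => c x

theorem join_update_reg (w : List StackSym) (s : Regs ι) (c : Fin D × Bool → List StackSym)
    (i : ι) (l : List StackSym) :
    Function.update (join w s c) (reg i) l = join w (Function.update s i l) c := by
  funext x
  rcases x with x | x | x
  · simp [join]
  · by_cases h : x = i
    · subst h; simp [join]
    · simp [join, h]
  · simp [join]

theorem join_update_clk (w : List StackSym) (s : Regs ι) (c : Fin D × Bool → List StackSym)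
    (x : Fin D × Bool) (l : List StackSym) :
    Function.update (join w s c) (.inr (.inr x)) l = join w s (Function.update c x l) := by
  funext y
  rcases y with y | y | y
  · simp [join]
  · simp [join]
  · by_cases h : y = x
    · subst h; simp [join]
    · simp [join, h]

/-- The clock stacks after giving clock `j` the remaining ticks `x` and the expired ticks `y`. -/
def setClk (c : Fin D × Bool → List StackSym) (j : Fin D) (x y : List StackSym) :
    Fin D × Bool → List StackSym :=
  fun z => if z.1 = j then if z.2 then x else y else c z

theorem setClk_self (c : Fin D × Bool → List StackSym) (j : Fin D) :
    setClk c j (c (j, true)) (c (j, false)) = c := by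
  funext ⟨i, b⟩
  by_cases h : i = j
  · subst h; cases b <;> simp [setClk]
  · simp [setClk, h]

theorem join_update_setClk_true (w : List StackSym) (s : Regs ι)
    (c : Fin D × Bool → List StackSym) (j : Fin D) (x y l : List StackSym) :
    Function.update (join w s (setClk c j x y)) (clk j true) l = join w s (setClk c j l y) := by
  rw [join_update_clk]
  congr 1
  funext ⟨i, b⟩
  by_cases h : i = j
  · subst h; cases b <;> simp [setClk]
  · simp [setClk, h]

theorem join_update_setClk_false (w : List StackSym) (s : Regs ι)
    (c : Fin D × Bool → List StackSym) (j : Fin D) (x y l : List StackSym) :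
    Function.update (join w s (setClk c j x y)) (clk j false) l = join w s (setClk c j x l) := by
  rw [join_update_clk]
  congr 1
  funext ⟨i, b⟩
  by_cases h : i = j
  · subst h; cases b <;> simp [setClk]
  · simp [setClk, h]

theorem exec_reset (j : Fin D) (w : List StackSym) (s : Regs ι) (o : List Bool)
    (c : Fin D × Bool → List StackSym) (n : ℕ) : ∀ m : ℕ,
      Cmd.Exec (.loop (clk j false) fun a => .push (clk j true) a)
        (join w s (setClk c j (List.replicate m (some true)) (List.replicate n (some true))), o)
        (join w s (setClk c j (List.replicate (m + n) (some true)) []), o) (2 * n + 1) := by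
  induction n with
  | zero => exact fun m => .loop_nil (by simp [join, setClk])
  | succ n ih =>
    intro m
    have h := ih (m + 1)
    rw [show m + 1 + n = m + (n + 1) by ring] at h
    rw [show 2 * (n + 1) + 1 = 1 + (2 * n + 1) + 1 by ring]
    refine Cmd.Exec.loop_cons (a := some true) (l := List.replicate n (some true))
      (by simp [join, setClk, List.replicate_succ]) (Cmd.Exec.push _ _ _ _) ?_
    rw [join_update_setClk_false, join_update_setClk_true,
      show join w s (setClk c j (List.replicate m (some true)) (List.replicate n (some true)))
        (clk j true) = List.replicate m (some true) by simp [join, setClk], ← List.replicate_succ]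
    exact h

/-- The stack program follows the evaluation in polynomial time, and restores the clocks. -/
theorem exec_toCmd (p : Prog ι D) : ∀ d, p.WF d → ∃ P : Polynomial ℕ, ∀ (B : ℕ)
    (w : List StackSym) (s : Regs ι) (c : Fin D × Bool → List StackSym) (o : List Bool),
    (∀ j : Fin D, j < d → c (j, true) = List.replicate B (some true) ∧ c (j, false) = []) →
    ∃ n ≤ P.eval B, Cmd.Exec p.toCmd (join w s c, o) (join w (p.eval B s) c, o) n := by
  induction p with
  | skip => exact fun d _ => ⟨1, fun B w s c o _ => ⟨1, by simp, .skip _⟩⟩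
  | push i a =>
    refine fun d _ => ⟨1, fun B w s c o _ => ⟨1, by simp, ?_⟩⟩
    rw [eval, ← join_update_reg]
    exact .push _ _ _ _
  | seq p q ihp ihq =>
    intro d hd
    obtain ⟨P, hP⟩ := ihp d hd.1
    obtain ⟨Q, hQ⟩ := ihq d hd.2
    refine ⟨P + Q, fun B w s c o hc => ?_⟩
    obtain ⟨m, hm, h1⟩ := hP B w s c o hc
    obtain ⟨n, hn, h2⟩ := hQ B w (p.eval B s) c o hc
    exact ⟨m + n, by simpa using add_le_add hm hn, h1.seq h2⟩
  | pop i k ih =>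
    intro d hd
    choose P hP using fun a => ih a d (hd a)
    refine ⟨∑ a, P a + 1, fun B w s c o hc => ?_⟩
    obtain ⟨n, hn, h⟩ := hP (s i).head? B w (Function.update s i (s i).tail) c o hc
    refine ⟨n + 1, ?_, ?_⟩
    · have : (P (s i).head?).eval B ≤ ∑ a, (P a).eval B :=
        Finset.single_le_sum (f := fun a => (P a).eval B) (fun _ _ => Nat.zero_le _)
          (Finset.mem_univ _)
      simp only [Polynomial.eval_add, Polynomial.eval_finsetSum, Polynomial.eval_one]
      omega
    · refine Cmd.Exec.pop ?_
      rw [join_update_reg]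
      exact h
  | rep j p ih =>
    intro d hd
    obtain ⟨P, hP⟩ := ih j hd.2
    refine ⟨(P + 2) * Polynomial.X + 1 + (2 * Polynomial.X + 1), fun B w s c o hc => ?_⟩
    obtain ⟨hc1, hc2⟩ := hc j hd.1
    have main : ∀ (l : ℕ) (t : Regs ι) (u : ℕ), ∃ n ≤ (P.eval B + 2) * l + 1,
        Cmd.Exec (.loop (clk j true) fun a => .seq (.push (clk j false) a) (toCmd p))
          (join w t (setClk c j (List.replicate l (some true)) (List.replicate u (some true))), o)
          (join w ((p.eval B)^[l] t) (setClk c j [] (List.replicate (u + l) (some true))), o)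
          n := by
      intro l
      induction l with
      | zero => exact fun t u => ⟨1, by simp, .loop_nil (by simp [join, setClk])⟩
      | succ l ihl =>
        intro t u
        obtain ⟨n, hn, h⟩ := ihl (p.eval B t) (u + 1)
        obtain ⟨n', hn', h'⟩ := hP B w t (setClk c j (List.replicate l (some true))
            (List.replicate (u + 1) (some true))) o (by
          intro j' hj'
          have : j' ≠ j := fun h => by subst h; exact lt_irrefl _ hj'
          simpa [setClk, this] using hc j' (hj'.trans hd.1))
        refine ⟨1 + n' + n + 1, ?_, ?_⟩
        · rw [mul_add]; omega
        · refine Cmd.Exec.loop_cons (a := some true) (l := List.replicate l (some true))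
            (by simp [join, setClk, List.replicate_succ]) (Cmd.Exec.seq (.push _ _ _ _)
            (s₂ := (join w (p.eval B t) (setClk c j (List.replicate l (some true))
              (List.replicate (u + 1) (some true))), o)) ?_) ?_
          · rw [join_update_setClk_true, join_update_setClk_false,
              show join w t (setClk c j (List.replicate l (some true))
                (List.replicate u (some true))) (clk j false) = List.replicate u (some true) by
                  simp [join, setClk], ← List.replicate_succ]
            exact h'
          · rw [Function.iterate_succ_apply, show u + (l + 1) = u + 1 + l by ring]
            exact h
    obtain ⟨n, hn, h⟩ := main B s 0
    have e : setClk c j (List.replicate B (some true)) [] = c := by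
      rw [← hc1, ← hc2, setClk_self]
    refine ⟨n + (2 * B + 1), ?_, ?_⟩
    · simp only [Polynomial.eval_add, Polynomial.eval_mul, Polynomial.eval_X,
        Polynomial.eval_one, Polynomial.eval_ofNat]
      omega
    · rw [List.replicate_zero, e] at h
      refine Cmd.Exec.seq h ?_
      have := exec_reset j w ((p.eval B)^[B] s) o c B 0
      rw [zero_add, e, List.replicate_zero] at this
      rw [zero_add]
      exact this

end Prog

namespace Cmd

variable {κ : Type}

/-- The bundled machine that runs a program and then halts. -/
noncomputable def machine [DecidableEq κ] [Fintype κ] (c : Cmd κ) (i : κ) : Turing.FinTM2 where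
  K := Option κ
  k₀ := some i
  k₁ := none
  Γ := Alph κ
  Λ := Option (Pos c)
  main := some (entry c)
  ΛFin := @instFintypeOption _ (Classical.choice (nonempty_fintype_pos c))
  σ := Option StackSym
  initialState := none
  Γk₀Fin := inferInstanceAs (Fintype StackSym)
  m := fun l => l.elim (.load (fun _ => none) .halt) fun l => code c some none l

/-- A program that leaves `f a` on the output stack, all other stacks being empty, in polynomially
many steps shows that `f` is computable in polynomial time. -/
theorem isPolyTime_of_exec [DecidableEq κ] [Fintype κ] (c : Cmd κ) (i : κ)
    (f : ℕ × ℕ × List Bool → List Bool) (P : Polynomial ℕ)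
    (h : ∀ a, ∃ n ≤ P.eval (encodeInput a).length,
      Exec c (Function.update (fun _ => []) i (encodeInput a), []) (fun _ => [], f a) n) :
    IsPolyTime f := by
  refine ⟨⟨⟨machine c i, Equiv.refl _, Equiv.refl _⟩, P + 1, fun a => ?_⟩⟩
  choose n hn h using h
  refine ⟨⟨n a + 1, ?_⟩, ?_⟩
  · have hinit : Turing.initList (machine c i) (encodeInput a) =
        (⟨some (some (entry c)), none,
          tmStacks (Function.update (fun _ => []) i (encodeInput a), [])⟩ :
          Turing.TM2.Cfg (Alph κ) (Option (Pos c)) (Option StackSym)) := by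
      unfold Turing.initList
      congr 1
      funext k
      cases k with
      | none => exact dif_neg (by simp [machine])
      | some j =>
        by_cases hj : j = i
        · subst hj
          refine (dif_pos rfl).trans ?_
          exact (Function.update_self j (encodeInput a) (fun _ => [])).symm
        · refine (dif_neg fun e => hj (Option.some.inj e)).trans ?_
          exact (Function.update_of_ne hj (encodeInput a) (fun _ => [])).symm
    have hhalt : Turing.haltList (machine c i) (f a) =
        (⟨none, none, tmStacks (fun _ => [], f a)⟩ :
          Turing.TM2.Cfg (Alph κ) (Option (Pos c)) (Option StackSym)) := by
      unfold Turing.haltList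
      congr 1
      funext k
      cases k with
      | none => exact dif_pos rfl
      | some j => exact dif_neg (by simp [machine])
    obtain ⟨v, hv⟩ := (h a).stepsTo (machine c i).m some none (fun _ => rfl) none
    have h1 := hv.trans (stepsTo_one (machine c i).m none (.load (fun _ => none) .halt) rfl v
      (tmStacks (fun _ => [], f a)) ⟨none, none, tmStacks (fun _ => [], f a)⟩ rfl)
    have e1 : List.map (Equiv.refl ((machine c i).Γ (machine c i).k₀)).invFun (encodeInput a) =
        encodeInput a := List.map_id _
    have e2 : List.map (Equiv.refl ((machine c i).Γ (machine c i).k₁)).invFun (f a) = f a :=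
      List.map_id _
    exact (congrArg (fun l => (flip bind (machine c i).step)^[n a + 1]
      (some (Turing.initList (machine c i) l))) e1).trans
      ((congrArg (fun b => (flip bind (machine c i).step)^[n a + 1] (some b)) hinit).trans
      (Eq.trans h1 ((congrArg some hhalt.symm).trans
      (congrArg (fun l => some (Turing.haltList (machine c i) l)) e2.symm))))
  · have := hn a
    simp only [Polynomial.eval_add, Polynomial.eval_one]
    omega

end Cmd

namespace Prog

variable {ι : Type} [DecidableEq ι] {D : ℕ}

/-- The program that adds a tick to each of the clocks in the list. -/
def tick (L : List (Fin D)) : Cmd (Cell ι D) :=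
  L.foldr (fun j c => .seq (.push (clk j true) (some true)) c) .skip

/-- The clock stacks with `n` remaining ticks on each clock. -/
def ticks (n : ℕ) : Fin D × Bool → List StackSym :=
  fun x => if x.2 then List.replicate n (some true) else []

theorem exec_tick (L : List (Fin D)) (w : List StackSym) (s : Regs ι) (o : List Bool) :
    ∀ c : Fin D × Bool → List StackSym, L.Nodup →
    Cmd.Exec (tick L) (join w s c, o) (join w s (fun x => if x.2 ∧ x.1 ∈ L then
      some true :: c x else c x), o) (L.length + 1) := by
  induction L with
  | nil => intro c _; simpa [tick] using Cmd.Exec.skip _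
  | cons j L ih =>
    intro c hL
    have h := ih (Function.update c (j, true) (some true :: c (j, true))) (List.nodup_cons.1 hL).2
    rw [List.length_cons, add_comm, ]
    refine Cmd.Exec.seq (Cmd.Exec.push _ _ _ _) ?_
    rw [join_update_clk]
    have e : (fun x : Fin D × Bool => if x.2 ∧ x.1 ∈ j :: L then some true :: c x else c x) =
        fun x => if x.2 ∧ x.1 ∈ L then
          some true :: Function.update c (j, true) (some true :: c (j, true)) x else
          Function.update c (j, true) (some true :: c (j, true)) x := by
      have := (List.nodup_cons.1 hL).1
      funext ⟨i, b⟩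
      by_cases hi : i = j
      · subst hi; cases b <;> simp [this]
      · simp [hi]
    rw [e]
    exact h

/-- The program that moves the input, in reverse order, to register `i` and winds the clocks. -/
def load (i : ι) : Cmd (Cell ι D) :=
  .loop (.inl ()) fun a => .seq (.push (reg i) a) (tick (List.finRange D))

theorem exec_load (i : ι) (o : List Bool) (w : List StackSym) : ∀ (s : Regs ι) (n : ℕ),
    Cmd.Exec (load i) (join w s (ticks (D := D) n), o)
      (join [] (Function.update s i (w.reverse ++ s i)) (ticks (n + w.length)), o)
      ((D + 3) * w.length + 1) := by
  induction w with
  | nil => intro s n; simpa [load] using Cmd.Exec.loop_nil (by simp [join])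
  | cons a w ih =>
    intro s n
    have h := ih (Function.update s i (a :: s i)) (n + 1)
    rw [Function.update_idem, Function.update_self, show n + 1 + w.length = n + (a :: w).length by
      simp; ring] at h
    rw [List.reverse_cons, List.append_assoc, List.singleton_append,
      show (D + 3) * (a :: w).length + 1 =
        (1 + ((List.finRange D).length + 1)) + ((D + 3) * w.length + 1) + 1 by simp; ring]
    refine Cmd.Exec.loop_cons (a := a) (l := w) rfl (Cmd.Exec.seq (Cmd.Exec.push _ _ _ _) (s₂ :=
      (join w (Function.update s i (a :: s i)) (ticks (n + 1)), o)) ?_) h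
    have e : Function.update (join (a :: w) s (ticks (D := D) n)) (.inl ()) w =
        join w s (ticks n) := by
      funext x
      rcases x with x | x | x <;> simp [join]
    rw [e, join_update_reg]
    have := exec_tick (List.finRange D) w (Function.update s i (a :: s i)) o (ticks n)
      (List.nodup_finRange D)
    convert this using 3
    congr 1
    funext ⟨j, b⟩
    cases b <;> simp [ticks, List.replicate_succ]

/-- The output of a program: the contents of three registers, bottom to top, one after the other. -/
def result (s : Regs ι) (x y z : ι) : List Bool :=
  ((s x).map (·.getD false)).reverse ++ ((s y).map (·.getD false)).reverse ++
    ((s z).map (·.getD false)).reverse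

/-- Every well-formed program computes a function in polynomial time. -/
theorem isPolyTime [Fintype ι] (p : Prog ι D) (hp : p.WF D) (i x y z : ι) (hxy : x ≠ y) (hxz : x ≠ z)
    (hyz : y ≠ z) :
    IsPolyTime fun a => result (p.eval (encodeInput a).length
      (Function.update (fun _ => []) i (encodeInput a).reverse)) x y z := by
  obtain ⟨P, hP⟩ := exec_toCmd p D hp
  let Q : Polynomial ℕ := ((D + 4 : ℕ) : Polynomial ℕ) * Polynomial.X + 1 + P
  refine Cmd.isPolyTime_of_exec (.seq (load i) (.seq p.toCmd (.seq (Cmd.flush (reg z))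
    (.seq (Cmd.flush (reg y)) (.seq (Cmd.flush (reg x))
    (Cmd.clear (Finset.univ : Finset (Cell ι D)).toList)))))) (.inl ()) _
    (Q + 3 * (2 * Q + 1) + (((Finset.univ : Finset (Cell ι D)).toList.length : ℕ) *
      (2 * Q + 1) + 1)) fun a => ?_
  set w := encodeInput a
  have e0 : Function.update (fun _ : Cell ι D => ([] : List StackSym)) (.inl ()) w =
      join w (fun _ => []) (ticks 0) := by
    funext c
    rcases c with c | c | ⟨c, b⟩ <;> simp [join, ticks]
  rw [e0]
  have h1 := exec_load (D := D) i [] w (fun _ => []) 0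
  rw [zero_add, List.append_nil] at h1
  set s0 : Regs ι := Function.update (fun _ => []) i w.reverse
  obtain ⟨n, hn, h2⟩ := hP w.length [] s0 (ticks w.length) [] (fun j _ => by simp [ticks])
  set s := p.eval w.length s0
  have hQ : Q.eval w.length = (D + 4) * w.length + 1 + P.eval w.length := by
    simp [Q]
  have h12 := h1.seq h2
  have hlen : ∀ c, (join [] s (ticks (D := D) w.length) c).length ≤ Q.eval w.length := by
    intro c
    have := h12.length_le c
    have h0 : (join (ι := ι) (D := D) w (fun _ => []) (ticks 0) c).length ≤ w.length := by
      rcases c with c | c | ⟨c, b⟩ <;> simp [join, ticks]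
    rw [hQ, add_mul]
    simp only at this
    rw [add_mul] at this
    omega
  set S := join [] s (ticks (D := D) w.length)
  have h3 := Cmd.exec_flush (reg z) _ S [] rfl
  have h4 := Cmd.exec_flush (reg y) _ (Function.update S (reg z) [])
    (((S (reg z)).map (·.getD false)).reverse ++ []) (Function.update_of_ne (by simpa using hyz) _ _)
  have h5 := Cmd.exec_flush (reg x) _ (Function.update (Function.update S (reg z) []) (reg y) [])
    (((S (reg y)).map (·.getD false)).reverse ++ (((S (reg z)).map (·.getD false)).reverse ++ []))
    ((Function.update_of_ne (by simpa using hxy) _ _).trans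
    (Function.update_of_ne (by simpa using hxz) _ _))
  obtain ⟨n', hn', h6⟩ := Cmd.exec_clear (Finset.univ : Finset (Cell ι D)).toList (Q.eval w.length)
    (Function.update (Function.update (Function.update S (reg z) []) (reg y) []) (reg x) [])
    (((S (reg x)).map (·.getD false)).reverse ++ (((S (reg y)).map (·.getD false)).reverse ++
      (((S (reg z)).map (·.getD false)).reverse ++ []))) (by
        have hup : ∀ (T : Cell ι D → List StackSym) (c₀ : Cell ι D),
            (∀ c, (T c).length ≤ Q.eval w.length) → ∀ c,
            (Function.update T c₀ [] c).length ≤ Q.eval w.length := by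
          intro T c₀ hT c
          by_cases h : c = c₀
          · subst h; simp
          · simpa [h] using hT c
        exact hup _ _ (hup _ _ (hup _ _ hlen)))
  refine ⟨_, ?_, h1.seq (h2.seq (h3.seq (h4.seq (h5.seq (n := n') ?_))))⟩
  rotate_right
  · convert h6 using 2
    · simp
    · simp only [List.append_nil, result, List.append_assoc]
      rfl
  · have hx := hlen (reg x)
    have hy := hlen (reg y)
    have hz := hlen (reg z)
    simp only [Polynomial.eval_add, Polynomial.eval_mul, Polynomial.eval_natCast,
      Polynomial.eval_one, Polynomial.eval_ofNat]
    have : (D + 3) * w.length ≤ (D + 4) * w.length := Nat.mul_le_mul_right _ (by omega)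
    simp only [Nat.cast_id] at hn' ⊢
    omega

end Prog

/-! ### Loops over registers -/

set_option linter.unusedSectionVars false

namespace Prog

variable {ι : Type} [DecidableEq ι] {D : ℕ}

/-- The program neither reads nor writes register `i`. -/
def Avoids (i : ι) : Prog ι D → Prop
  | .skip => True
  | .push k _ => k ≠ i
  | .seq p q => Avoids i p ∧ Avoids i q
  | .pop k f => k ≠ i ∧ ∀ a, Avoids i (f a)
  | .rep _ p => Avoids i p

theorem eval_update_of_avoids (B : ℕ) (i : ι) (l : List StackSym) (p : Prog ι D) :
    p.Avoids i → ∀ s : Regs ι,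
      p.eval B (Function.update s i l) = Function.update (p.eval B s) i l := by
  induction p with
  | skip => exact fun _ s => rfl
  | push k a =>
    intro h s
    have h : k ≠ i := h
    rw [eval, eval, Function.update_of_ne h, Function.update_comm h]
  | seq p q ihp ihq => intro h s; rw [eval, eval, ihp h.1, ihq h.2]
  | pop k f ih =>
    intro h s
    have h1 : k ≠ i := h.1
    rw [eval, eval, Function.update_of_ne h1, Function.update_comm h1.symm, ih _ (h.2 _)]
  | rep j p ih =>
    intro h s
    rw [eval, eval]
    generalize B = m at *
    have : ∀ n, (eval m p)^[n] (Function.update s i l) =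
        Function.update ((eval m p)^[n] s) i l := by
      intro n
      induction n with
      | zero => rfl
      | succ n ihn => rw [Function.iterate_succ_apply', Function.iterate_succ_apply', ihn, ih h]
    exact this m

theorem eval_of_avoids (B : ℕ) (i : ι) (p : Prog ι D) (h : p.Avoids i) (s : Regs ι) :
    p.eval B s i = s i := by
  have := congrFun (eval_update_of_avoids B i (s i) p h s) i
  rwa [Function.update_eq_self, Function.update_self] at this

/-- Pops register `i` until it is empty, and runs `body a` for each symbol `a`. -/
def scan (j : Fin D) (i : ι) (body : StackSym → Prog ι D) : Prog ι D :=
  .rep j (.pop i fun | none => .skip | some a => body a)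

theorem eval_scan (B : ℕ) (j : Fin D) (i : ι) (body : StackSym → Prog ι D)
    (h : ∀ a, (body a).Avoids i) (s : Regs ι) (hs : (s i).length ≤ B) :
    (scan j i body).eval B s =
      (s i).foldl (fun s a => (body a).eval B s) (Function.update s i []) := by
  rw [scan, eval]
  suffices H : ∀ (n : ℕ) (s : Regs ι), (s i).length ≤ n →
      (eval B (.pop i fun | none => .skip | some a => body a))^[n] s =
      (s i).foldl (fun s a => (body a).eval B s) (Function.update s i []) from H B s hs
  intro n
  induction n with
  | zero =>
    intro s hs
    have h0 : s i = [] := by simpa using hs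
    rw [Function.iterate_zero_apply, h0, List.foldl_nil, ← h0, Function.update_eq_self]
  | succ n ih =>
    intro s hs
    rw [Function.iterate_succ_apply]
    rcases h0 : s i with _ | ⟨a, l⟩
    · have h1 : (eval B (.pop i fun | none => .skip | some a => body a)) s = s := by
        rw [eval, h0]
        change Function.update s i [] = s
        rw [← h0, Function.update_eq_self]
      rw [h1, ih s (by rw [h0]; simp), h0]
    · have h1 : (eval B (.pop i fun | none => .skip | some a => body a)) s =
          Function.update ((body a).eval B s) i l := by
        rw [eval, h0, ← eval_update_of_avoids _ _ _ _ (h a)]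
        rfl
      rw [h0] at hs
      rw [h1, ih _ (by simpa using hs), Function.update_self, Function.update_idem,
        List.foldl_cons, eval_update_of_avoids _ _ _ _ (h a)]

/-- Moves register `i` to register `k`, reversing the order. -/
def move (j : Fin D) (i k : ι) : Prog ι D := scan j i fun a => .push k a

theorem foldl_push (k : ι) (l : List StackSym) : ∀ s : Regs ι,
    l.foldl (fun s a => Function.update s k (a :: s k)) s =
      Function.update s k (l.reverse ++ s k) := by
  induction l with
  | nil => intro s; simp
  | cons a l ih => intro s; simp [ih]

theorem eval_move (B : ℕ) (j : Fin D) (i k : ι) (hik : i ≠ k) (s : Regs ι)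
    (hs : (s i).length ≤ B) :
    (move j i k).eval B s =
      Function.update (Function.update s i []) k ((s i).reverse ++ s k) := by
  rw [move, eval_scan B j i (fun a => .push k a) (fun _ => hik.symm) s hs]
  simp only [eval]
  rw [foldl_push, Function.update_of_ne hik.symm]

/-- Empties register `i`. -/
def erase (j : Fin D) (i : ι) : Prog ι D := scan j i fun _ => .skip

theorem eval_erase (B : ℕ) (j : Fin D) (i : ι) (s : Regs ι) (hs : (s i).length ≤ B) :
    (erase j i).eval B s = Function.update s i [] := by
  rw [erase, eval_scan B j i (fun _ => .skip) (fun _ => trivial) s hs]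
  simp only [eval]
  generalize s i = l
  induction l with
  | nil => rfl
  | cons a l ih => exact ih

/-- Runs `body a` for each symbol `a` of register `i`, which is preserved with the help of the
empty register `t`. -/
def forEach (j : Fin D) (i t : ι) (body : StackSym → Prog ι D) : Prog ι D :=
  .seq (scan j i fun a => .seq (.push t a) (body a)) (move j t i)

theorem eval_forEach (B : ℕ) (j : Fin D) (i t : ι) (body : StackSym → Prog ι D) (hit : i ≠ t)
    (hi : ∀ a, (body a).Avoids i) (ht : ∀ a, (body a).Avoids t) (s : Regs ι)
    (hst : s t = []) (hs : (s i).length ≤ B) :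
    (forEach j i t body).eval B s = (s i).foldl (fun s a => (body a).eval B s) s := by
  rw [forEach, eval, eval_scan B j i (fun a => .seq (.push t a) (body a))
    (fun a => ⟨hit.symm, hi a⟩) s hs]
  have H : ∀ (l : List StackSym) (s : Regs ι),
      l.foldl (fun s a => (Prog.seq (.push t a) (body a)).eval B s) s =
        Function.update (l.foldl (fun s a => (body a).eval B s) s) t (l.reverse ++ s t) := by
    intro l
    induction l with
    | nil => intro s; simp
    | cons a l ih =>
      intro s
      rw [List.foldl_cons, List.foldl_cons, ih, eval, eval, eval_update_of_avoids _ _ _ _ (ht a)]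
      have H2 : ∀ (l : List StackSym) (s : Regs ι) (u : List StackSym),
          l.foldl (fun s a => (body a).eval B s) (Function.update s t u) =
            Function.update (l.foldl (fun s a => (body a).eval B s) s) t u := by
        intro l
        induction l with
        | nil => exact fun s u => rfl
        | cons a l ih =>
          intro s u
          rw [List.foldl_cons, List.foldl_cons, eval_update_of_avoids _ _ _ _ (ht a), ih]
      rw [H2, Function.update_idem, Function.update_self]
      simp
  have H3 : ∀ (l : List StackSym) (s : Regs ι) (u : List StackSym),
      l.foldl (fun s a => (body a).eval B s) (Function.update s i u) =
        Function.update (l.foldl (fun s a => (body a).eval B s) s) i u := by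
    intro l
    induction l with
    | nil => exact fun s u => rfl
    | cons a l ih =>
      intro s u
      rw [List.foldl_cons, List.foldl_cons, eval_update_of_avoids _ _ _ _ (hi a), ih]
  have H4 : ∀ (x : ι), (∀ a, (body a).Avoids x) → ∀ (l : List StackSym) (s : Regs ι),
      l.foldl (fun s a => (body a).eval B s) s x = s x := by
    intro x hx l
    induction l with
    | nil => exact fun s => rfl
    | cons a l ih => intro s; rw [List.foldl_cons, ih, eval_of_avoids _ _ _ (hx a)]
  rw [H, Function.update_of_ne hit.symm, hst, List.append_nil, H3, eval_move _ _ _ _ hit.symm]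
  · rw [Function.update_self, Function.update_idem, List.reverse_reverse,
      Function.update_of_ne hit, Function.update_self, List.append_nil]
    funext x
    by_cases hxi : x = i
    · subst hxi; rw [Function.update_self, H4 _ hi]
    · rw [Function.update_of_ne hxi]
      by_cases hxt : x = t
      · subst hxt; rw [Function.update_self, H4 _ ht, hst]
      · rw [Function.update_of_ne hxt, Function.update_of_ne hxi]
  · simpa using hs

theorem WF.mono {p : Prog ι D} : ∀ {d d' : ℕ}, d ≤ d' → p.WF d → p.WF d' := by
  induction p with
  | skip => exact fun _ _ => trivial
  | push k a => exact fun _ _ => trivial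
  | seq p q ihp ihq => exact fun h h' => ⟨ihp h h'.1, ihq h h'.2⟩
  | pop k f ih => exact fun h h' a => ih a h (h' a)
  | rep j p ih => exact fun h h' => ⟨h'.1.trans_le h, h'.2⟩

theorem wf_scan (j : Fin D) (i : ι) (body : StackSym → Prog ι D) (d : ℕ) (hj : j < d)
    (h : ∀ a, (body a).WF j) : (scan j i body).WF d :=
  ⟨hj, fun | none => trivial | some a => h a⟩

theorem wf_move (j : Fin D) (i k : ι) (d : ℕ) (hj : j < d) : (move j i k : Prog ι D).WF d :=
  wf_scan _ _ _ _ hj fun _ => trivial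

theorem wf_erase (j : Fin D) (i : ι) (d : ℕ) (hj : j < d) : (erase j i : Prog ι D).WF d :=
  wf_scan _ _ _ _ hj fun _ => trivial

theorem wf_forEach (j : Fin D) (i t : ι) (body : StackSym → Prog ι D) (d : ℕ) (hj : j < d)
    (h : ∀ a, (body a).WF j) : (forEach j i t body).WF d :=
  ⟨wf_scan _ _ _ _ hj fun a => ⟨trivial, h a⟩, wf_move _ _ _ _ hj⟩

theorem avoids_scan (x : ι) (j : Fin D) (i : ι) (body : StackSym → Prog ι D) (hi : i ≠ x)
    (h : ∀ a, (body a).Avoids x) : (scan j i body).Avoids x :=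
  ⟨hi, fun | none => trivial | some a => h a⟩

theorem avoids_move (x : ι) (j : Fin D) (i k : ι) (hi : i ≠ x) (hk : k ≠ x) :
    (move j i k : Prog ι D).Avoids x :=
  avoids_scan _ _ _ _ hi fun _ => hk

/-- Pushes a symbol to each register of a list. -/
def pushAll (L : List ι) (a : StackSym) : Prog ι D :=
  L.foldr (fun k p => .seq (.push k a) p) .skip

theorem wf_pushAll (L : List ι) (a : StackSym) (d : ℕ) : (pushAll L a : Prog ι D).WF d := by
  induction L with
  | nil => trivial
  | cons k L ih => exact ⟨trivial, ih⟩

theorem avoids_pushAll (x : ι) (L : List ι) (a : StackSym) (h : x ∉ L) :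
    (pushAll L a : Prog ι D).Avoids x := by
  induction L with
  | nil => trivial
  | cons k L ih =>
    exact ⟨fun e => h (by simp [e]), ih fun e => h (by simp [e])⟩

theorem eval_pushAll (B : ℕ) (a : StackSym) (L : List ι) : ∀ s : Regs ι,
    (pushAll L a : Prog ι D).eval B s = fun k => List.replicate (L.count k) a ++ s k := by
  induction L with
  | nil => intro s; rfl
  | cons k L ih =>
    intro s
    have : (pushAll (k :: L) a : Prog ι D).eval B s =
      (pushAll L a : Prog ι D).eval B (Function.update s k (a :: s k)) := rfl
    rw [this, ih]
    funext x
    by_cases h : x = k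
    · subst h
      simp only [Function.update_self, List.count_cons_self, List.replicate_succ']
      simp
    · simp [h, List.count_cons_of_ne (Ne.symm h)]

/-- Pushes to register `k` a unary number, `c` times the length of register `i`. -/
def addTo (j : Fin D) (i t : ι) (c : ℕ) (k : ι) : Prog ι D :=
  forEach j i t fun _ => pushAll (List.replicate c k) (some true)

theorem eval_addTo (B : ℕ) (j : Fin D) (i t : ι) (c : ℕ) (k : ι) (hit : i ≠ t) (hi : i ≠ k)
    (ht : t ≠ k) (s : Regs ι) (hst : s t = []) (hs : (s i).length ≤ B) :
    (addTo j i t c k).eval B s =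
      Function.update s k (List.replicate (c * (s i).length) (some true) ++ s k) := by
  rw [addTo, eval_forEach B j i t (fun _ => pushAll (List.replicate c k) (some true)) hit
    (fun a => avoids_pushAll _ _ _ fun h => hi (List.eq_of_mem_replicate h))
    (fun a => avoids_pushAll _ _ _ fun h => ht (List.eq_of_mem_replicate h)) _ hst hs]
  generalize s i = l
  clear hs hst
  induction l generalizing s with
  | nil => simp
  | cons a l ih =>
    rw [List.foldl_cons, ih, eval_pushAll]
    funext x
    by_cases h : x = k
    · subst h
      simp only [Function.update_self, List.count_replicate_self, List.length_cons]
      rw [← List.append_assoc, ← List.replicate_add, mul_add, mul_one]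
    · simp only [Function.update_of_ne h]
      rw [List.count_eq_zero_of_not_mem fun h' => h (List.eq_of_mem_replicate h')]
      rfl

/-- Reads as many symbols from register `w` as register `i` has, and pushes each of them to the
registers in a list. -/
def readTo (j : Fin D) (i t w : ι) (L : List ι) : Prog ι D :=
  forEach j i t fun _ => .pop w fun | none => .skip | some a => pushAll L a

theorem eval_readTo (B : ℕ) (j : Fin D) (i t w : ι) (L : List ι) (hit : i ≠ t) (hi : i ∉ L)
    (ht : t ∉ L) (hiw : i ≠ w) (htw : t ≠ w) (hw : w ∉ L) (hL : L.Nodup) (s : Regs ι)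
    (hst : s t = []) (hs : (s i).length ≤ B) :
    (readTo j i t w L).eval B s = fun k => if k = w then (s w).drop (s i).length else
      if k ∈ L then ((s w).take (s i).length).reverse ++ s k else s k := by
  rw [readTo, eval_forEach B j i t (fun _ => .pop w fun | none => .skip | some a => pushAll L a)
    hit (fun a => ⟨hiw.symm, fun | none => trivial | some a => avoids_pushAll _ _ _ hi⟩)
    (fun a => ⟨htw.symm, fun | none => trivial | some a => avoids_pushAll _ _ _ ht⟩) _ hst hs]
  generalize s i = l
  clear hs hst
  induction l generalizing s with
  | nil => funext k; by_cases h : k = w <;> simp [h]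
  | cons a l ih =>
    rw [List.foldl_cons, ih]
    rcases h0 : s w with _ | ⟨b, u⟩
    · funext k
      simp only [eval, h0, List.head?_nil, List.tail_nil, Function.update_self]
      by_cases h : k = w <;> simp [h]
    · funext k
      simp only [eval, h0, List.head?_cons, List.tail_cons, eval_pushAll, List.length_cons]
      by_cases h : k = w
      · subst h; simp [List.count_eq_zero_of_not_mem hw]
      · simp only [h, if_false, Function.update_of_ne h,
          Function.update_self, List.count_eq_zero_of_not_mem hw, List.replicate_zero,
          List.nil_append, List.take_succ_cons, List.reverse_cons, List.append_assoc]
        by_cases hk : k ∈ L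
        · simp [hk, List.count_eq_one_of_mem hL hk]
        · simp [hk, List.count_eq_zero_of_not_mem hk]

theorem wf_addTo (j : Fin D) (i t : ι) (c : ℕ) (k : ι) (d : ℕ) (hj : j < d) :
    (addTo j i t c k).WF d := wf_forEach _ _ _ _ _ hj fun _ => wf_pushAll _ _ _

theorem wf_readTo (j : Fin D) (i t w : ι) (L : List ι) (d : ℕ) (hj : j < d) :
    (readTo j i t w L).WF d :=
  wf_forEach _ _ _ _ _ hj fun _ => fun | none => trivial | some _ => wf_pushAll _ _ _

end Prog

/-! ### The isolator and its program -/

/-- The inner product modulo 2 of two bit lists, as long as both last. -/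
def dotBits : List Bool → List Bool → Bool
  | a :: x, b :: y => xor (a && b) (dotBits x y)
  | _, _ => false

/-- The isolator on lists: the inner products of `y` with `x` and its first `m - 1` shifts all
vanish. -/
def isoList : ℕ → List Bool → List Bool → Bool
  | 0, _, _ => true
  | m + 1, x, y => !dotBits x y && isoList m x.tail y

/-- The registers of the programs below. -/
inductive Reg : Type
  | inp | a | b | w | m | x | y | x2 | y2 | par | bad | t0 | t1 | ox | oy | oz | n | v | q | u | c
  | sep | sep2
  deriving DecidableEq

instance : Fintype Reg :=
  ⟨{.inp, .a, .b, .w, .m, .x, .y, .x2, .y2, .par, .bad, .t0, .t1, .ox, .oy, .oz, .n, .v, .q, .u,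
    .c, .sep, .sep2}, fun k => by cases k <;> simp⟩

namespace Prog

open Reg

/-- The contents of a register that holds a flag. -/
def flag (p : Bool) : List StackSym := if p then [some true] else []

/-- Processes one bit of `x` and one bit of `y`, and adds their product to the parity. -/
def dotStep (s : StackSym) : Prog Reg 3 :=
  .seq (.push x2 s) (.pop y fun
    | none => .skip
    | some s' => .seq (.push y2 s') (if s = some true ∧ s' = some true then
        .pop par fun
          | none => .push par (some true)
          | some _ => .skip
        else .skip))

/-- Adds the inner product of `x` and `y` to `bad`, and drops a bit of `x`. -/
def isoRound : Prog Reg 3 :=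
  .seq (scan 0 x dotStep) (.seq (move 0 x2 x) (.seq (move 0 y2 y) (.seq
    (.pop par fun
      | none => .skip
      | some _ => .pop bad fun _ => .push bad (some true))
    (.pop x fun _ => .skip))))

/-- Pushes the value of the isolator at the contents of `x` and `y` to `oz`, the number of shifts
being the length of `m`, and empties `x` and `y`. -/
def iso : Prog Reg 3 :=
  .seq (forEach 1 m t1 fun _ => isoRound) (.seq (erase 0 x) (.seq (erase 0 y)
    (.pop bad fun
      | none => .push oz (some true)
      | some _ => .push oz (some false))))

theorem avoids_dotStep (k : Reg) (s : StackSym) (h1 : x2 ≠ k) (h2 : y2 ≠ k) (h3 : y ≠ k)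
    (h4 : par ≠ k) : (dotStep s).Avoids k := by
  refine ⟨h1, h3, fun | none => trivial | some s' => ⟨h2, ?_⟩⟩
  split_ifs
  · exact ⟨h4, fun | none => h4 | some _ => trivial⟩
  · trivial

theorem avoids_isoRound (k : Reg) (h1 : x2 ≠ k) (h2 : y2 ≠ k) (h3 : y ≠ k)
    (h4 : par ≠ k) (h5 : x ≠ k) (h6 : bad ≠ k) : isoRound.Avoids k :=
  ⟨avoids_scan _ _ _ _ h5 fun _ => avoids_dotStep _ _ h1 h2 h3 h4, avoids_move _ _ _ _ h1 h5,
    avoids_move _ _ _ _ h2 h3, ⟨h4, fun | none => trivial | some _ => ⟨h6, fun _ => h6⟩⟩,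
    ⟨h5, fun _ => trivial⟩⟩

theorem wf_dotStep (s : StackSym) (d : ℕ) : (dotStep s).WF d := by
  refine ⟨trivial, fun | none => trivial | some s' => ⟨trivial, ?_⟩⟩
  split_ifs
  · exact fun | none => trivial | some _ => trivial
  · trivial

theorem wf_isoRound : isoRound.WF 1 :=
  ⟨wf_scan _ _ _ _ (by simp) fun _ => wf_dotStep _ _, wf_move _ _ _ _ (by simp),
    wf_move _ _ _ _ (by simp), fun | none => trivial | some _ => fun _ => trivial,
    fun _ => trivial⟩

theorem wf_iso : iso.WF 2 :=
  ⟨wf_forEach _ _ _ _ _ (by simp) fun _ => wf_isoRound, wf_erase _ _ _ (by simp),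
    wf_erase _ _ _ (by simp), fun | none => trivial | some _ => trivial⟩

theorem foldl_dotStep (B : ℕ) (xs : List Bool) : ∀ (ys : List Bool) (p : Bool) (s : Regs Reg),
    s y = ys.map some → s par = flag p →
    (xs.map some).foldl (fun s a => (dotStep a).eval B s) s = fun k => match k with
      | x2 => (xs.map some).reverse ++ s x2
      | y => (ys.drop xs.length).map some
      | y2 => ((ys.take xs.length).map some).reverse ++ s y2
      | par => flag (xor p (dotBits xs ys))
      | k => s k := by
  induction xs with
  | nil =>
    intro ys p s h1 h2
    funext k
    cases k <;> simp [h1, h2, dotBits]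
  | cons a xs ih =>
    intro ys p s h1 h2
    cases ys with
    | nil =>
      rw [List.map_cons, List.foldl_cons, ih [] p]
      · funext k
        cases k <;> simp [dotStep, eval, h1, dotBits]
      · simp [dotStep, eval, h1]
      · simp [dotStep, eval, h1, h2]
    | cons b ys =>
      rw [List.map_cons, List.foldl_cons, ih ys (xor p (a && b))]
      · funext k
        cases k <;> simp [dotStep, eval, h1, dotBits] <;> cases a <;> cases b <;> cases p <;>
          simp [eval, h2, flag]
      · cases a <;> cases b <;> cases p <;> simp [dotStep, eval, h1, h2, flag]
      · cases a <;> cases b <;> cases p <;> simp [dotStep, eval, h1, h2, flag]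

theorem eval_isoRound (B : ℕ) (xs ys : List Bool) (p : Bool) (s : Regs Reg)
    (hx : s x = xs.map some) (hy : s y = ys.map some) (hx2 : s x2 = []) (hy2 : s y2 = [])
    (hpar : s par = []) (hbad : s bad = flag p) (hxB : xs.length ≤ B) :
    isoRound.eval B s = fun k => match k with
      | x => xs.tail.map some
      | bad => flag (p || dotBits xs ys)
      | k => s k := by
  have h1 : eval B (scan 0 x dotStep) s = fun k => match k with
      | x => []
      | x2 => (xs.map some).reverse
      | y => (ys.drop xs.length).map some
      | y2 => ((ys.take xs.length).map some).reverse
      | par => flag (dotBits xs ys)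
      | k => s k := by
    rw [eval_scan B 0 x dotStep (fun a => avoids_dotStep _ _ (by simp) (by simp) (by simp)
      (by simp)) s (by simpa [hx] using hxB), hx, foldl_dotStep B xs ys false]
    · funext k
      cases k <;> simp [hx2, hy2]
    · simp [hy]
    · simp [hpar, flag]
  rw [isoRound, eval, h1, eval, eval_move _ _ _ _ (by simp) _ (by simpa using hxB), eval,
    eval_move _ _ _ _ (by simp) _ (by simp; omega), eval, eval]
  have hd : (ys.take xs.length).map some ++ (ys.drop xs.length).map some = ys.map some := by
    rw [← List.map_append, List.take_append_drop]
  funext k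
  cases hdot : dotBits xs ys <;> cases p <;> cases k <;>
    simp [flag, eval, hy, hx2, hy2, hpar, hbad, hd, List.map_tail, -List.map_take,
      -List.map_drop]

theorem foldl_isoRound (B : ℕ) (ys : List Bool) (l : List StackSym) :
    ∀ (xs : List Bool) (p : Bool) (s : Regs Reg),
    s x = xs.map some → s y = ys.map some → s x2 = [] → s y2 = [] → s par = [] →
    s bad = flag p → xs.length ≤ B →
    ∃ xs' : List Bool, xs'.length ≤ B ∧
    l.foldl (fun s _ => isoRound.eval B s) s = fun k => match k with
      | x => xs'.map some
      | bad => flag (p || !isoList l.length xs ys)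
      | k => s k := by
  induction l with
  | nil =>
    intro xs p s hx hy hx2 hy2 hpar hbad hxB
    refine ⟨xs, hxB, ?_⟩
    funext k
    cases k <;> simp [hx, hbad, isoList]
  | cons a l ih =>
    intro xs p s hx hy hx2 hy2 hpar hbad hxB
    obtain ⟨xs', hxs', h⟩ := ih xs.tail (p || dotBits xs ys) (isoRound.eval B s)
      (by rw [eval_isoRound B xs ys p s hx hy hx2 hy2 hpar hbad hxB])
      (by rw [eval_isoRound B xs ys p s hx hy hx2 hy2 hpar hbad hxB]; exact hy)
      (by rw [eval_isoRound B xs ys p s hx hy hx2 hy2 hpar hbad hxB]; exact hx2)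
      (by rw [eval_isoRound B xs ys p s hx hy hx2 hy2 hpar hbad hxB]; exact hy2)
      (by rw [eval_isoRound B xs ys p s hx hy hx2 hy2 hpar hbad hxB]; exact hpar)
      (by rw [eval_isoRound B xs ys p s hx hy hx2 hy2 hpar hbad hxB]) (by simp; omega)
    refine ⟨xs', hxs', ?_⟩
    rw [List.foldl_cons, h, eval_isoRound B xs ys p s hx hy hx2 hy2 hpar hbad hxB]
    funext k
    cases k <;> simp [isoList, Bool.or_assoc]

theorem eval_iso (B : ℕ) (xs ys : List Bool) (s : Regs Reg)
    (hx : s x = xs.map some) (hy : s y = ys.map some) (hx2 : s x2 = []) (hy2 : s y2 = [])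
    (hpar : s par = []) (hbad : s bad = []) (ht : s t1 = []) (hxB : xs.length ≤ B)
    (hyB : ys.length ≤ B) (hm : (s m).length ≤ B) :
    iso.eval B s = fun k => match k with
      | x => []
      | y => []
      | oz => some (isoList (s m).length xs ys) :: s oz
      | k => s k := by
  obtain ⟨xs', hxs', h⟩ := foldl_isoRound B ys (s m) xs false s hx hy hx2 hy2 hpar hbad hxB
  rw [iso, eval, eval_forEach B 1 m t1 (fun _ => isoRound) (by simp)
    (fun _ => avoids_isoRound _ (by simp) (by simp) (by simp) (by simp) (by simp) (by simp))
    (fun _ => avoids_isoRound _ (by simp) (by simp) (by simp) (by simp) (by simp) (by simp))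
    s ht hm, h, eval, eval_erase _ _ _ _ (by simpa using hxs'), eval, eval_erase _ _ _ _
    (by simpa [hy] using hyB), eval]
  funext k
  cases hiso : isoList (s m).length xs ys <;> cases k <;> simp [flag, eval, hbad]

/-- Processes one symbol of the reversed input; `sep` and `sep2` record the separators seen. -/
def parseStep : StackSym → Prog Reg 3
  | none => .pop sep fun
    | none => .push sep (some true)
    | some _ => .seq (.push sep (some true)) (.push sep2 (some true))
  | some s => .pop sep2 fun
    | some _ => .seq (.push sep2 (some true)) (.push a (some s))
    | none => .pop sep fun
      | some _ => .seq (.push sep (some true)) (.push b (some s))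
      | none => .push w (some s)

/-- Splits the reversed input `1^a # 1^b # w` into the registers `a`, `b` and `w`. -/
def parse : Prog Reg 3 := scan 0 inp parseStep

theorem wf_parse : parse.WF 1 := by
  refine wf_scan _ _ _ _ (by simp) fun s => ?_
  cases s with
  | none => exact fun | none => trivial | some _ => ⟨trivial, trivial⟩
  | some s =>
    exact fun
      | some _ => ⟨trivial, trivial⟩
      | none => fun
        | none => trivial
        | some _ => ⟨trivial, trivial⟩

theorem foldl_parseStep (B : ℕ) (C : Regs Reg → Prop) (k : Reg)
    (hf : ∀ s u, C s → (parseStep (some u)).eval B s = Function.update s k (some u :: s k))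
    (hC : ∀ s l, C s → C (Function.update s k l)) (l : List Bool) : ∀ s, C s →
    (l.map some).foldl (fun s u => (parseStep u).eval B s) s =
      Function.update s k ((l.map some).reverse ++ s k) := by
  induction l with
  | nil => intro s _; simp
  | cons a l ih =>
    intro s hs
    rw [List.map_cons, List.foldl_cons, hf s a hs, ih _ (hC _ _ hs)]
    simp

theorem eval_parse (B N b' : ℕ) (r : List Bool)
    (hB : (encodeInput (N, b', r)).length ≤ B) :
    parse.eval B (Function.update (fun _ => []) inp (encodeInput (N, b', r)).reverse) =
      fun k => match k with
        | a => List.replicate N (some true)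
        | b => List.replicate b' (some true)
        | w => r.map some
        | sep => [some true]
        | sep2 => [some true]
        | _ => [] := by
  have e : (encodeInput (N, b', r)).reverse = r.reverse.map some ++ none ::
      ((List.replicate b' true).map some ++ none :: (List.replicate N true).map some) := by
    simp [encodeInput]
  rw [parse, eval_scan, Function.update_self, Function.update_idem, e, List.foldl_append,
    List.foldl_cons, List.foldl_append, List.foldl_cons,
    foldl_parseStep B (fun s => s sep = [] ∧ s sep2 = []) w _ _ r.reverse _ (by simp),
    foldl_parseStep B (fun s => s sep = [some true] ∧ s sep2 = []) b _ _ (List.replicate b' true)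
      _ (by simp [eval, parseStep]),
    foldl_parseStep B (fun s => s sep = [some true] ∧ s sep2 = [some true]) a _ _
      (List.replicate N true) _ (by simp [eval, parseStep])]
  · funext k
    cases k <;> simp [eval, parseStep]
  · rintro s u ⟨h1, h2⟩
    funext k
    cases k <;> simp [eval, parseStep, h2]
  · rintro s l ⟨h1, h2⟩
    simp [h1, h2]
  · rintro s u ⟨h1, h2⟩
    funext k
    cases k <;> simp [eval, parseStep, h1, h2]
  · rintro s l ⟨h1, h2⟩
    simp [h1, h2]
  · rintro s u ⟨h1, h2⟩
    funext k
    cases k <;> simp [eval, parseStep, h1, h2]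
  · rintro s l ⟨h1, h2⟩
    simp [h1, h2]
  · rintro (_ | s)
    · exact ⟨by simp, fun | none => by simp [Avoids] | some _ => by simp [Avoids]⟩
    · exact ⟨by simp, fun
        | some _ => by simp [Avoids]
        | none => ⟨by simp, fun | none => by simp [Avoids] | some _ => by simp [Avoids]⟩⟩
  · simpa using hB

end Prog

/-- The isolator on pairs of bit strings. -/
def isoFun (n m : ℕ) (p : BitStr n × BitStr n) : Bool :=
  isoList m (List.ofFn p.1).reverse (List.ofFn p.2).reverse

namespace Prog

open Reg

/-- The program for the isolator. -/
def isoProg : Prog Reg 3 :=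
  .seq parse (.seq (readTo 0 a t0 w [x]) (.seq (readTo 0 a t0 w [y]) (.seq (move 0 b m) iso)))

theorem wf_isoProg : isoProg.WF 3 :=
  ⟨wf_parse.mono (by simp), wf_readTo _ _ _ _ _ _ (by simp), wf_readTo _ _ _ _ _ _ (by simp),
    wf_move _ _ _ _ (by simp), wf_iso.mono (by simp)⟩

theorem eval_isoProg (n' m' : ℕ) (xs ys : List Bool) (hx : xs.length = n') (hy : ys.length = n') :
    result (isoProg.eval (encodeInput (n', m', xs ++ ys)).length (Function.update (fun _ => []) inp
      (encodeInput (n', m', xs ++ ys)).reverse)) ox oy oz = [isoList m' xs.reverse ys.reverse] := by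
  set B := (encodeInput (n', m', xs ++ ys)).length with hBdef
  have hB : n' ≤ B ∧ m' ≤ B := by simp [hBdef, encodeInput]; omega
  rw [isoProg, eval, eval_parse _ _ _ _ le_rfl, eval,
    eval_readTo _ _ _ _ _ _ (by simp) (by simp) (by simp) (by simp) (by simp) (by simp) (by simp)
      _ (by simp) (by simpa using hB.1), eval,
    eval_readTo _ _ _ _ _ _ (by simp) (by simp) (by simp) (by simp) (by simp) (by simp) (by simp)
      _ (by simp) (by simpa using hB.1), eval, eval_move _ _ _ _ (by simp) _
      (by simpa using hB.2), eval_iso B xs.reverse ys.reverse]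
  · simp [result]
  · simp [← hx]
  · simp [← hx, hy.trans hx.symm]
  all_goals simp [hx, hy, hB]

theorem isExplicit_isoFun : IsExplicit isoFun := by
  refine ⟨_, isPolyTime isoProg wf_isoProg inp ox oy oz (by simp) (by simp) (by simp), ?_⟩
  intro n' m' x' y'
  exact eval_isoProg n' m' _ _ (by simp) (by simp)

/-! ### The sampler for one block -/

/-- The program that outputs `96 b` random bits and the isolator at the first and the last third
of them. -/
def sampleOne : Prog Reg 3 :=
  .seq parse (.seq (addTo 0 b t0 32 n) (.seq (readTo 0 n t0 w [x, ox])
    (.seq (readTo 0 n t0 w [ox]) (.seq (readTo 0 n t0 w [y, ox]) (.seq (.push m (some true))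
    iso)))))

theorem wf_sampleOne : sampleOne.WF 3 :=
  ⟨wf_parse.mono (by simp), wf_addTo _ _ _ _ _ _ (by simp), wf_readTo _ _ _ _ _ _ (by simp),
    wf_readTo _ _ _ _ _ _ (by simp), wf_readTo _ _ _ _ _ _ (by simp), trivial,
    wf_iso.mono (by simp)⟩

theorem eval_sampleOne (N b' : ℕ) (r : List Bool) (hr : 96 * b' ≤ r.length) :
    result (sampleOne.eval (encodeInput (N, b', r)).length (Function.update (fun _ => []) inp
      (encodeInput (N, b', r)).reverse)) ox oy oz = r.take (96 * b') ++
        [isoList 1 (r.take (32 * b')).reverse ((r.drop (64 * b')).take (32 * b')).reverse] := by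
  set B := (encodeInput (N, b', r)).length with hBdef
  have hB : 96 * b' ≤ B ∧ 1 ≤ B := by simp [hBdef, encodeInput]; omega
  rw [sampleOne, eval, eval_parse _ _ _ _ le_rfl, eval,
    eval_addTo _ _ _ _ _ _ (by simp) (by simp) (by simp) _ (by simp) (by simp; omega), eval,
    eval_readTo _ _ _ _ _ _ (by simp) (by simp) (by simp) (by simp) (by simp) (by simp) (by simp)
      _ (by simp ) (by simp ; omega), eval,
    eval_readTo _ _ _ _ _ _ (by simp) (by simp) (by simp) (by simp) (by simp) (by simp) (by simp)
      _ (by simp ) (by simp ; omega), eval,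
    eval_readTo _ _ _ _ _ _ (by simp) (by simp) (by simp) (by simp) (by simp) (by simp) (by simp)
      _ (by simp ) (by simp ; omega), eval, eval,
      eval_iso B (r.take (32 * b')).reverse ((r.drop (64 * b')).take (32 * b')).reverse]
  · have h96 : r.take (96 * b') = r.take (32 * b') ++ ((r.drop (32 * b')).take (32 * b') ++
        (r.drop (64 * b')).take (32 * b')) := by
      rw [show 64 * b' = 32 * b' + 32 * b' by ring, ← List.drop_drop, ← List.take_add,
        ← List.take_add]
      congr 1
      ring
    simp [result, h96, ← List.map_take, ← List.map_drop]
    rw [show 64 * b' = 32 * b' + 32 * b' by ring]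
  · simp [← List.map_take]
  · simp [← List.map_take, ← List.map_drop]
    rw [show 64 * b' = 32 * b' + 32 * b' by ring]
  all_goals simp
  all_goals omega

end Prog

/-! ### The sampler for many blocks -/

/-- The largest `m` with `m 2^m n ≤ N`. -/
def numShifts (N n : ℕ) : ℕ := Nat.findGreatest (fun m => m * 2 ^ m * n ≤ N) N

theorem numShifts_spec (N n : ℕ) : numShifts N n * 2 ^ numShifts N n * n ≤ N :=
  Nat.findGreatest_spec (P := fun m => m * 2 ^ m * n ≤ N) (Nat.zero_le N) (by simp)

theorem shifts_mono (n : ℕ) {k m : ℕ} (h : k ≤ m) : k * 2 ^ k * n ≤ m * 2 ^ m * n :=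
  Nat.mul_le_mul_right _ (Nat.mul_le_mul h (Nat.pow_le_pow_right (by simp) h))

theorem le_numShifts {N n k : ℕ} (hn : 0 < n) (h : k * 2 ^ k * n ≤ N) : k ≤ numShifts N n := by
  refine Nat.le_findGreatest ?_ h
  calc k = k * 1 * 1 := by ring
    _ ≤ k * 2 ^ k * n := Nat.mul_le_mul (Nat.mul_le_mul_left _ Nat.one_le_two_pow) hn
    _ ≤ N := h

/-- The concatenation of every other block of length `n`. -/
def evenBlocks (n : ℕ) : ℕ → List Bool → List Bool
  | 0, _ => []
  | t + 1, l => l.take n ++ evenBlocks n t (l.drop (2 * n))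

/-- The values of the isolator on consecutive pairs of blocks of length `n`. -/
def isoBlocks (n m : ℕ) : ℕ → List Bool → List Bool
  | 0, _ => []
  | t + 1, l => isoList m (l.take n).reverse ((l.drop n).take n).reverse ::
      isoBlocks n m t (l.drop (2 * n))

namespace Prog

open Reg

/-- Replaces `v = m 2^m n`, `q = 2^m n` and `m` by the values for `m + 1`, unless the new value of
`v` exceeds `a`. -/
def searchRound : Prog Reg 3 :=
  .seq (addTo 0 v t0 2 u) (.seq (addTo 0 q t0 2 u) (.seq (addTo 0 a t0 1 c) (.seq
    (forEach 0 u t0 fun _ => .pop c fun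
      | none => .pop bad fun _ => .push bad (some true)
      | some _ => .skip)
    (.seq (.pop bad fun
      | none => .seq (erase 0 v) (.seq (move 0 u v) (.seq (addTo 0 q t0 1 x2) (.seq (move 0 x2 q)
          (.push m (some true)))))
      | some _ => erase 0 u) (erase 0 c)))))

theorem wf_searchRound : searchRound.WF 1 :=
  ⟨wf_addTo _ _ _ _ _ _ (by simp), wf_addTo _ _ _ _ _ _ (by simp),
    wf_addTo _ _ _ _ _ _ (by simp), wf_forEach _ _ _ _ _ (by simp) fun _ => fun
      | none => fun _ => trivial
      | some _ => trivial, fun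
      | none => ⟨wf_erase _ _ _ (by simp), wf_move _ _ _ _ (by simp),
        wf_addTo _ _ _ _ _ _ (by simp), wf_move _ _ _ _ (by simp), trivial⟩
      | some _ => wf_erase _ _ _ (by simp), wf_erase _ _ _ (by simp)⟩

theorem foldl_compare (B : ℕ) (l : List StackSym) : ∀ (k : ℕ) (p : Bool) (s : Regs Reg),
    s c = List.replicate k (some true) → s bad = flag p →
    l.foldl (fun s _ => eval B (.pop c fun
      | none => .pop bad fun _ => .push bad (some true)
      | some _ => .skip : Prog Reg 3) s) s = fun r => match r with
        | c => List.replicate (k - l.length) (some true)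
        | bad => flag (p || decide (k < l.length))
        | r => s r := by
  induction l with
  | nil =>
    intro k p s h1 h2
    funext r
    cases r <;> simp [h1, h2]
  | cons e l ih =>
    intro k p s h1 h2
    cases k with
    | zero =>
      rw [List.foldl_cons, ih 0 true]
      · funext r
        cases r <;> simp [eval, h1]
      · simp [eval, h1]
      · cases p <;> simp [eval, h1, h2, flag]
    | succ k =>
      rw [List.foldl_cons, ih k p]
      · funext r
        cases r <;> simp [eval, h1, List.replicate_succ]
      · simp [eval, h1, List.replicate_succ]
      · simp [eval, h1, h2, List.replicate_succ]

/-- The registers during the search for the number of shifts. -/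
def searchRegs (s : Regs Reg) (n M : ℕ) : Regs Reg := fun r => match r with
  | v => List.replicate (M * 2 ^ M * n) (some true)
  | q => List.replicate (2 ^ M * n) (some true)
  | m => List.replicate M (some true)
  | r => s r

theorem eval_searchRound (B N n M : ℕ) (s : Regs Reg) (ha : s a = List.replicate N (some true))
    (hu : s u = []) (hc : s c = []) (hbad : s bad = []) (hx2 : s x2 = []) (ht : s t0 = [])
    (hn : n ≤ N) (hM : M * 2 ^ M * n ≤ N) (hB : 4 * N ≤ B) :
    searchRound.eval B (searchRegs s n M) =
      searchRegs s n (if (M + 1) * 2 ^ (M + 1) * n ≤ N then M + 1 else M) := by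
  have hq : 2 ^ M * n ≤ N := by
    rcases Nat.eq_zero_or_pos M with rfl | h
    · simpa using hn
    · refine le_trans ?_ hM
      rw [mul_assoc]
      exact Nat.le_mul_of_pos_left _ h
  have hU : (M + 1) * 2 ^ (M + 1) * n = 2 * (2 ^ M * n) + 2 * (M * 2 ^ M * n) := by ring
  have h2 : 2 ^ (M + 1) * n = 2 ^ M * n + 2 ^ M * n := by ring
  have h1 : eval B (forEach 0 u t0 fun _ => .pop c fun
      | none => .pop bad fun _ => .push bad (some true)
      | some _ => .skip : Prog Reg 3) (eval B (addTo 0 a t0 1 c : Prog Reg 3)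
      (eval B (addTo 0 q t0 2 u : Prog Reg 3) (eval B (addTo 0 v t0 2 u : Prog Reg 3)
        (searchRegs s n M)))) = fun r => match r with
      | u => List.replicate ((M + 1) * 2 ^ (M + 1) * n) (some true)
      | c => List.replicate (N - (M + 1) * 2 ^ (M + 1) * n) (some true)
      | bad => flag (decide (N < (M + 1) * 2 ^ (M + 1) * n))
      | r => searchRegs s n M r := by
    rw [eval_addTo B 0 v t0 2 u (by simp) (by simp) (by simp) _ (by simp [searchRegs, ht])
      (by simp [searchRegs]; omega), eval_addTo B 0 q t0 2 u (by simp) (by simp) (by simp) _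
      (by simp [searchRegs, ht]) (by simp [searchRegs]; omega), eval_addTo B 0 a t0 1 c (by simp)
      (by simp) (by simp) _ (by simp [searchRegs, ht]) (by simp [searchRegs, ha]; omega),
      eval_forEach B 0 u t0 (fun _ => .pop c fun
        | none => .pop bad fun _ => .push bad (some true)
        | some _ => .skip) (by simp) (fun _ => ⟨by simp, fun
        | none => ⟨by simp, fun _ => by simp [Avoids]⟩
        | some _ => trivial⟩) (fun _ => ⟨by simp, fun
        | none => ⟨by simp, fun _ => by simp [Avoids]⟩
        | some _ => trivial⟩) _ (by simp [searchRegs, ht])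
        (by simp [searchRegs, hu]; omega), foldl_compare B _ N false]
    · funext r
      cases r <;> simp [searchRegs, hu, hU]
    · simp [searchRegs, hc, ha]
    · simp [searchRegs, hbad, flag]
  rw [searchRound, eval, eval, eval, eval, h1, eval]
  by_cases h : (M + 1) * 2 ^ (M + 1) * n ≤ N
  · have hlt : ¬ N < (M + 1) * 2 ^ (M + 1) * n := by omega
    rw [if_pos h, eval]
    simp only [hlt, decide_false, flag, Bool.false_eq_true, if_false, List.head?_nil,
      List.tail_nil, eval]
    rw [eval_erase B 0 v _ (by simp [searchRegs]; omega),
      eval_move B 0 u v (by simp) _ (by simp; omega),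
      eval_addTo B 0 q t0 1 x2 (by simp) (by simp) (by simp) _ (by simp [searchRegs, ht])
      (by simp [searchRegs]; omega), eval_move B 0 x2 q (by simp) _
      (by simp [searchRegs, hx2]; omega), eval_erase B 0 c _ (by simp [searchRegs]; omega)]
    funext r
    cases r <;> simp [searchRegs, hu, hc, hbad, hx2, h2, List.replicate_succ]
  · have hlt : N < (M + 1) * 2 ^ (M + 1) * n := by omega
    rw [if_neg h, eval]
    simp only [hlt, decide_true, flag, if_true, List.head?_cons, List.tail_cons]
    rw [eval_erase B 0 u _ (by simp; omega), eval_erase B 0 c _ (by simp; omega)]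
    funext r
    cases r <;> simp [searchRegs, hu, hc, hbad]

theorem iterate_searchRound (B N n : ℕ) (s : Regs Reg) (ha : s a = List.replicate N (some true))
    (hu : s u = []) (hc : s c = []) (hbad : s bad = []) (hx2 : s x2 = []) (ht : s t0 = [])
    (hn0 : 0 < n) (hn : n ≤ N) (hB : 4 * N ≤ B) :
    (searchRound.eval B)^[B] (searchRegs s n 0) = searchRegs s n (numShifts N n) := by
  have H : ∀ K, (searchRound.eval B)^[K] (searchRegs s n 0) =
      searchRegs s n (min K (numShifts N n)) := by
    intro K
    induction K with
    | zero => simp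
    | succ K ih =>
      have hmin : min K (numShifts N n) * 2 ^ min K (numShifts N n) * n ≤ N :=
        (shifts_mono n (min_le_right _ _)).trans (numShifts_spec N n)
      rw [Function.iterate_succ_apply', ih, eval_searchRound B N n _ s ha hu hc hbad hx2 ht hn
        hmin hB]
      congr 1
      rcases lt_or_ge K (numShifts N n) with h | h
      · rw [min_eq_left h.le, min_eq_left h, if_pos ((shifts_mono n h).trans (numShifts_spec N n))]
      · rw [min_eq_right h, min_eq_right (by omega), if_neg]
        intro h'
        have := le_numShifts hn0 h'
        omega
  rw [H, min_eq_right]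
  exact (Nat.findGreatest_le N).trans (by omega)

/-- Samples a pair of blocks and its isolator value. -/
def block : Prog Reg 3 :=
  .seq (readTo 0 n t0 w [x, ox]) (.seq (readTo 0 n t0 w [y, oy]) (.seq (readTo 0 n t0 v []) iso))

theorem wf_block : block.WF 2 :=
  ⟨wf_readTo _ _ _ _ _ _ (by simp), wf_readTo _ _ _ _ _ _ (by simp),
    wf_readTo _ _ _ _ _ _ (by simp), wf_iso⟩

/-- The registers during the sampling of the blocks, when `V` bits are still to be sampled for the
first party. -/
def blockRegs (s : Regs Reg) (V : ℕ) (l X Y Z : List Bool) : Regs Reg := fun r => match r with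
  | v => List.replicate V (some true)
  | w => l.map some
  | ox => (X.map some).reverse
  | oy => (Y.map some).reverse
  | oz => (Z.map some).reverse
  | r => s r

theorem eval_block (B n' M V : ℕ) (l X Y Z : List Bool) (s : Regs Reg)
    (hn : s n = List.replicate n' (some true)) (hm : s m = List.replicate M (some true))
    (hx : s x = []) (hy : s y = []) (hx2 : s x2 = []) (hy2 : s y2 = []) (hpar : s par = [])
    (hbad : s bad = []) (ht : s t0 = []) (ht1 : s t1 = []) (hnB : n' ≤ B) (hMB : M ≤ B) :
    block.eval B (blockRegs s V l X Y Z) =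
      blockRegs s (V - n') (l.drop (2 * n')) (X ++ l.take n') (Y ++ (l.drop n').take n')
        (Z ++ [isoList M (l.take n').reverse ((l.drop n').take n').reverse]) := by
  rw [block, eval, eval_readTo _ _ _ _ _ _ (by simp) (by simp) (by simp) (by simp) (by simp)
      (by simp) (by simp) _ (by simp [blockRegs, ht]) (by simpa [blockRegs, hn] using hnB), eval,
    eval_readTo _ _ _ _ _ _ (by simp) (by simp) (by simp) (by simp) (by simp) (by simp) (by simp)
      _ (by simp [blockRegs, ht]) (by simpa [blockRegs, hn] using hnB), eval,
    eval_readTo _ _ _ _ _ _ (by simp) (by simp) (by simp) (by simp) (by simp) (by simp) (by simp)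
      _ (by simp [blockRegs, ht]) (by simpa [blockRegs, hn] using hnB),
    eval_iso B (l.take n').reverse ((l.drop n').take n').reverse]
  · funext r
    cases r <;> simp [blockRegs, hx, hy, hn, hm, two_mul, ← List.map_take, ← List.map_drop]
  · simp [blockRegs, hx, hn, ← List.map_take]
  · simp [blockRegs, hy, hn, ← List.map_take, ← List.map_drop]
  all_goals simp [blockRegs, hx2, hy2, hpar, hbad, ht1, hm]
  all_goals omega

/-- The program that samples a pair of blocks and its isolator value as long as `v` is nonempty. -/
def blocks : Prog Reg 3 :=
  .rep 2 (.pop v fun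
    | none => .skip
    | some s => .seq (.push v s) block)

theorem wf_blocks : blocks.WF 3 :=
  ⟨by simp, fun
    | none => trivial
    | some _ => ⟨trivial, wf_block⟩⟩

theorem eval_blocks (B n' M t : ℕ) (l : List Bool) (s : Regs Reg)
    (hn : s n = List.replicate n' (some true)) (hm : s m = List.replicate M (some true))
    (hx : s x = []) (hy : s y = []) (hx2 : s x2 = []) (hy2 : s y2 = []) (hpar : s par = [])
    (hbad : s bad = []) (ht : s t0 = []) (ht1 : s t1 = []) (hn0 : 0 < n') (hnB : n' ≤ B)
    (hMB : M ≤ B) (htB : t ≤ B) :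
    blocks.eval B (blockRegs s (t * n') l [] [] []) =
      blockRegs s 0 (l.drop (t * (2 * n'))) (evenBlocks n' t l) (evenBlocks n' t (l.drop n'))
        (isoBlocks n' M t l) := by
  rw [blocks, eval]
  suffices H : ∀ (K t : ℕ) (l X Y Z : List Bool), t ≤ K →
      (eval B (.pop v fun
        | none => .skip
        | some s => .seq (.push v s) block))^[K] (blockRegs s (t * n') l X Y Z) =
      blockRegs s 0 (l.drop (t * (2 * n'))) (X ++ evenBlocks n' t l)
        (Y ++ evenBlocks n' t (l.drop n')) (Z ++ isoBlocks n' M t l) from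
    (H B t l [] [] [] htB).trans (by simp)
  intro K
  induction K with
  | zero =>
    intro t l X Y Z h
    obtain rfl : t = 0 := by omega
    simp [evenBlocks, isoBlocks]
  | succ K ih =>
    intro t l X Y Z h
    rw [Function.iterate_succ_apply]
    rcases t with _ | t
    · have e : eval B (.pop v fun
          | none => .skip
          | some s => .seq (.push v s) block) (blockRegs s (0 * n') l X Y Z) =
          blockRegs s (0 * n') l X Y Z := by
        funext r
        cases r <;> simp [eval, blockRegs]
      rw [e, ih 0 l X Y Z (by omega)]
    · have e : eval B (.pop v fun
          | none => .skip
          | some s => .seq (.push v s) block) (blockRegs s ((t + 1) * n') l X Y Z) =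
          block.eval B (blockRegs s ((t + 1) * n') l X Y Z) := by
        obtain ⟨k, hk⟩ : ∃ k, (t + 1) * n' = k + 1 :=
          ⟨(t + 1) * n' - 1, by have : 0 < (t + 1) * n' := Nat.mul_pos (Nat.succ_pos t) hn0; omega⟩
        rw [hk]
        have e2 : blockRegs s (k + 1) l X Y Z v = some true :: List.replicate k (some true) := rfl
        rw [eval, e2]
        simp only [List.head?_cons, List.tail_cons, eval, Function.update_self,
          Function.update_idem]
        rw [← e2, Function.update_eq_self]
      rw [e, eval_block B n' M _ l X Y Z s hn hm hx hy hx2 hy2 hpar hbad ht ht1 hnB hMB,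
        show (t + 1) * n' - n' = t * n' by rw [add_mul, one_mul, Nat.add_sub_cancel], ih _ _ _ _ _ (by omega)]
      simp only [evenBlocks, isoBlocks, List.append_assoc, List.drop_drop, List.singleton_append]
      rw [show 2 * n' + t * (2 * n') = (t + 1) * (2 * n') by ring, add_comm (2 * n') n']

/-- The program that samples the distribution with many blocks. -/
def sampleMany : Prog Reg 3 :=
  .seq parse (.seq (addTo 0 b t0 96 n) (.seq (addTo 0 n t0 1 q) (.seq (.rep 1 searchRound) blocks)))

theorem wf_sampleMany : sampleMany.WF 3 :=
  ⟨wf_parse.mono (by simp), wf_addTo _ _ _ _ _ _ (by simp), wf_addTo _ _ _ _ _ _ (by simp),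
    ⟨by simp, wf_searchRound⟩, wf_blocks⟩

theorem eval_sampleMany (N b' n' M : ℕ) (l : List Bool) (hn' : n' = 96 * b')
    (hM' : M = numShifts N n') (hb : 0 < b') (hbN : 96 * b' ≤ N)
    (hl : 4 * N ≤ l.length) :
    result (sampleMany.eval (encodeInput (N, b', l)).length (Function.update (fun _ => []) inp
      (encodeInput (N, b', l)).reverse)) ox oy oz =
      evenBlocks n' (M * 2 ^ M) l ++ evenBlocks n' (M * 2 ^ M) (l.drop n') ++
        isoBlocks n' M (M * 2 ^ M) l := by
  set B := (encodeInput (N, b', l)).length with hBdef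
  have hB : 4 * N ≤ B := by simp [hBdef, encodeInput]; omega
  have hMN : M * 2 ^ M * n' ≤ N := hM' ▸ numShifts_spec N n'
  have htN : M * 2 ^ M ≤ N := (Nat.le_mul_of_pos_right _ (by omega)).trans hMN
  have hM : M ≤ N := hM' ▸ Nat.findGreatest_le N
  set s : Regs Reg := fun k => match k with
      | a => List.replicate N (some true)
      | b => List.replicate b' (some true)
      | w => l.map some
      | n => List.replicate n' (some true)
      | sep => [some true]
      | sep2 => [some true]
      | _ => [] with hs
  have e1 : eval B (addTo 0 n t0 1 q : Prog Reg 3) (eval B (addTo 0 b t0 96 n : Prog Reg 3)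
      (eval B parse (Function.update (fun _ => []) inp (encodeInput (N, b', l)).reverse))) =
      searchRegs s n' 0 := by
    rw [eval_parse _ _ _ _ le_rfl, eval_addTo B 0 b t0 96 n (by simp) (by simp) (by simp) _ (by simp)
      (by simp; omega), eval_addTo B 0 n t0 1 q (by simp) (by simp) (by simp) _ (by simp)
      (by simp; omega)]
    funext k
    cases k <;> simp [hs, searchRegs, hn']
  set s' : Regs Reg := fun k => match k with
      | q => List.replicate (2 ^ M * n') (some true)
      | m => List.replicate M (some true)
      | k => s k with hs'
  have e2 : searchRegs s n' M = blockRegs s' (M * 2 ^ M * n') l [] [] [] := by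
    funext k
    cases k <;> simp [hs, hs', searchRegs, blockRegs]
  rw [sampleMany, eval, eval, eval, eval, e1, eval, iterate_searchRound B N n' s rfl rfl rfl rfl
    rfl rfl (by omega) (hn' ▸ hbN) hB, ← hM', e2, eval_blocks B n' M _ l s' rfl rfl rfl rfl rfl rfl rfl rfl rfl rfl
    (by omega) (by omega) (by omega) (by omega)]
  simp [result, blockRegs]

end Prog

/-! ### Sampling the hard distributions in polynomial time -/

theorem map_uniform_of_equiv {α β γ : Type} [Fintype α] [Nonempty α] [Fintype β] [Nonempty β]
    [Fintype γ] [Nonempty γ] (e : α ≃ β × γ) :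
    (PMF.uniformOfFintype α).map (fun a => (e a).1) = PMF.uniformOfFintype β := by
  classical
  ext b
  rw [PMF.map_apply, tsum_fintype, ← e.symm.sum_comp, Fintype.sum_prod_type]
  have hc : Fintype.card α = Fintype.card β * Fintype.card γ := by
    rw [Fintype.card_congr e, Fintype.card_prod]
  simp only [Equiv.apply_symm_apply, PMF.uniformOfFintype_apply, hc]
  rw [Finset.sum_eq_single b]
  · simp only [if_true, Finset.sum_const, Finset.card_univ, nsmul_eq_mul, Nat.cast_mul]
    rw [ENNReal.mul_inv (by simp) (by simp), mul_comm, mul_assoc,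
      ENNReal.inv_mul_cancel (by simp) (by simp), mul_one]
  · intro b' _ h
    simp [h.symm]
  · simp

/-- Reading a uniform string at distinct positions gives uniform bits. -/
theorem map_uniform_comp {ι κ β : Type} [Fintype ι] [DecidableEq ι] [Fintype κ] [Fintype β]
    [Nonempty β] (f : κ → ι) (hf : Function.Injective f) (g : (κ → Bool) ≃ β) :
    (PMF.uniformOfFintype (ι → Bool)).map (fun r => g (r ∘ f)) = PMF.uniformOfFintype β := by
  classical
  refine map_uniform_of_equiv ((Equiv.piEquivPiSubtypeProd (fun i => i ∈ Set.range f)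
    fun _ => Bool).trans (Equiv.prodCongr ((Equiv.arrowCongr (Equiv.ofInjective f hf).symm
      (Equiv.refl Bool)).trans g) (Equiv.refl _)))

theorem evenBlocks_eq (n t : ℕ) (l : List Bool) : evenBlocks n t l =
    (List.ofFn fun i : Fin t => (l.drop (i * (2 * n))).take n).flatten := by
  induction t generalizing l with
  | zero => simp [evenBlocks]
  | succ t ih =>
    simp [evenBlocks, ih, List.ofFn_succ, List.drop_drop, add_mul, add_comm]

theorem isoBlocks_eq (n m t : ℕ) (l : List Bool) : isoBlocks n m t l =
    List.ofFn fun i : Fin t => isoList m ((l.drop (i * (2 * n))).take n).reverse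
      ((l.drop (i * (2 * n) + n)).take n).reverse := by
  induction t generalizing l with
  | zero => simp [isoBlocks]
  | succ t ih =>
    simp [isoBlocks, ih, List.ofFn_succ, List.drop_drop, add_mul, add_comm, add_left_comm]

theorem take_drop_ofFn {ℓ : ℕ} (r : BitStr ℓ) (k n : ℕ) (h : k + n ≤ ℓ) :
    ((List.ofFn r).drop k).take n = List.ofFn fun j : Fin n => r ⟨k + j, by omega⟩ := by
  refine List.ext_getElem (by simp; omega) fun i h1 h2 => by simp

theorem ofFn_concatBits {t n : ℕ} (x : Fin t → BitStr n) :
    List.ofFn (concatBits x) = (List.ofFn fun i => List.ofFn (x i)).flatten := by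
  rw [List.ofFn_mul]
  congr 2
  funext i
  congr 1
  funext j
  have hj : 0 < n := j.pos
  have h1 : (⟨i * n + j, by nlinarith [i.isLt, j.isLt]⟩ : Fin (t * n)).divNat = i := by
    ext
    simp [Fin.divNat, Nat.div_eq_of_lt j.isLt, Nat.add_div_of_dvd_right, hj, mul_comm]
  have h2 : (⟨i * n + j, by nlinarith [i.isLt, j.isLt]⟩ : Fin (t * n)).modNat = j := by
    ext
    simp [Fin.modNat, Nat.mod_eq_of_lt j.isLt]
  simp only [concatBits]
  rw [h1, h2]

/-- Positions in a random string of the bits of the blocks; the blocks of the two parties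
alternate. -/
def blockIndex {n t ℓ : ℕ} (h : t * (2 * n) ≤ ℓ) (k : Fin t × Fin 2 × Fin n) : Fin ℓ :=
  Fin.castLE h (finProdFinEquiv (k.1, finProdFinEquiv k.2))

theorem blockIndex_injective {n t ℓ : ℕ} (h : t * (2 * n) ≤ ℓ) :
    Function.Injective (blockIndex h) := by
  rintro ⟨i, k⟩ ⟨i', k'⟩ hk
  have := finProdFinEquiv.injective (Fin.castLE_injective h hk)
  rw [Prod.mk.injEq] at this
  exact Prod.ext this.1 (finProdFinEquiv.injective this.2)

/-- The two sequences of blocks formed by a family of bits. -/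
def blocksEquiv (n t : ℕ) :
    (Fin t × Fin 2 × Fin n → Bool) ≃ (Fin t → BitStr n) × (Fin t → BitStr n) where
  toFun r := (fun i j => r (i, 0, j), fun i j => r (i, 1, j))
  invFun u k := if k.2.1 = 0 then u.1 k.1 k.2.2 else u.2 k.1 k.2.2
  left_inv r := by
    funext ⟨i, k, j⟩
    fin_cases k <;> simp
  right_inv u := by simp

/-- The isolator on single strings of length `96 b`: whether the inner product of the first and
the last third vanishes. -/
def isoThirds (b : ℕ) (u : BitStr (96 * b)) : Bool :=
  isoList 1 ((List.ofFn u).take (32 * b)).reverse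
    (((List.ofFn u).drop (64 * b)).take (32 * b)).reverse

theorem map_sampleMany (N b ℓ : ℕ) (hb : 0 < b) (hbN : 96 * b ≤ N) (hℓ : 4 * N ≤ ℓ) :
    (PMF.uniformOfFintype (BitStr ℓ)).map (fun r => Prog.result
      (Prog.sampleMany.eval (encodeInput (N, b, List.ofFn r)).length (Function.update (fun _ => [])
        .inp (encodeInput (N, b, List.ofFn r)).reverse)) .ox .oy .oz) =
      (hardDist (96 * b) (numShifts N (96 * b) * 2 ^ numShifts N (96 * b))
        (isoFun (96 * b) (numShifts N (96 * b)))).map List.ofFn := by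
  have hspec := numShifts_spec N (96 * b)
  set n := 96 * b with hn
  set m := numShifts N n with hm
  set t := m * 2 ^ m with ht
  have hle : t * (2 * n) ≤ ℓ := by nlinarith
  rw [hardDist, ← map_uniform_comp (blockIndex hle) (blockIndex_injective hle) (blocksEquiv n t),
    PMF.map_comp, PMF.map_comp]
  congr 1
  funext r
  rw [Prog.eval_sampleMany N b n m (List.ofFn r) hn hm hb hbN (by simpa using hℓ)]
  have hi (i : Fin t) : i * (2 * n) + 2 * n ≤ ℓ := by nlinarith [i.isLt]
  have hx (i : Fin t) : ((List.ofFn r).drop (i * (2 * n))).take n =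
      List.ofFn ((blocksEquiv n t (r ∘ blockIndex hle)).1 i) := by
    rw [take_drop_ofFn r _ _ (by have := hi i; omega)]
    congr 1
    funext j
    simp only [blocksEquiv, blockIndex, Equiv.coe_fn_mk, Function.comp]
    congr 1
    ext
    simp [finProdFinEquiv]
    ring
  have hy (i : Fin t) : ((List.ofFn r).drop (i * (2 * n) + n)).take n =
      List.ofFn ((blocksEquiv n t (r ∘ blockIndex hle)).2 i) := by
    rw [take_drop_ofFn r _ _ (by have := hi i; omega)]
    congr 1
    funext j
    simp only [blocksEquiv, blockIndex, Equiv.coe_fn_mk, Function.comp]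
    congr 1
    ext
    simp [finProdFinEquiv]
    ring
  rw [evenBlocks_eq, evenBlocks_eq, isoBlocks_eq]
  simp only [List.drop_drop, Function.comp, List.ofFn_fin_append, ofFn_concatBits]
  simp only [hx, add_comm n, hy]
  rfl

theorem map_sampleOne (N b ℓ : ℕ) (hbN : 96 * b ≤ N) (hℓ : 4 * N ≤ ℓ) :
    (PMF.uniformOfFintype (BitStr ℓ)).map (fun r => Prog.result
      (Prog.sampleOne.eval (encodeInput (N, b, List.ofFn r)).length (Function.update (fun _ => [])
        .inp (encodeInput (N, b, List.ofFn r)).reverse)) .ox .oy .oz) =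
      (hardDistOne (96 * b) (isoThirds b)).map List.ofFn := by
  have hle : 96 * b ≤ ℓ := by omega
  rw [hardDistOne, ← map_uniform_comp (Fin.castLE hle) (Fin.castLE_injective hle) (Equiv.refl _),
    PMF.map_comp, PMF.map_comp]
  congr 1
  funext r
  rw [Prog.eval_sampleOne N b (List.ofFn r) (by simpa using hle)]
  have h : (List.ofFn r).take (96 * b) = List.ofFn (r ∘ Fin.castLE hle) := by
    have := take_drop_ofFn r 0 (96 * b) (by omega)
    rw [List.drop_zero] at this
    rw [this]
    congr 1
    funext j
    simp only [Function.comp, zero_add]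
    rfl
  simp only [Function.comp_apply, List.ofFn_fin_append, Equiv.refl_apply, isoThirds, ← h,
    List.take_take, List.drop_take]
  rw [min_eq_left (by omega), min_eq_left (by omega)]
  simp

theorem isPolySamplable_hardDist (S : ℕ → ℕ → Prop) (hS : ∀ N b, S N b → 0 < b ∧ 96 * b ≤ N) :
    IsPolySamplable S (fun N b => numShifts N (96 * b) * 2 ^ numShifts N (96 * b) * (96 * b) +
      numShifts N (96 * b) * 2 ^ numShifts N (96 * b) * (96 * b) +
      numShifts N (96 * b) * 2 ^ numShifts N (96 * b))
      (fun N b => hardDist (96 * b) (numShifts N (96 * b) * 2 ^ numShifts N (96 * b))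
        (isoFun (96 * b) (numShifts N (96 * b)))) :=
  ⟨_, Polynomial.C 4 * Polynomial.X, Prog.isPolyTime _ Prog.wf_sampleMany .inp .ox .oy .oz
    (by simp) (by simp) (by simp), fun N b h =>
      map_sampleMany N b _ (hS N b h).1 (hS N b h).2 (by simp)⟩

theorem isPolySamplable_hardDistOne (S : ℕ → ℕ → Prop) (hS : ∀ N b, S N b → 96 * b ≤ N) :
    IsPolySamplable S (fun _ b => 96 * b + 1)
      (fun _ b => hardDistOne (96 * b) (isoThirds b)) :=
  ⟨_, Polynomial.C 4 * Polynomial.X, Prog.isPolyTime _ Prog.wf_sampleOne .inp .ox .oy .oz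
    (by simp) (by simp) (by simp), fun N b h => map_sampleOne N b _ (hS N b h) (by simp)⟩

/-! ### Mixing -/

/-- The function `f` accepts pairs from nonnegative product functions of total mass at most one
as often as an event of probability `μ` would, up to an error `a ε`, if the point masses exceed
the uniform ones by a factor of at most `a`. -/
def Mixes {X Y : Type} [Fintype X] [Fintype Y] (f : X → Y → Bool) (μ ε : ℝ) : Prop :=
  ∀ (a : ℝ) (P : X → ℝ) (R : Y → ℝ), 0 ≤ a → (∀ x, 0 ≤ P x) → (∀ y, 0 ≤ R y) → ∑ x, P x ≤ 1 →
    ∑ y, R y ≤ 1 → (∀ x, P x ≤ a / Fintype.card X) → (∀ y, R y ≤ a / Fintype.card Y) →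
    |∑ x, ∑ y, P x * R y * ((if f x y then 1 else 0) - μ)| ≤ a * ε

theorem Mixes.comp {X Y X' Y' : Type} [Fintype X] [Fintype Y] [Fintype X'] [Fintype Y']
    [DecidableEq X'] [DecidableEq Y'] {f : X' → Y' → Bool} {μ ε : ℝ} (h : Mixes f μ ε)
    (π : X → X') (ρ : Y → Y')
    (hπ : ∀ x', (Finset.univ.filter fun x => π x = x').card * Fintype.card X' = Fintype.card X)
    (hρ : ∀ y', (Finset.univ.filter fun y => ρ y = y').card * Fintype.card Y' = Fintype.card Y) :
    Mixes (fun x y => f (π x) (ρ y)) μ ε := by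
  intro a P R ha hP hR hP1 hR1 hPa hRa
  have key {Z Z' : Type} [Fintype Z] [Fintype Z'] [DecidableEq Z'] (σ : Z → Z')
      (hσ : ∀ z', (Finset.univ.filter fun z => σ z = z').card * Fintype.card Z' = Fintype.card Z)
      (P : Z → ℝ) (hPa : ∀ z, P z ≤ a / Fintype.card Z) (z' : Z') :
      ∑ z with σ z = z', P z ≤ a / Fintype.card Z' := by
    have hpos : (0 : ℝ) < Fintype.card Z' := by
      exact_mod_cast Fintype.card_pos_iff.mpr ⟨z'⟩
    calc ∑ z with σ z = z', P z ≤ ∑ z with σ z = z', a / Fintype.card Z :=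
          Finset.sum_le_sum fun z _ => hPa z
      _ = (Finset.univ.filter fun z => σ z = z').card * (a / Fintype.card Z) := by
          rw [Finset.sum_const, nsmul_eq_mul]
      _ ≤ a / Fintype.card Z' := by
          rw [← hσ z']
          push_cast
          rcases Nat.eq_zero_or_pos (Finset.univ.filter fun z => σ z = z').card with h0 | h0
          · rw [h0]
            simp only [Nat.cast_zero, zero_mul]
            positivity
          · have : (0 : ℝ) < (Finset.univ.filter fun z => σ z = z').card := by exact_mod_cast h0
            apply le_of_eq
            field_simp
  have h1 := h a (fun x' => ∑ x with π x = x', P x) (fun y' => ∑ y with ρ y = y', R y) ha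
    (fun _ => Finset.sum_nonneg fun x _ => hP x) (fun _ => Finset.sum_nonneg fun y _ => hR y)
    (by rw [Finset.sum_fiberwise]; exact hP1) (by rw [Finset.sum_fiberwise]; exact hR1)
    (key π hπ P hPa) (key ρ hρ R hRa)
  convert h1 using 2
  rw [← Finset.sum_fiberwise Finset.univ π]
  refine Finset.sum_congr rfl fun x' _ => ?_
  calc ∑ x with π x = x', ∑ y, P x * R y * ((if f (π x) (ρ y) then 1 else 0) - μ)
      = ∑ x with π x = x', ∑ y', ∑ y with ρ y = y', P x * R y * ((if f x' y' then 1 else 0) - μ) :=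
        Finset.sum_congr rfl fun x hx => by
          rw [← Finset.sum_fiberwise Finset.univ ρ]
          refine Finset.sum_congr rfl fun y' _ => Finset.sum_congr rfl fun y hy => ?_
          rw [(Finset.mem_filter.mp hx).2, (Finset.mem_filter.mp hy).2]
    _ = _ := by
        rw [Finset.sum_comm]
        refine Finset.sum_congr rfl fun y' _ => ?_
        simp only [Finset.sum_mul, Finset.mul_sum]
        exact Finset.sum_comm

/-- The character value `±1` of a bit. -/
def bitSign (p : Bool) : ℝ := if p then -1 else 1

theorem bitSign_sq (p : Bool) : bitSign p * bitSign p = 1 := by cases p <;> simp [bitSign]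

theorem bitSign_ne_zero (p : Bool) : bitSign p ≠ 0 := by cases p <;> simp [bitSign]

theorem bitSign_injective : Function.Injective bitSign := by
  intro p q h
  cases p <;> cases q <;> simp [bitSign] at h ⊢ <;> norm_num at h

theorem bitSign_dotBits (X Y : List Bool) : bitSign (dotBits X Y) =
    ∏ i ∈ Finset.range Y.length, if Y.getD i false then bitSign (X.getD i false) else 1 := by
  induction Y generalizing X with
  | nil => cases X <;> simp [dotBits, bitSign]
  | cons b Y ih =>
    rw [List.length_cons, Finset.prod_range_succ']
    cases X with
    | nil => simp [dotBits, bitSign]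
    | cons a X =>
      simp only [List.getD_cons_succ, List.getD_cons_zero, ← ih X]
      cases a <;> cases b <;> cases h : dotBits X Y <;> simp [dotBits, bitSign, h]

theorem isoList_eq_prod (m : ℕ) (X Y : List Bool) : (if isoList m X Y then (1 : ℝ) else 0) =
    ∏ j ∈ Finset.range m, (1 + bitSign (dotBits (X.drop j) Y)) / 2 := by
  induction m generalizing X with
  | zero => simp [isoList]
  | succ m ih =>
    rw [Finset.prod_range_succ']
    have : ∀ j, X.drop (j + 1) = X.tail.drop j := fun j => by simp [List.drop_tail]
    simp only [this, ← ih, List.drop_zero]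
    cases h : dotBits X Y <;> simp [isoList, h, bitSign]

/-- The sign of the `k`-th coefficient (from the end) of the sum over `j ∈ c` of the `j`-th shifts
of a string. -/
def shiftSign {n : ℕ} (c : Finset ℕ) (x : BitStr n) (k : Fin n) : ℝ :=
  ∏ j ∈ c, bitSign ((List.ofFn x).reverse.getD (n - 1 - k + j) false)

theorem shiftSign_sq {n : ℕ} (c : Finset ℕ) (x : BitStr n) (k : Fin n) :
    shiftSign c x k * shiftSign c x k = 1 := by
  rw [shiftSign, ← Finset.prod_mul_distrib]
  exact Finset.prod_eq_one fun _ _ => bitSign_sq _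

theorem prod_bitSign_dotBits {n : ℕ} (c : Finset ℕ) (x y : BitStr n) :
    ∏ j ∈ c, bitSign (dotBits ((List.ofFn x).reverse.drop j) (List.ofFn y).reverse) =
      ∏ k, if y k then shiftSign c x k else 1 := by
  have h (j : ℕ) : bitSign (dotBits ((List.ofFn x).reverse.drop j) (List.ofFn y).reverse) =
      ∏ k, if y k then bitSign ((List.ofFn x).reverse.getD (n - 1 - k + j) false) else 1 := by
    rw [bitSign_dotBits, Finset.prod_range, ← (finCongr (by simp : n =
      (List.ofFn y).reverse.length)).prod_comp, ← Equiv.prod_comp Fin.revPerm]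
    refine Finset.prod_congr rfl fun k _ => ?_
    have e : (List.ofFn y).reverse.getD (n - (k + 1)) false = y k := by
      rw [List.getD_eq_getElem (List.ofFn y).reverse false (by simp; have := k.isLt; omega)]
      simp only [List.getElem_reverse, List.getElem_ofFn]
      congr 1
      ext
      simp
      omega
    have e2 : n - (k + 1) = n - 1 - (k : ℕ) := by omega
    simp [-List.getD_eq_getElem?_getD, e]
    rw [e2]
    simp [List.getD_eq_getElem?_getD, add_comm]
  simp only [h]
  rw [Finset.prod_comm]
  refine Finset.prod_congr rfl fun k _ => ?_
  by_cases hy : y k <;> simp [hy, shiftSign]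

/-- A nontrivial sum of shifts determines a string up to its first bits. -/
theorem card_shiftSign_fiber {n m : ℕ} (hmn : m ≤ n) (c : Finset ℕ) (hc : c ⊆ Finset.range m)
    (hne : c.Nonempty) (x : BitStr n) :
    (Finset.univ.filter fun x' : BitStr n => shiftSign c x' = shiftSign c x).card ≤ 2 ^ m := by
  classical
  have hcard : Fintype.card (BitStr m) = 2 ^ m := by simp
  rw [← hcard, ← Finset.card_univ]
  refine Finset.card_le_card_of_injOn
    (fun x' i => (List.ofFn x').reverse.getD i false) (fun _ _ => Finset.mem_coe.mpr
    (Finset.mem_univ _)) fun x1 h1 x2 h2 h => ?_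
  have hE : shiftSign c x1 = shiftSign c x2 :=
    (Finset.mem_filter.mp h1).2.trans (Finset.mem_filter.mp h2).2.symm
  have hmax := c.max'_mem hne
  set J := c.max' hne with hJ
  have hJm : J < m := Finset.mem_range.mp (hc hmax)
  have key : ∀ k, k < n → (List.ofFn x1).reverse.getD k false =
      (List.ofFn x2).reverse.getD k false := by
    intro k
    induction k using Nat.strong_induction_on with
    | _ k ih =>
      intro hk
      rcases lt_or_ge k m with hkm | hkm
      · exact congrFun h ⟨k, hkm⟩
      · have hEk := congrFun hE ⟨n - 1 - (k - J), by omega⟩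
        simp only [shiftSign] at hEk
        rw [show n - 1 - (n - 1 - (k - J)) = k - J by omega, ← Finset.mul_prod_erase _ _ hmax,
          ← Finset.mul_prod_erase _ _ hmax, show k - J + J = k by omega,
          Finset.prod_congr rfl (g := fun j => bitSign ((List.ofFn x2).reverse.getD (k - J + j)
            false)) fun j hj => ?_] at hEk
        · exact bitSign_injective (mul_right_cancel₀
            (Finset.prod_ne_zero_iff.mpr fun _ _ => bitSign_ne_zero _) hEk)
        · have hjJ : j < J := lt_of_le_of_ne (c.le_max' _ (Finset.mem_of_mem_erase hj))
            (Finset.ne_of_mem_erase hj)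
          rw [ih (k - J + j) (by omega) (by omega)]
  funext i
  have := key (n - 1 - i) (by omega)
  rw [List.getD_eq_getElem _ _ (by simp; omega), List.getD_eq_getElem _ _ (by simp; omega)] at this
  simp only [List.getElem_reverse, List.getElem_ofFn, List.length_ofFn] at this
  have e : (⟨n - 1 - (n - 1 - i), by omega⟩ : Fin n) = i := by ext; simp; omega
  rwa [e] at this

theorem sum_prod_ite {n : ℕ} (u : Fin n → ℝ) :
    ∑ y : BitStr n, ∏ k, (if y k then u k else 1) = ∏ k, (1 + u k) := by
  have := Finset.prod_univ_sum (fun _ : Fin n => (Finset.univ : Finset Bool))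
    (fun k p => if p then u k else 1)
  rw [Fintype.piFinset_univ] at this
  rw [← this]
  exact Finset.prod_congr rfl fun k _ => by simp [add_comm]

/-- A character sum over a product function is small, by the inequality of Cauchy and Schwarz and
the orthogonality of the characters. -/
theorem sq_char_sum_le {X : Type} [Fintype X] {n M : ℕ} (E : X → Fin n → ℝ)
    (hE : ∀ x k, E x k * E x k = 1) (hM : ∀ x, Nat.card {x' // E x' = E x} ≤ M)
    (P : X → ℝ) (R : BitStr n → ℝ) {p r : ℝ} (hP : ∀ x, 0 ≤ P x) (hR : ∀ y, 0 ≤ R y)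
    (hP1 : ∑ x, P x ≤ 1) (hR1 : ∑ y, R y ≤ 1) (hPp : ∀ x, P x ≤ p) (hRr : ∀ y, R y ≤ r)
    (hp : 0 ≤ p) (hr : 0 ≤ r) :
    (∑ x, ∑ y, P x * R y * ∏ k, if y k then E x k else 1) ^ 2 ≤ r * (2 ^ n * M * p) := by
  classical
  have h1 : ∑ x, ∑ y, P x * R y * (∏ k, if y k then E x k else 1) =
      ∑ y, R y * ∑ x, P x * ∏ k, if y k then E x k else 1 := by
    rw [Finset.sum_comm]
    refine Finset.sum_congr rfl fun y _ => ?_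
    rw [Finset.mul_sum]
    exact Finset.sum_congr rfl fun x _ => by ring
  rw [h1]
  refine (Finset.sum_mul_sq_le_sq_mul_sq _ _ _).trans (mul_le_mul ?_ ?_
    (Finset.sum_nonneg fun _ _ => sq_nonneg _) hr)
  · calc ∑ y, R y ^ 2 ≤ ∑ y, r * R y := Finset.sum_le_sum fun y _ => by
          rw [sq]
          exact mul_le_mul_of_nonneg_right (hRr y) (hR y)
      _ = r * ∑ y, R y := by rw [Finset.mul_sum]
      _ ≤ r := mul_le_of_le_one_right hr hR1
  · have horth (x x' : X) : ∏ k, (1 + E x k * E x' k) = if E x' = E x then (2 : ℝ) ^ n else 0 := by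
      split_ifs with h
      · rw [h]
        simp only [hE]
        norm_num
      · obtain ⟨k, hk⟩ := Function.ne_iff.mp h
        refine Finset.prod_eq_zero (Finset.mem_univ k) ?_
        have h2 : (E x' k - E x k) * (1 + E x k * E x' k) = 0 := by
          linear_combination (E x k) * hE x' k - (E x' k) * hE x k
        exact (mul_eq_zero.mp h2).resolve_left (sub_ne_zero.mpr hk)
    have hfib (x : X) : ∑ x', P x' * (if E x' = E x then (2 : ℝ) ^ n else 0) ≤ 2 ^ n * M * p := by
      calc ∑ x', P x' * (if E x' = E x then (2 : ℝ) ^ n else 0)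
          = ∑ x' with E x' = E x, P x' * 2 ^ n := by
            rw [Finset.sum_filter]
            exact Finset.sum_congr rfl fun x' _ => by split_ifs <;> simp
        _ ≤ ∑ x' with E x' = E x, p * 2 ^ n := Finset.sum_le_sum fun x' _ =>
            mul_le_mul_of_nonneg_right (hPp x') (by positivity)
        _ = (Finset.univ.filter fun x' => E x' = E x).card * (p * 2 ^ n) := by
            rw [Finset.sum_const, nsmul_eq_mul]
        _ ≤ M * (p * 2 ^ n) := by
            refine mul_le_mul_of_nonneg_right ?_ (by positivity)
            have := hM x
            rw [Nat.card_eq_fintype_card, Fintype.card_subtype] at this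
            exact_mod_cast this
        _ = 2 ^ n * M * p := by ring
    calc ∑ y : BitStr n, (∑ x, P x * ∏ k, if y k then E x k else 1) ^ 2
        = ∑ x, P x * ∑ x', P x' * ∏ k, (1 + E x k * E x' k) := by
          simp only [sq, Finset.sum_mul_sum, ← sum_prod_ite]
          rw [Finset.sum_comm]
          refine Finset.sum_congr rfl fun x _ => ?_
          rw [Finset.sum_comm, Finset.mul_sum]
          refine Finset.sum_congr rfl fun x' _ => ?_
          rw [Finset.mul_sum, Finset.mul_sum]
          refine Finset.sum_congr rfl fun y _ => ?_
          rw [mul_mul_mul_comm, ← Finset.prod_mul_distrib, mul_assoc]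
          congr 3
          funext k
          split_ifs <;> simp
      _ ≤ ∑ x, P x * (2 ^ n * M * p) := Finset.sum_le_sum fun x _ => by
          simp only [horth]
          exact mul_le_mul_of_nonneg_left (hfib x) (hP x)
      _ = (∑ x, P x) * (2 ^ n * M * p) := by rw [Finset.sum_mul]
      _ ≤ 2 ^ n * M * p := mul_le_of_le_one_left (by positivity) hP1

theorem mixes_isoFun {n m : ℕ} (hmn : m ≤ n) :
    Mixes (fun x y => isoFun n m (x, y)) (1 / 2 ^ m) (Real.sqrt (2 ^ m / 2 ^ n)) := by
  classical
  intro a P R ha hP hR hP1 hR1 hPa hRa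
  have hexp (x y : BitStr n) : (if isoFun n m (x, y) then (1 : ℝ) else 0) - 1 / 2 ^ m =
      ∑ c ∈ (Finset.range m).powerset.erase ∅, 1 / 2 ^ m *
        ∏ k, if y k then shiftSign c x k else 1 := by
    rw [isoFun, isoList_eq_prod, Finset.prod_div_distrib, Finset.prod_const, Finset.card_range,
      Finset.prod_one_add, ← Finset.add_sum_erase _ _ (Finset.empty_mem_powerset _)]
    simp only [prod_bitSign_dotBits, Finset.prod_empty, ← Finset.mul_sum]
    simp [shiftSign]
    ring
  have hbound (c : Finset ℕ) (hc : c ∈ (Finset.range m).powerset.erase ∅) :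
      |∑ x, ∑ y, P x * R y * ∏ k, if y k then shiftSign c x k else 1| ≤
        a * Real.sqrt (2 ^ m / 2 ^ n) := by
    rw [Finset.mem_erase, Finset.mem_powerset] at hc
    have h2 : (0 : ℝ) < 2 ^ n := by positivity
    have hcardn : (Fintype.card (BitStr n) : ℝ) = 2 ^ n := by simp
    have := sq_char_sum_le (shiftSign c) (shiftSign_sq c) (M := 2 ^ m) (fun x => by
      rw [Nat.card_eq_fintype_card, Fintype.card_subtype]
      exact card_shiftSign_fiber hmn c hc.2 (Finset.nonempty_iff_ne_empty.mpr hc.1) x) P R hP hR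
      hP1 hR1 hPa hRa (by positivity) (by positivity)
    refine abs_le_of_sq_le_sq (this.trans (le_of_eq ?_)) (by positivity)
    rw [mul_pow, Real.sq_sqrt (by positivity), hcardn]
    push_cast
    field_simp
  calc |∑ x, ∑ y, P x * R y * ((if isoFun n m (x, y) then 1 else 0) - 1 / 2 ^ m)|
      = |∑ c ∈ (Finset.range m).powerset.erase ∅, 1 / 2 ^ m *
          ∑ x, ∑ y, P x * R y * ∏ k, if y k then shiftSign c x k else 1| := by
        congr 1
        simp only [hexp, Finset.mul_sum]
        symm
        rw [Finset.sum_comm]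
        refine Finset.sum_congr rfl fun x _ => ?_
        rw [Finset.sum_comm]
        refine Finset.sum_congr rfl fun y _ => Finset.sum_congr rfl fun c _ => ?_
        ring
    _ ≤ ∑ c ∈ (Finset.range m).powerset.erase ∅, 1 / 2 ^ m * (a * Real.sqrt (2 ^ m / 2 ^ n)) := by
        refine (Finset.abs_sum_le_sum_abs _ _).trans (Finset.sum_le_sum fun c hc => ?_)
        rw [abs_mul, abs_of_pos (by positivity)]
        exact mul_le_mul_of_nonneg_left (hbound c hc) (by positivity)
    _ ≤ ∑ c ∈ (Finset.range m).powerset, 1 / 2 ^ m * (a * Real.sqrt (2 ^ m / 2 ^ n)) :=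
        Finset.sum_le_sum_of_subset_of_nonneg (Finset.erase_subset _ _) fun _ _ _ => by positivity
    _ = a * Real.sqrt (2 ^ m / 2 ^ n) := by
        rw [Finset.sum_const, Finset.card_powerset, Finset.card_range, nsmul_eq_mul]
        push_cast
        field_simp

/-! ### Communication sources and isolators -/

theorem prob_eq_sum {Ω : Type} [Fintype Ω] (X : PMF Ω) (S : Set Ω) [DecidablePred (· ∈ S)] :
    prob X S = ∑ x, if x ∈ S then (X x).toReal else 0 := by
  classical
  rw [prob, PMF.toOuterMeasure_apply_fintype, ENNReal.toReal_sum fun x _ => by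
    by_cases h : x ∈ S <;> simp [h, X.apply_ne_top x]]
  refine Finset.sum_congr rfl fun x _ => ?_
  by_cases h : x ∈ S <;> simp [h]

theorem sum_toReal_pmf {Ω : Type} [Fintype Ω] (X : PMF Ω) : ∑ x, (X x).toReal = 1 := by
  rw [← ENNReal.toReal_sum fun x _ => X.apply_ne_top x, ← tsum_fintype (L := .unconditional _), X.tsum_coe,
    ENNReal.toReal_one]

/-- The outputs of a protocol split along at most `2^cost` transcripts, each of which contributes
a product. -/
theorem Protocol.exists_rectangles {A B X Y : Type} [Fintype X] [Fintype Y] [DecidableEq X]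
    [DecidableEq Y] (π : Protocol A B X Y) :
    ∃ (I : Type) (_ : Fintype I) (F : I → A → X → ENNReal) (G : I → B → Y → ENNReal),
      Fintype.card I ≤ 2 ^ π.cost ∧ (∀ i a, ∑ x, F i a x ≤ 1) ∧ (∀ i b, ∑ y, G i b y ≤ 1) ∧
      ∀ a b x y, ∑ i, F i a x * G i b y = if π.run a b = (x, y) then 1 else 0 := by
  induction π with
  | output outA outB =>
    refine ⟨Unit, inferInstance, fun _ a x => if outA a = x then 1 else 0,
      fun _ b y => if outB b = y then 1 else 0, by simp [Protocol.cost], by simp, by simp,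
      fun a b x y => ?_⟩
    by_cases h1 : outA a = x <;> by_cases h2 : outB b = y <;> simp [Protocol.run, h1, h2]
  | alice msg next ih =>
    choose I hI F G hc hF hG h using ih
    refine ⟨Σ d, I d, inferInstance, fun i a x => if msg a = i.1 then F i.1 i.2 a x else 0,
      fun i => G i.1 i.2, ?_, fun i a => ?_, fun i b => hG _ _ b, fun a b x y => ?_⟩
    · rw [Fintype.card_sigma, Fintype.sum_bool, Protocol.cost, pow_add, pow_one, two_mul]
      exact add_le_add ((hc true).trans (Nat.pow_le_pow_right (by simp) (le_max_right _ _)))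
        ((hc false).trans (Nat.pow_le_pow_right (by simp) (le_max_left _ _)))
    · by_cases hm : msg a = i.1
      · simpa [hm] using hF i.1 i.2 a
      · simp [hm]
    · rw [Fintype.sum_sigma, Finset.sum_eq_single (msg a)]
      · refine Eq.trans ?_ (h (msg a) a b x y)
        exact Finset.sum_congr rfl fun i _ => by simp
      · intro d _ hd
        simp [hd.symm]
      · simp
  | bob msg next ih =>
    choose I hI F G hc hF hG h using ih
    refine ⟨Σ d, I d, inferInstance, fun i => F i.1 i.2,
      fun i b y => if msg b = i.1 then G i.1 i.2 b y else 0, ?_, fun i a => hF _ _ a,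
      fun i b => ?_, fun a b x y => ?_⟩
    · rw [Fintype.card_sigma, Fintype.sum_bool, Protocol.cost, pow_add, pow_one, two_mul]
      exact add_le_add ((hc true).trans (Nat.pow_le_pow_right (by simp) (le_max_right _ _)))
        ((hc false).trans (Nat.pow_le_pow_right (by simp) (le_max_left _ _)))
    · by_cases hm : msg b = i.1
      · simpa [hm] using hG i.1 i.2 b
      · simp [hm]
    · rw [Fintype.sum_sigma, Finset.sum_eq_single (msg b)]
      · refine Eq.trans ?_ (h (msg b) a b x y)
        exact Finset.sum_congr rfl fun i _ => by simp
      · intro d _ hd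
        simp [hd.symm]
      · simp

theorem sum_tsum_mul_le_one {A X I : Type} [Fintype X] (μ : PMF A) (F : I → A → X → ENNReal)
    (hF : ∀ i a, ∑ x, F i a x ≤ 1) (i : I) : ∑ x, (∑' a, μ a * F i a x) ≤ 1 := by
  rw [← Summable.tsum_finsetSum fun _ _ => ENNReal.summable, ← μ.tsum_coe]
  refine ENNReal.tsum_le_tsum fun a => ?_
  rw [← Finset.mul_sum]
  exact mul_le_of_le_one_right (by simp) (hF i a)

/-- A communication source of cost at most `c` is a sum of at most `2^c` product functions. -/
theorem exists_products_of_mem_commSources {X Y : Type} [Fintype X] [Fintype Y] {c : ℝ}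
    {P : PMF (X × Y)} (hP : P ∈ commSources X Y c) :
    ∃ (I : Type) (_ : Fintype I) (A : I → X → ℝ) (B : I → Y → ℝ),
      (Fintype.card I : ℝ) ≤ 2 ^ c ∧ (∀ i x, 0 ≤ A i x) ∧ (∀ i y, 0 ≤ B i y) ∧
      (∀ i, ∑ x, A i x ≤ 1) ∧ (∀ i, ∑ y, B i y ≤ 1) ∧
      ∀ x y, (P (x, y)).toReal = ∑ i, A i x * B i y := by
  classical
  obtain ⟨A, B, μ, ν, π, hc, rfl⟩ := hP
  obtain ⟨I, hI, F, G, hcard, hF, hG, hrun⟩ := π.exists_rectangles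
  have hA := sum_tsum_mul_le_one μ F hF
  have hB := sum_tsum_mul_le_one ν G hG
  have hA' (i x) : (∑' a, μ a * F i a x) ≠ ⊤ :=
    ((Finset.single_le_sum (f := fun x => ∑' a, μ a * F i a x) (fun _ _ => by simp)
      (Finset.mem_univ x)).trans (hA i)).trans_lt ENNReal.one_lt_top |>.ne
  have hB' (i y) : (∑' b, ν b * G i b y) ≠ ⊤ :=
    ((Finset.single_le_sum (f := fun y => ∑' b, ν b * G i b y) (fun _ _ => by simp)
      (Finset.mem_univ y)).trans (hB i)).trans_lt ENNReal.one_lt_top |>.ne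
  refine ⟨I, hI, fun i x => (∑' a, μ a * F i a x).toReal, fun i y => (∑' b, ν b * G i b y).toReal,
    ?_, fun _ _ => ENNReal.toReal_nonneg, fun _ _ => ENNReal.toReal_nonneg, fun i => ?_, fun i => ?_,
    fun x y => ?_⟩
  · calc (Fintype.card I : ℝ) ≤ 2 ^ π.cost := by exact_mod_cast hcard
      _ = (2 : ℝ) ^ (π.cost : ℝ) := (Real.rpow_natCast _ _).symm
      _ ≤ 2 ^ c := Real.rpow_le_rpow_of_exponent_le (by norm_num) hc
  · rw [← ENNReal.toReal_sum fun x _ => hA' i x, ← ENNReal.toReal_one]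
    exact ENNReal.toReal_mono ENNReal.one_ne_top (hA i)
  · rw [← ENNReal.toReal_sum fun x _ => hB' i x, ← ENNReal.toReal_one]
    exact ENNReal.toReal_mono ENNReal.one_ne_top (hB i)
  · simp only [← ENNReal.toReal_mul]
    rw [← ENNReal.toReal_sum fun i _ => ENNReal.mul_ne_top (hA' i x) (hB' i y)]
    congr 1
    rw [PMF.bind_apply]
    have h1 (i : I) : (∑' a, μ a * F i a x) * (∑' b, ν b * G i b y) =
        ∑' a, μ a * ∑' b, ν b * (F i a x * G i b y) := by
      rw [← ENNReal.tsum_mul_right]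
      refine tsum_congr fun a => ?_
      rw [mul_assoc]
      congr 1
      rw [← ENNReal.tsum_mul_left]
      refine tsum_congr fun b => ?_
      ring
    simp only [h1]
    rw [← Summable.tsum_finsetSum fun _ _ => ENNReal.summable]
    refine tsum_congr fun a => ?_
    rw [← Finset.mul_sum, ← Summable.tsum_finsetSum fun _ _ => ENNReal.summable]
    congr 1
    rw [PMF.map_apply]
    refine tsum_congr fun b => ?_
    rw [← Finset.mul_sum, hrun]
    by_cases h : π.run a b = (x, y)
    · simp [h]
    · simp [h, Ne.symm (a := π.run a b) h]

/-- Truncating the point masses of a product function at `a` times the uniform ones. -/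
theorem Mixes.truncated_le {X Y : Type} [Fintype X] [Fintype Y] {f : X → Y → Bool} {μ ε : ℝ}
    (h : Mixes f μ ε) (hμ : 0 ≤ μ) {a : ℝ} (ha : 0 ≤ a) (P : X → ℝ) (R : Y → ℝ)
    (hP : ∀ x, 0 ≤ P x) (hR : ∀ y, 0 ≤ R y) (hP1 : ∑ x, P x ≤ 1) (hR1 : ∑ y, R y ≤ 1) :
    ∑ x, ∑ y, (if P x ≤ a / Fintype.card X ∧ R y ≤ a / Fintype.card Y ∧ f x y then P x * R y
      else 0) ≤ μ * ∑ x, ∑ y, P x * R y + a * ε := by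
  set P' : X → ℝ := fun x => if P x ≤ a / Fintype.card X then P x else 0 with hP'
  set R' : Y → ℝ := fun y => if R y ≤ a / Fintype.card Y then R y else 0 with hR'
  have hPP (x) : P' x ≤ P x := by simp only [hP']; split_ifs; exacts [le_rfl, hP x]
  have hRR (y) : R' y ≤ R y := by simp only [hR']; split_ifs; exacts [le_rfl, hR y]
  have hP0 (x) : 0 ≤ P' x := by simp only [hP']; split_ifs; exacts [hP x, le_rfl]
  have hR0 (y) : 0 ≤ R' y := by simp only [hR']; split_ifs; exacts [hR y, le_rfl]
  have h1 := le_of_abs_le (h a P' R' ha hP0 hR0 ((Finset.sum_le_sum fun x _ => hPP x).trans hP1)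
    ((Finset.sum_le_sum fun x _ => hRR x).trans hR1)
    (fun x => by simp only [hP']; split_ifs with h; exacts [h, by positivity])
    (fun y => by simp only [hR']; split_ifs with h; exacts [h, by positivity]))
  have h2 : ∑ x, ∑ y, (if P x ≤ a / Fintype.card X ∧ R y ≤ a / Fintype.card Y ∧ f x y then P x * R y
      else 0) = ∑ x, ∑ y, P' x * R' y * ((if f x y then 1 else 0) - μ) +
        μ * ∑ x, ∑ y, P' x * R' y := by
    simp only [Finset.mul_sum, ← Finset.sum_add_distrib]
    refine Finset.sum_congr rfl fun x _ => Finset.sum_congr rfl fun y _ => ?_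
    by_cases c1 : P x ≤ a / Fintype.card X <;> by_cases c2 : R y ≤ a / Fintype.card Y <;>
      by_cases c3 : f x y <;> simp [hP', hR', c1, c2, c3] <;> ring
  rw [h2]
  have h3 : ∑ x, ∑ y, P' x * R' y ≤ ∑ x, ∑ y, P x * R y :=
    Finset.sum_le_sum fun x _ => Finset.sum_le_sum fun y _ =>
      mul_le_mul (hPP x) (hRR y) (hR0 y) (hP x)
  have := mul_le_mul_of_nonneg_left h3 hμ
  linarith

/-- A sum of few product functions puts little more than the fraction `μ` of its mass on accepted
light points: where one factor of a product is large, the other factor is small. -/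
theorem Mixes.light_le {X Y I : Type} [Fintype X] [Fintype Y] [Fintype I] {f : X → Y → Bool}
    {μ ε : ℝ} (h : Mixes f μ ε) (hμ : 0 ≤ μ) {a : ℝ} (ha : 0 < a) {ℓ : ℝ} (hℓ : 0 ≤ ℓ)
    (A : I → X → ℝ) (B : I → Y → ℝ) (hA : ∀ i x, 0 ≤ A i x) (hB : ∀ i y, 0 ≤ B i y)
    (hA1 : ∀ i, ∑ x, A i x ≤ 1) (hB1 : ∀ i, ∑ y, B i y ≤ 1) (P : X → Y → ℝ)
    (hP : ∀ x y, P x y = ∑ i, A i x * B i y) (hP1 : ∑ x, ∑ y, P x y ≤ 1) :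
    ∑ x, ∑ y, (if P x y ≤ ℓ ∧ f x y then P x y else 0) ≤
      μ + Fintype.card I * (a * ε + 2 * (Fintype.card X * Fintype.card Y * ℓ / a)) := by
  have hAB (i x y) : 0 ≤ A i x * B i y := mul_nonneg (hA i x) (hB i y)
  have hle (i x y) : A i x * B i y ≤ P x y := by
    rw [hP]
    exact Finset.single_le_sum (f := fun i => A i x * B i y) (fun i _ => hAB i x y)
      (Finset.mem_univ i)
  have hsmall (p q m : ℝ) (hp : 0 ≤ p) (hm : 0 < m) (hq : 0 ≤ q) (hpq : p * q ≤ ℓ)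
      (hbig : a / m < p) : q ≤ m * ℓ / a := by
    rw [div_lt_iff₀ hm] at hbig
    rw [le_div_iff₀ ha]
    nlinarith
  set α : ℝ := Fintype.card X * Fintype.card Y * ℓ / a with hα
  have hX (x : X) : (0 : ℝ) < Fintype.card X := by exact_mod_cast Fintype.card_pos_iff.mpr ⟨x⟩
  have hY (y : Y) : (0 : ℝ) < Fintype.card Y := by exact_mod_cast Fintype.card_pos_iff.mpr ⟨y⟩
  have hpt (i x y) : (if P x y ≤ ℓ ∧ f x y then A i x * B i y else 0) ≤
      (if A i x ≤ a / Fintype.card X ∧ B i y ≤ a / Fintype.card Y ∧ f x y then A i x * B i y else 0)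
        + (A i x * (Fintype.card X * ℓ / a) + B i y * (Fintype.card Y * ℓ / a)) := by
    have e1 : 0 ≤ A i x * (Fintype.card X * ℓ / a) :=
      mul_nonneg (hA i x) (by positivity)
    have e2 : 0 ≤ B i y * (Fintype.card Y * ℓ / a) :=
      mul_nonneg (hB i y) (by positivity)
    by_cases c : P x y ≤ ℓ ∧ f x y
    · rw [if_pos c]
      by_cases c1 : A i x ≤ a / Fintype.card X
      · by_cases c2 : B i y ≤ a / Fintype.card Y
        · rw [if_pos ⟨c1, c2, c.2⟩]
          linarith
        · have := hsmall (B i y) (A i x) _ (hB i y) (hY y) (hA i x)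
            (by rw [mul_comm]; exact (hle i x y).trans c.1) (not_le.mp c2)
          have := mul_le_mul_of_nonneg_left this (hB i y)
          rw [if_neg fun h => c2 h.2.1]
          linarith
      · have := hsmall (A i x) (B i y) _ (hA i x) (hX x) (hB i y)
          ((hle i x y).trans c.1) (not_le.mp c1)
        have := mul_le_mul_of_nonneg_left this (hA i x)
        rw [if_neg fun h => c1 h.1]
        linarith
    · rw [if_neg c]
      have : 0 ≤ (if A i x ≤ a / Fintype.card X ∧ B i y ≤ a / Fintype.card Y ∧ f x y then
        A i x * B i y else 0) := by
        split_ifs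
        exacts [hAB i x y, le_rfl]
      linarith
  have hi (i : I) : ∑ x, ∑ y, (if P x y ≤ ℓ ∧ f x y then A i x * B i y else 0) ≤
      μ * ∑ x, ∑ y, A i x * B i y + (a * ε + 2 * α) := by
    refine (Finset.sum_le_sum fun x _ => Finset.sum_le_sum fun y _ => hpt i x y).trans ?_
    simp only [Finset.sum_add_distrib, Finset.sum_const, Finset.card_univ, nsmul_eq_mul,
      ← Finset.mul_sum, ← Finset.sum_mul]
    have h1 := h.truncated_le hμ ha.le (A i) (B i) (hA i) (hB i) (hA1 i) (hB1 i)
    have h2 : (∑ x, (Fintype.card Y : ℝ) * (A i x * (Fintype.card X * ℓ / a))) ≤ α := by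
      rw [← Finset.mul_sum, ← Finset.sum_mul]
      calc _ ≤ (Fintype.card Y : ℝ) * (1 * (Fintype.card X * ℓ / a)) := by
            gcongr
            exact hA1 i
        _ = α := by rw [hα]; ring
    have h3 : (Fintype.card X : ℝ) * ((∑ y, B i y) * (Fintype.card Y * ℓ / a)) ≤ α := by
      calc _ ≤ (Fintype.card X : ℝ) * (1 * (Fintype.card Y * ℓ / a)) := by
            gcongr
            exact hB1 i
        _ = α := by rw [hα]; ring
    simp only [← Finset.mul_sum, ← Finset.sum_mul] at h1 h2
    linarith
  calc ∑ x, ∑ y, (if P x y ≤ ℓ ∧ f x y then P x y else 0)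
      = ∑ i, ∑ x, ∑ y, (if P x y ≤ ℓ ∧ f x y then A i x * B i y else 0) := by
        symm
        rw [Finset.sum_comm]
        refine Finset.sum_congr rfl fun x _ => ?_
        rw [Finset.sum_comm]
        refine Finset.sum_congr rfl fun y _ => ?_
        split_ifs
        · exact (hP x y).symm
        · simp
    _ ≤ ∑ i, (μ * ∑ x, ∑ y, A i x * B i y + (a * ε + 2 * α)) := Finset.sum_le_sum fun i _ => hi i
    _ = μ * ∑ x, ∑ y, P x y + Fintype.card I * (a * ε + 2 * α) := by
        rw [Finset.sum_add_distrib, ← Finset.mul_sum, Finset.sum_const, Finset.card_univ,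
          nsmul_eq_mul, Finset.sum_comm]
        congr 2
        refine Finset.sum_congr rfl fun x _ => ?_
        rw [Finset.sum_comm]
        simp only [hP]
    _ ≤ _ := by
        have := mul_le_mul_of_nonneg_left hP1 hμ
        linarith

theorem Mixes.uniform {X Y : Type} [Fintype X] [Fintype Y] [Nonempty X] [Nonempty Y]
    {f : X → Y → Bool} {μ ε : ℝ} (h : Mixes f μ ε) :
    |∑ x, ∑ y, (if f x y then 1 / (Fintype.card X * Fintype.card Y : ℝ) else 0) - μ| ≤ ε := by
  have hX : (Fintype.card X : ℝ) ≠ 0 := by exact_mod_cast Fintype.card_ne_zero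
  have hY : (Fintype.card Y : ℝ) ≠ 0 := by exact_mod_cast Fintype.card_ne_zero
  have := h 1 (fun _ => 1 / Fintype.card X) (fun _ => 1 / Fintype.card Y) zero_le_one
    (fun _ => by positivity) (fun _ => by positivity) (by simp [hX]) (by simp [hY])
    (fun _ => le_rfl) (fun _ => le_rfl)
  rw [one_mul] at this
  convert this using 2
  have e (x : X) (y : Y) : 1 / (Fintype.card X : ℝ) * (1 / Fintype.card Y) *
      ((if f x y then 1 else 0) - μ) = (if f x y then 1 / (Fintype.card X * Fintype.card Y : ℝ)
        else 0) - μ * (1 / (Fintype.card X * Fintype.card Y)) := by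
    split_ifs <;> field_simp
    simp
  simp only [e, Finset.sum_sub_distrib, Finset.sum_const, Finset.card_univ, nsmul_eq_mul]
  field_simp

/-- Mixing functions are isolators for communication sources. -/
theorem Mixes.isIsolator {X Y : Type} [Fintype X] [Fintype Y] [Nonempty X] [Nonempty Y]
    {f : X → Y → Bool} {μ ε : ℝ} (h : Mixes f μ ε) (hμ : 0 ≤ μ) {c k a η : ℝ} (ha : 0 < a)
    (hε : ε ≤ η) (hη : 2 ^ c * (a * ε + 2 * (Fintype.card X * Fintype.card Y * 2 ^ (-k) / a)) ≤ η) :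
    IsIsolator (μ - η) (μ + η) k (fun p : X × Y => f p.1 p.2) (commSources X Y c) := by
  classical
  have hu := h.uniform
  have hε0 : 0 ≤ ε := (abs_nonneg _).trans hu
  refine ⟨?_, fun P hP => ?_⟩
  · rw [prob_eq_sum, Fintype.sum_prod_type]
    simp only [Set.mem_ofPred_eq, PMF.uniformOfFintype_apply, Fintype.card_prod, Nat.cast_mul,
      ENNReal.toReal_inv, ENNReal.toReal_mul, ENNReal.toReal_natCast]
    simp only [one_div] at hu
    have := neg_le_of_abs_le hu
    linarith
  · obtain ⟨I, hI, A, B, hcard, hA, hB, hA1, hB1, hAB⟩ := exists_products_of_mem_commSources hP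
    have := h.light_le hμ ha (ℓ := 2 ^ (-k)) (by positivity) A B hA hB hA1 hB1
      (fun x y => (P (x, y)).toReal) hAB
      (by rw [← Fintype.sum_prod_type (f := fun p => (P p).toReal), sum_toReal_pmf])
    rw [prob_eq_sum, Fintype.sum_prod_type]
    simp only [Set.mem_ofPred_eq]
    refine this.trans (add_le_add_right (le_trans ?_ hη) _)
    gcongr

/-! ### The two isolators -/

theorem sqrt_two_pow_div (m n : ℕ) :
    Real.sqrt (2 ^ m / 2 ^ n) = (2 : ℝ) ^ (((m : ℝ) - n) / 2) := by
  rw [Real.sqrt_eq_rpow, ← Real.rpow_natCast, ← Real.rpow_natCast, ← Real.rpow_sub (by norm_num),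
    ← Real.rpow_mul (by norm_num)]
  congr 1
  ring

theorem rpow_two_mono {x y : ℝ} (h : x ≤ y) : (2 : ℝ) ^ x ≤ 2 ^ y :=
  Real.rpow_le_rpow_of_exponent_le (by norm_num) h

theorem two_mul_rpow (x : ℝ) : 2 * (2 : ℝ) ^ x = 2 ^ (x + 1) := by
  rw [Real.rpow_add_one (by norm_num), mul_comm]

theorem isIsolator_isoFun {n m : ℕ} (hn : 96 ≤ n) (hm : (m : ℝ) ≤ 1 / 100 * n) :
    IsIsolator ((2 : ℝ) ^ (-(m : ℝ)) - (2 : ℝ) ^ (-(1 / 100 * n : ℝ)))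
      ((2 : ℝ) ^ (-(m : ℝ)) + (2 : ℝ) ^ (-(1 / 100 * n : ℝ))) ((1 - 1 / 100) * (2 * n))
      (isoFun n m) (commSources (BitStr n) (BitStr n) (1 / 100 * n)) := by
  have hn' : (96 : ℝ) ≤ n := by exact_mod_cast hn
  have hmn : m ≤ n := by
    have : (m : ℝ) ≤ n := by linarith
    exact_mod_cast this
  have hμ : (2 : ℝ) ^ (-(m : ℝ)) = 1 / 2 ^ m := by
    rw [Real.rpow_neg (by norm_num), Real.rpow_natCast, one_div]
  have hcard : (Fintype.card (BitStr n) : ℝ) = 2 ^ (n : ℝ) := by simp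
  rw [hμ]
  refine (mixes_isoFun hmn).isIsolator (by positivity) (a := 2 ^ (1 / 4 * n : ℝ)) (by positivity)
    ?_ ?_
  · rw [sqrt_two_pow_div]
    exact rpow_two_mono (by linarith)
  · rw [sqrt_two_pow_div, hcard, ← Real.rpow_add (by norm_num), ← Real.rpow_add (by norm_num),
      ← Real.rpow_add (by norm_num), ← Real.rpow_sub (by norm_num), two_mul_rpow, mul_add,
      ← Real.rpow_add (by norm_num), ← Real.rpow_add (by norm_num)]
    have h1 : (2 : ℝ) ^ (1 / 100 * n + (1 / 4 * n + ((m : ℝ) - n) / 2) : ℝ) ≤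
        2 ^ (-(1 / 100 * n) - 1 : ℝ) := rpow_two_mono (by linarith)
    have h2 : (2 : ℝ) ^ (1 / 100 * n + (n + n + -((1 - 1 / 100) * (2 * n)) - 1 / 4 * n + 1) : ℝ) ≤
        2 ^ (-(1 / 100 * n) - 1 : ℝ) := rpow_two_mono (by linarith)
    have h3 := two_mul_rpow (-(1 / 100 * n) - 1 : ℝ)
    rw [sub_add_cancel] at h3
    linarith

/-- All fibres of a map reading distinct positions of a string have the same size. -/
theorem card_fiber_comp {κ ι : Type} [Fintype κ] [Fintype ι] [DecidableEq κ] [DecidableEq ι]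
    (e : κ → ι) (he : Function.Injective e) (u : κ → Bool) :
    (Finset.univ.filter fun x : ι → Bool => x ∘ e = u).card * Fintype.card (κ → Bool) =
      Fintype.card (ι → Bool) := by
  classical
  let E : (ι → Bool) ≃ (κ → Bool) × ({i // ¬ i ∈ Set.range e} → Bool) :=
    (Equiv.piEquivPiSubtypeProd (fun i => i ∈ Set.range e) fun _ => Bool).trans
      (Equiv.prodCongr (Equiv.arrowCongr (Equiv.ofInjective e he).symm (Equiv.refl Bool))
        (Equiv.refl _))
  have hE (x : ι → Bool) : (E x).1 = x ∘ e := rfl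
  have h1 : (Finset.univ.filter fun x : ι → Bool => x ∘ e = u).card =
      Fintype.card ({i // ¬ i ∈ Set.range e} → Bool) := by
    rw [← Finset.card_univ]
    refine Finset.card_bij' (fun x _ => (E x).2) (fun v _ => E.symm (u, v)) (by simp) ?_ ?_ (by simp)
    · intro v _
      rw [Finset.mem_filter, ← hE, Equiv.apply_symm_apply]
      exact ⟨Finset.mem_univ _, rfl⟩
    · intro x hx
      rw [Finset.mem_filter, ← hE] at hx
      rw [← hx.2]
      exact E.symm_apply_apply x
  rw [h1, Fintype.card_congr E, Fintype.card_prod, mul_comm]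

/-- The two halves of a string form a pair, bijectively. -/
def halvesEquiv (n : ℕ) : BitStr n ≃ BitStr (n / 2) × BitStr (n - n / 2) where
  toFun := halves n
  invFun p i := if h : (i : ℕ) < n / 2 then p.1 ⟨i, h⟩ else p.2 ⟨i - n / 2, by omega⟩
  left_inv x := by
    funext i
    by_cases h : (i : ℕ) < n / 2
    · simp [halves, h]
    · simp only [halves, h, dite_false]
      congr 1
      ext
      simp
      omega
  right_inv p := by
    refine Prod.ext ?_ ?_
    · funext i
      simp [halves]
    · funext i
      simp [halves]

/-- The first third of the string, as a function of its first half. -/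
def firstThird (b : ℕ) (x : BitStr (96 * b / 2)) : BitStr (32 * b) := fun i => x ⟨i, by omega⟩

/-- The last third of the string, as a function of its second half. -/
def lastThird (b : ℕ) (y : BitStr (96 * b - 96 * b / 2)) : BitStr (32 * b) :=
  fun i => y ⟨16 * b + i, by omega⟩

theorem isoThirds_apply (b : ℕ) (u : BitStr (96 * b)) : isoThirds b u =
    isoFun (32 * b) 1 (fun i => u ⟨i, by omega⟩, fun i => u ⟨64 * b + i, by omega⟩) := by
  have h1 := take_drop_ofFn u 0 (32 * b) (by omega)
  rw [List.drop_zero] at h1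
  rw [isoThirds, isoFun, h1, take_drop_ofFn u _ _ (by omega)]
  simp only [zero_add]

theorem isoThirds_eq (b : ℕ) (u : BitStr (96 * b)) : isoThirds b u =
    isoFun (32 * b) 1 (firstThird b (halves _ u).1, lastThird b (halves _ u).2) := by
  rw [isoThirds_apply]
  congr 2
  funext j
  simp only [lastThird, halves]
  congr 2
  omega

theorem mixes_thirds {b : ℕ} (hb : 0 < b) :
    Mixes (fun x y => isoFun (32 * b) 1 (firstThird b x, lastThird b y)) (1 / 2)
      (2 ^ ((1 - 32 * b : ℝ) / 2)) := by
  have h := mixes_isoFun (n := 32 * b) (m := 1) (by omega)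
  rw [sqrt_two_pow_div] at h
  push_cast at h
  rw [pow_one] at h
  refine h.comp (firstThird b) (lastThird b)
    (fun u => card_fiber_comp (fun i : Fin (32 * b) => (⟨i, by omega⟩ : Fin (96 * b / 2)))
      (fun i j hij => by simpa [Fin.ext_iff] using hij) u)
    (fun u => card_fiber_comp
      (fun i : Fin (32 * b) => (⟨16 * b + i, by omega⟩ : Fin (96 * b - 96 * b / 2)))
      (fun i j hij => by simpa [Fin.ext_iff] using hij) u)

theorem isIsolator_isoThirds {b : ℕ} (hb : 0 < b) :
    IsIsolator (1 / 2 - (2 : ℝ) ^ (-(1 / 100 * (96 * b : ℕ) : ℝ)))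
      (1 / 2 + (2 : ℝ) ^ (-(1 / 100 * (96 * b : ℕ) : ℝ))) ((1 - 1 / 100) * (96 * b : ℕ))
      (isoThirds b) (halvesCommSources (96 * b) (1 / 100 * (96 * b : ℕ))) := by
  classical
  have hb' : (1 : ℝ) ≤ b := by exact_mod_cast hb
  have hcard : (Fintype.card (BitStr (96 * b / 2)) : ℝ) * Fintype.card
      (BitStr (96 * b - 96 * b / 2)) = 2 ^ (96 * b : ℝ) := by
    have : Fintype.card (BitStr (96 * b / 2)) * Fintype.card (BitStr (96 * b - 96 * b / 2)) =
        2 ^ (96 * b) := by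
      rw [← Fintype.card_prod, ← Fintype.card_congr (halvesEquiv (96 * b))]
      simp
    rw [← Nat.cast_mul, this, Nat.cast_pow, ← Real.rpow_natCast]
    push_cast
    rfl
  have h := (mixes_thirds hb).isIsolator (by norm_num) (c := 1 / 100 * (96 * b : ℕ))
    (k := (1 - 1 / 100) * (96 * b : ℕ)) (a := 2 ^ (8 * b : ℝ)) (by positivity)
    (η := (2 : ℝ) ^ (-(1 / 100 * (96 * b : ℕ) : ℝ))) (rpow_two_mono (by push_cast; linarith)) (by
      rw [hcard, ← Real.rpow_add (by norm_num), ← Real.rpow_add (by norm_num),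
        ← Real.rpow_sub (by norm_num), two_mul_rpow, mul_add,
        ← Real.rpow_add (by norm_num), ← Real.rpow_add (by norm_num)]
      push_cast
      have h1 : (2 : ℝ) ^ (1 / 100 * (96 * b) + (8 * b + (1 - 32 * b) / 2) : ℝ) ≤
        2 ^ (-(1 / 100 * (96 * b)) - 1 : ℝ) := rpow_two_mono (by linarith)
      have h2 : (2 : ℝ) ^ (1 / 100 * (96 * b) + (96 * b + -((1 - 1 / 100) * (96 * b)) - 8 * b + 1)
          : ℝ) ≤ 2 ^ (-(1 / 100 * (96 * b)) - 1 : ℝ) := rpow_two_mono (by linarith)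
      have h3 := two_mul_rpow (-(1 / 100 * (96 * b)) - 1 : ℝ)
      rw [sub_add_cancel] at h3
      linarith)
  have hiso (u : BitStr (96 * b)) : isoThirds b u =
      (fun p : BitStr (96 * b / 2) × BitStr (96 * b - 96 * b / 2) =>
        isoFun (32 * b) 1 (firstThird b p.1, lastThird b p.2)) (halvesEquiv _ u) :=
    isoThirds_eq b u
  refine ⟨h.1.trans (le_of_eq ?_), fun P hP => le_trans (le_of_eq ?_) (h.2 _ hP)⟩
  · rw [prob_eq_sum, prob_eq_sum, ← (halvesEquiv (96 * b)).sum_comp]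
    refine Finset.sum_congr rfl fun u _ => ?_
    simp only [Set.mem_ofPred_eq, hiso, PMF.uniformOfFintype_apply,
      Fintype.card_congr (halvesEquiv (96 * b))]
  · have hmap (u) : (P.map (halves (96 * b))) (halvesEquiv (96 * b) u) = P u := by
      rw [PMF.map_apply, tsum_eq_single u]
      · exact if_pos rfl
      · intro v hv
        exact if_neg fun h => hv ((halvesEquiv (96 * b)).injective h.symm)
    rw [prob_eq_sum, prob_eq_sum, ← (halvesEquiv (96 * b)).sum_comp]
    refine Finset.sum_congr rfl fun u _ => ?_
    simp only [Set.mem_ofPred_eq, hiso, hmap]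

/-! ### Turing machines with a cut tape -/

namespace RandTM

variable {Q : ℕ} (M : RandTM Q) (twoWay : Bool)

/-- The new state if a step leads across the cut between the cells `p - 1` and `p`. -/
def crossing (p : ℤ) (c c' : TMConfig Q) : Option (Fin Q) :=
  if c.head < p ↔ c'.head < p then none else some c'.state

/-- The sequence of crossings of the cut at `p` in a run from the configuration `c`. -/
def crossings (p : ℤ) : TMConfig Q → List Bool → List (Option (Fin Q))
  | _, [] => []
  | c, r :: ω => crossing p c (M.step twoWay c r) :: crossings p (M.step twoWay c r) ω

/-- The random bits consumed by a run for which there is a pair of random bits for every step: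
the first one is used to the left of the cut, the second one to its right. -/
def usedBits (p : ℤ) : TMConfig Q → List (Bool × Bool) → List Bool
  | _, [] => []
  | c, x :: l => (if c.head < p then x.1 else x.2) ::
      usedBits p (M.step twoWay c (if c.head < p then x.1 else x.2)) l

/-- The configuration `c` agrees with `c₁` on the left and with `c₂` on the right of the cut. -/
structure Glued (p : ℤ) (c₁ c₂ c : TMConfig Q) : Prop where
  side_left : c₁.head < p ↔ c.head < p
  side_right : c₂.head < p ↔ c.head < p
  tape_left : ∀ i < p, c.tape i = c₁.tape i
  tape_right : ∀ i, p ≤ i → c.tape i = c₂.tape i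
  left : c.head < p → c.head = c₁.head ∧ c.state = c₁.state
  right : p ≤ c.head → c.head = c₂.head ∧ c.state = c₂.state

theorem moveHead_eq_of_lt {p h : ℤ} (hp : 1 ≤ p) (d : Turing.Dir) (h1 : h < p)
    (h2 : p ≤ moveHead twoWay h d) : moveHead twoWay h d = p := by
  cases d <;> cases twoWay <;> simp [moveHead] at * <;> omega

theorem moveHead_eq_of_ge {p h : ℤ} (hp : 1 ≤ p) (d : Turing.Dir) (h1 : p ≤ h)
    (h2 : moveHead twoWay h d < p) : moveHead twoWay h d = p - 1 := by
  cases d <;> cases twoWay <;> simp [moveHead] at * <;> omega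

theorem step_head (c : TMConfig Q) (r : Bool) :
    ∃ d, (M.step twoWay c r).head = moveHead twoWay c.head d := ⟨_, rfl⟩

theorem step_tape_of_ne (c : TMConfig Q) (r : Bool) {i : ℤ} (h : i ≠ c.head) :
    (M.step twoWay c r).tape i = c.tape i := Function.update_of_ne h _ _

theorem step_congr {c c' : TMConfig Q} (r : Bool) (hs : c.state = c'.state) (hh : c.head = c'.head)
    (ht : c.tape c.head = c'.tape c.head) : (M.step twoWay c r).state = (M.step twoWay c' r).state ∧
      (M.step twoWay c r).head = (M.step twoWay c' r).head ∧
      ∀ i, c.tape i = c'.tape i → (M.step twoWay c r).tape i = (M.step twoWay c' r).tape i := by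
  obtain ⟨s, h, t⟩ := c
  obtain ⟨s', h', t'⟩ := c'
  obtain rfl : s = s' := hs
  obtain rfl : h = h' := hh
  have ht' : t h = t' h := ht
  refine ⟨by simp [step, ht'], by simp [step, ht'], fun i hi => ?_⟩
  have hi' : t i = t' i := hi
  by_cases hih : i = h
  · simp [step, hih, ht']
  · simp [step, Function.update_of_ne hih, hi']

/-- Gluing is preserved by a step if the two runs cross the cut in the same way. -/
theorem Glued.step {p : ℤ} (hp : 1 ≤ p) {c₁ c₂ c : TMConfig Q} (hg : Glued p c₁ c₂ c)
    (x₁ x₂ : Bool × Bool)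
    (hx : crossing p c₁ (M.step twoWay c₁ (if c₁.head < p then x₁.1 else x₁.2)) =
      crossing p c₂ (M.step twoWay c₂ (if c₂.head < p then x₂.1 else x₂.2))) :
    Glued p (M.step twoWay c₁ (if c₁.head < p then x₁.1 else x₁.2))
      (M.step twoWay c₂ (if c₂.head < p then x₂.1 else x₂.2))
      (M.step twoWay c (if c.head < p then x₁.1 else x₂.2)) ∧
    crossing p c (M.step twoWay c (if c.head < p then x₁.1 else x₂.2)) =
      crossing p c₁ (M.step twoWay c₁ (if c₁.head < p then x₁.1 else x₁.2)) := by
  by_cases h : c.head < p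
  · have h1 := hg.side_left.mpr h
    have h2 := hg.side_right.mpr h
    simp only [h, h1, h2, if_true] at hx ⊢
    obtain ⟨e1, e2⟩ := hg.left h
    obtain ⟨f1, f2, f3⟩ := M.step_congr twoWay x₁.1 e2 e1 (hg.tape_left _ h)
    obtain ⟨d, hd⟩ := M.step_head twoWay c x₁.1
    obtain ⟨d2, hd2⟩ := M.step_head twoWay c₂ x₂.1
    simp only [crossing, h, h1, h2, true_iff] at hx ⊢
    have g3 : ∀ i, p ≤ i → (M.step twoWay c x₁.1).tape i = (M.step twoWay c₂ x₂.1).tape i :=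
      fun i hi => by
        rw [step_tape_of_ne _ _ _ _ (by omega), step_tape_of_ne _ _ _ _ (by omega),
          hg.tape_right i hi]
    rw [f2, f1]
    refine ⟨⟨by rw [f2], ?_, fun i hi => f3 i (hg.tape_left i hi), g3, fun _ => ⟨f2, f1⟩, ?_⟩, rfl⟩
    · rw [f2]
      by_cases k1 : (M.step twoWay c₁ x₁.1).head < p <;>
        by_cases k2 : (M.step twoWay c₂ x₂.1).head < p <;> simp [k1, k2] at hx ⊢
    · intro hge
      have k1 : ¬ (M.step twoWay c₁ x₁.1).head < p := by rw [← f2]; omega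
      have k2 : ¬ (M.step twoWay c₂ x₂.1).head < p := by
        intro k2
        simp [k1, k2] at hx
      rw [if_neg k1, if_neg k2, Option.some.injEq] at hx
      refine ⟨?_, f1.trans hx⟩
      rw [hd, hd2, moveHead_eq_of_lt twoWay hp d h (hd ▸ hge),
        moveHead_eq_of_lt twoWay hp d2 h2 (hd2 ▸ not_lt.mp k2)]
  · have h1 := mt hg.side_left.mp h
    have h2 := mt hg.side_right.mp h
    simp only [h, h1, h2, if_false] at hx ⊢
    have hge := not_lt.mp h
    obtain ⟨e1, e2⟩ := hg.right hge
    obtain ⟨f1, f2, f3⟩ := M.step_congr twoWay x₂.2 e2 e1 (hg.tape_right _ hge)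
    obtain ⟨d, hd⟩ := M.step_head twoWay c x₂.2
    obtain ⟨d1, hd1⟩ := M.step_head twoWay c₁ x₁.2
    simp only [crossing, h, h1, h2, false_iff] at hx ⊢
    have g3 : ∀ i, i < p → (M.step twoWay c x₂.2).tape i = (M.step twoWay c₁ x₁.2).tape i :=
      fun i hi => by
        rw [step_tape_of_ne _ _ _ _ (by omega), step_tape_of_ne _ _ _ _ (by omega),
          hg.tape_left i hi]
    rw [f2, f1]
    refine ⟨⟨?_, by rw [f2], g3, fun i hi => f3 i (hg.tape_right i hi), ?_, fun _ => ⟨f2, f1⟩⟩,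
      hx.symm⟩
    · rw [f2]
      by_cases k1 : (M.step twoWay c₁ x₁.2).head < p <;>
        by_cases k2 : (M.step twoWay c₂ x₂.2).head < p <;> simp [k1, k2] at hx ⊢
    · intro hlt
      have k2 : (M.step twoWay c₂ x₂.2).head < p := by rw [← f2]; exact hlt
      have k1 : (M.step twoWay c₁ x₁.2).head < p := by
        by_contra k1
        simp [k1, k2] at hx
      simp only [k1, k2, not_true, if_false, Option.some.injEq] at hx
      refine ⟨?_, f1.trans hx.symm⟩
      rw [hd, hd1, moveHead_eq_of_ge twoWay hp d hge (hd ▸ hlt),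
        moveHead_eq_of_ge twoWay hp d1 (not_lt.mp h1) (hd1 ▸ k1)]

/-- Two runs with the same crossings can be cut and pasted. -/
theorem Glued.run {p : ℤ} (hp : 1 ≤ p) (l : List ((Bool × Bool) × (Bool × Bool))) :
    ∀ {c₁ c₂ c : TMConfig Q}, Glued p c₁ c₂ c →
    M.crossings twoWay p c₁ (M.usedBits twoWay p c₁ (l.map Prod.fst)) =
      M.crossings twoWay p c₂ (M.usedBits twoWay p c₂ (l.map Prod.snd)) →
    Glued p ((M.usedBits twoWay p c₁ (l.map Prod.fst)).foldl (M.step twoWay) c₁)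
      ((M.usedBits twoWay p c₂ (l.map Prod.snd)).foldl (M.step twoWay) c₂)
      ((M.usedBits twoWay p c (l.map fun x => (x.1.1, x.2.2))).foldl (M.step twoWay) c) ∧
    M.crossings twoWay p c (M.usedBits twoWay p c (l.map fun x => (x.1.1, x.2.2))) =
      M.crossings twoWay p c₁ (M.usedBits twoWay p c₁ (l.map Prod.fst)) := by
  induction l with
  | nil => exact fun hg _ => ⟨hg, rfl⟩
  | cons x l ih =>
    intro c₁ c₂ c hg hx
    simp only [List.map_cons, usedBits, crossings, List.cons.injEq, List.foldl_cons] at hx ⊢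
    obtain ⟨h1, h2⟩ := Glued.step M twoWay hp hg x.1 x.2 hx.1
    obtain ⟨h3, h4⟩ := ih h1 hx.2
    exact ⟨h3, h2, h4⟩

theorem sum_bitStr_succ {β : Type} [Fintype β] {R : Type} [AddCommMonoid R] (T : ℕ)
    (g : (Fin (T + 1) → β) → R) : ∑ z, g z = ∑ b, ∑ z, g (Fin.cons b z) := by
  rw [← (Fin.consEquiv fun _ : Fin (T + 1) => β).sum_comp, Fintype.sum_prod_type]
  rfl

/-- The bits consumed by a run with two random bits for every step are uniform. -/
theorem sum_usedBits (p : ℤ) (T : ℕ) (G : List Bool → ℝ) (c : TMConfig Q) :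
    ∑ z : Fin T → Bool × Bool, G (M.usedBits twoWay p c (List.ofFn z)) =
      2 ^ T * ∑ ω : BitStr T, G (List.ofFn ω) := by
  induction T generalizing G c with
  | zero => simp [usedBits]
  | succ T ih =>
    rw [sum_bitStr_succ, sum_bitStr_succ]
    simp only [List.ofFn_cons, usedBits]
    have h (x : Bool × Bool) : ∑ z : Fin T → Bool × Bool,
        G ((if c.head < p then x.1 else x.2) :: M.usedBits twoWay p
          (M.step twoWay c (if c.head < p then x.1 else x.2)) (List.ofFn z)) =
        2 ^ T * ∑ ω : BitStr T, G ((if c.head < p then x.1 else x.2) :: List.ofFn ω) :=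
      ih (fun l => G ((if c.head < p then x.1 else x.2) :: l)) _
    simp only [h]
    rw [Fintype.sum_prod_type]
    by_cases hc : c.head < p
    · simp only [hc, if_true, Fintype.sum_bool]
      ring
    · simp only [hc, if_false, Fintype.sum_bool]
      ring

/-- The number of crossings. -/
def numCrossings (l : List (Option (Fin Q))) : ℕ :=
  (l.map fun e => if e.isSome then 1 else 0).sum

/-- A step crosses at most one cut. -/
theorem sum_crossing_le (W : Finset ℕ) (hW : ∀ p ∈ W, 1 ≤ p) (c : TMConfig Q) (r : Bool) :
    ∑ p ∈ W, (if (crossing (p : ℤ) c (M.step twoWay c r)).isSome then 1 else 0) ≤ 1 := by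
  rw [Finset.sum_boole, Nat.cast_id, Finset.card_le_one]
  obtain ⟨d, hd⟩ := M.step_head twoWay c r
  have key : ∀ p : ℕ, p ∈ W.filter (fun p : ℕ => (crossing (p : ℤ) c (M.step twoWay c r)).isSome) →
      (p : ℤ) = max c.head (M.step twoWay c r).head := by
    intro p hp
    have hp2 := (Finset.mem_filter.mp hp).2
    by_cases h : c.head < p ↔ (M.step twoWay c r).head < p
    · simp [crossing, h] at hp2
    · have hp1 : (1 : ℤ) ≤ p := by exact_mod_cast hW p (Finset.mem_filter.mp hp).1
      rw [hd] at h ⊢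
      cases d <;> cases twoWay <;> simp [moveHead] at h ⊢ <;> omega
  intro p hp p' hp'
  have := (key p hp).trans (key p' hp').symm
  exact_mod_cast this

theorem sum_numCrossings_le (W : Finset ℕ) (hW : ∀ p ∈ W, 1 ≤ p) (c : TMConfig Q) (ω : List Bool) :
    ∑ p ∈ W, numCrossings (M.crossings twoWay p c ω) ≤ ω.length := by
  induction ω generalizing c with
  | nil => simp [crossings, numCrossings]
  | cons r ω ih =>
    have h1 := ih (M.step twoWay c r)
    have h2 := M.sum_crossing_le twoWay W hW c r
    simp only [numCrossings, crossings, List.map_cons, List.sum_cons, Finset.sum_add_distrib,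
      List.length_cons] at h1 h2 ⊢
    omega

theorem length_crossings (p : ℤ) (c : TMConfig Q) (ω : List Bool) :
    (M.crossings twoWay p c ω).length = ω.length := by
  induction ω generalizing c with
  | nil => rfl
  | cons r ω ih => simp [crossings, ih]

/-- There are few sequences with few crossings. -/
theorem card_le_of_numCrossings_le {T q : ℕ} (s : Finset (List (Option (Fin Q))))
    (hs : ∀ l ∈ s, l.length = T ∧ numCrossings l ≤ q) : s.card ≤ (T * Q + 1) ^ q := by
  classical
  let S : List (Option (Fin Q)) → Finset (Fin T × Fin Q) := fun l =>
    Finset.univ.filter fun x => l[(x.1 : ℕ)]? = some (some x.2)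
  have hS (l) (hl : l ∈ s) : (S l).card ≤ q := by
    refine le_trans (le_of_eq ?_) (hs l hl).2
    obtain ⟨hT, -⟩ := hs l hl
    subst hT
    rw [Finset.card_filter, Fintype.sum_prod_type, numCrossings,
      ← Fin.sum_univ_fun_getElem l fun e => if e.isSome then 1 else 0]
    refine Finset.sum_congr rfl fun i _ => ?_
    simp only [List.getElem?_eq_getElem i.isLt, Option.some.injEq]
    cases h : l[(i : ℕ)] <;> simp
  have hcard : Fintype.card (Fin q → Option (Fin T × Fin Q)) = (T * Q + 1) ^ q := by simp
  rw [← hcard, ← Finset.card_univ]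
  refine Finset.card_le_card_of_injOn (fun l k => (S l).toList[(k : ℕ)]?) (fun _ _ =>
    Finset.mem_coe.mpr (Finset.mem_univ _)) fun l hl l' hl' h => ?_
  have hlist : (S l).toList = (S l').toList := by
    refine List.ext_getElem? fun k => ?_
    rcases lt_or_ge k q with hk | hk
    · exact congrFun h ⟨k, hk⟩
    · rw [List.getElem?_eq_none (by rw [Finset.length_toList]; exact (hS l hl).trans hk),
        List.getElem?_eq_none (by rw [Finset.length_toList]; exact (hS l' hl').trans hk)]
  have hSS : S l = S l' := by
    ext x
    rw [← Finset.mem_toList, hlist, Finset.mem_toList]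
  refine List.ext_getElem ((hs l hl).1.trans (hs l' hl').1.symm) fun i h1 h2 => ?_
  have hiT : i < T := (hs l hl).1 ▸ h1
  ext x
  have := Finset.ext_iff.mp hSS (⟨i, hiT⟩, x)
  simpa [S, h1, h2] using this

end RandTM

/-! ### Turing-machine sources are almost sums of few products -/

/-- The image of a weight function under a map. -/
noncomputable def pushWeight {X U : Type} [Fintype X] (g : X → U) (P : X → ℝ) (u : U) : ℝ :=
  open Classical in ∑ x with g x = u, P x

theorem sum_pushWeight_mul {X U : Type} [Fintype X] [Fintype U] (g : X → U) (P : X → ℝ)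
    (F : U → ℝ) : ∑ u, pushWeight g P u * F u = ∑ x, P x * F (g x) := by
  classical
  rw [← Finset.sum_fiberwise Finset.univ g]
  refine Finset.sum_congr rfl fun u _ => ?_
  rw [pushWeight, Finset.sum_mul]
  refine Finset.sum_congr (by congr) fun x hx => ?_
  rw [(Finset.mem_filter.mp hx).2]

theorem sum_pushWeight {X U : Type} [Fintype X] [Fintype U] (g : X → U) (P : X → ℝ) :
    ∑ u, pushWeight g P u = ∑ x, P x := by
  simpa using sum_pushWeight_mul g P fun _ => 1

theorem pushWeight_nonneg {X U : Type} [Fintype X] (g : X → U) (P : X → ℝ) (hP : ∀ x, 0 ≤ P x)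
    (u : U) : 0 ≤ pushWeight g P u := Finset.sum_nonneg fun x _ => hP x

theorem sum_sum_pushWeight_mul {X Y U V : Type} [Fintype X] [Fintype Y] [Fintype U] [Fintype V]
    (g : X → U) (h : Y → V) (P : X → ℝ) (R : Y → ℝ) (F : U → V → ℝ) :
    ∑ u, ∑ v, pushWeight g P u * pushWeight h R v * F u v =
      ∑ x, ∑ y, P x * R y * F (g x) (h y) := by
  have h1 (u : U) : ∑ v, pushWeight g P u * pushWeight h R v * F u v =
      pushWeight g P u * ∑ y, R y * F u (h y) := by
    rw [← sum_pushWeight_mul h R, Finset.mul_sum]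
    exact Finset.sum_congr rfl fun v _ => by ring
  simp only [h1]
  rw [sum_pushWeight_mul g P fun u => ∑ y, R y * F u (h y)]
  refine Finset.sum_congr rfl fun x _ => ?_
  rw [Finset.mul_sum]
  exact Finset.sum_congr rfl fun y _ => by ring

theorem sum_map_uniform {Ω O : Type} [Fintype Ω] [Nonempty Ω] [Fintype O] (f : Ω → O)
    (F : O → ℝ) : ∑ x, (((PMF.uniformOfFintype Ω).map f) x).toReal * F x =
      (∑ ω, F (f ω)) / Fintype.card Ω := by
  classical
  have h (x : O) : (((PMF.uniformOfFintype Ω).map f) x).toReal =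
      pushWeight f (fun _ => 1 / (Fintype.card Ω : ℝ)) x := by
    rw [PMF.map_apply, tsum_fintype, pushWeight, Finset.sum_filter, ENNReal.toReal_sum]
    · refine Finset.sum_congr rfl fun ω _ => ?_
      by_cases hω : f ω = x
      · simp [hω]
      · simp [hω, Ne.symm (a := f ω) hω]
    · intro ω _
      by_cases hω : x = f ω <;> simp [hω]
  simp only [h, sum_pushWeight_mul]
  rw [Finset.sum_div]
  exact Finset.sum_congr rfl fun ω _ => by ring

/-- If a function of two arguments has the cut-and-paste property on the rectangles on which `tr`
is constant, its distribution on uniform arguments is a sum of product functions. -/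
theorem exists_products_of_cut_paste {Α Β 𝒯 O : Type} [Fintype Α] [Fintype Β] [Nonempty Α]
    [Nonempty Β] [Fintype O] [DecidableEq 𝒯] (tr : Α → Β → 𝒯) (out : Α → Β → O)
    (merge : O → O → O)
    (h : ∀ α α' β β', tr α β' = tr α' β → tr α β = tr α β' ∧ out α β = merge (out α β') (out α' β))
    (I : Finset 𝒯) : ∃ A B : I → O → ℝ, (∀ i u, 0 ≤ A i u) ∧ (∀ i v, 0 ≤ B i v) ∧
      (∀ i, ∑ u, A i u ≤ 1) ∧ (∀ i, ∑ v, B i v ≤ 1) ∧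
      ∀ F : O → ℝ, (∑ α, ∑ β, if tr α β ∈ I then F (out α β) else 0) /
        (Fintype.card Α * Fintype.card Β) = ∑ i, ∑ u, ∑ v, A i u * B i v * F (merge u v) := by
  classical
  let oA : 𝒯 → Α → O := fun τ α => if h : ∃ β, tr α β = τ then out α h.choose else
    out α (Classical.arbitrary Β)
  let oB : 𝒯 → Β → O := fun τ β => if h : ∃ α, tr α β = τ then out h.choose β else
    out (Classical.arbitrary Α) β
  let P : 𝒯 → Α → ℝ := fun τ α => if ∃ β, tr α β = τ then 1 / Fintype.card Α else 0
  let R : 𝒯 → Β → ℝ := fun τ β => if ∃ α, tr α β = τ then 1 / Fintype.card Β else 0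
  have hP0 (τ α) : 0 ≤ P τ α := by simp only [P]; split_ifs <;> positivity
  have hR0 (τ β) : 0 ≤ R τ β := by simp only [R]; split_ifs <;> positivity
  have hα : (Fintype.card Α : ℝ) ≠ 0 := by exact_mod_cast Fintype.card_ne_zero
  have hβ : (Fintype.card Β : ℝ) ≠ 0 := by exact_mod_cast Fintype.card_ne_zero
  refine ⟨fun i => pushWeight (oA i) (P i), fun i => pushWeight (oB i) (R i),
    fun i => pushWeight_nonneg _ _ (hP0 i), fun i => pushWeight_nonneg _ _ (hR0 i), fun i => ?_,
    fun i => ?_, fun F => ?_⟩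
  · rw [sum_pushWeight]
    calc ∑ α, P i α ≤ ∑ α : Α, 1 / (Fintype.card Α : ℝ) := Finset.sum_le_sum fun α _ => by
          simp only [P]; split_ifs; exacts [le_rfl, by positivity]
      _ = 1 := by simp [hα]
  · rw [sum_pushWeight]
    calc ∑ β, R i β ≤ ∑ β : Β, 1 / (Fintype.card Β : ℝ) := Finset.sum_le_sum fun β _ => by
          simp only [R]; split_ifs; exacts [le_rfl, by positivity]
      _ = 1 := by simp [hβ]
  · have key (τ : 𝒯) (α : Α) (β : Β) : P τ α * R τ β * F (merge (oA τ α) (oB τ β)) =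
        (if tr α β = τ then F (out α β) else 0) / (Fintype.card Α * Fintype.card Β) := by
      by_cases h1 : ∃ β', tr α β' = τ
      · by_cases h2 : ∃ α', tr α' β = τ
        · obtain ⟨e1, e2⟩ := h α h2.choose β h1.choose
            (h1.choose_spec.trans h2.choose_spec.symm)
          rw [if_pos (e1.trans h1.choose_spec), e2]
          simp only [P, R, oA, oB, dif_pos h1, dif_pos h2, if_pos h1, if_pos h2]
          field_simp
        · rw [if_neg fun e => h2 ⟨α, e⟩]
          simp [R, h2]
      · rw [if_neg fun e => h1 ⟨β, e⟩]
        simp [P, h1]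
    simp only [sum_sum_pushWeight_mul, key]
    symm
    rw [Finset.sum_coe_sort I fun τ => ∑ α, ∑ β, (if tr α β = τ then F (out α β) else 0) /
      (Fintype.card Α * Fintype.card Β : ℝ), Finset.sum_comm, Finset.sum_div]
    refine Finset.sum_congr rfl fun α _ => ?_
    rw [Finset.sum_comm, Finset.sum_div]
    refine Finset.sum_congr rfl fun β _ => ?_
    rw [← Finset.sum_div, Finset.sum_ite_eq]

/-- The string that agrees with `u` before position `p` and with `v` from there on. -/
def mergeAt {ℓ : ℕ} (p : ℕ) (u v : BitStr ℓ) : BitStr ℓ := fun i => if (i : ℕ) < p then u i else v i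

theorem glued_refl {Q : ℕ} (p : ℤ) (c : TMConfig Q) : RandTM.Glued p c c c :=
  ⟨Iff.rfl, Iff.rfl, fun _ _ => rfl, fun _ _ => rfl, fun _ => ⟨rfl, rfl⟩, fun _ => ⟨rfl, rfl⟩⟩

/-- For some cut in `W`, a Turing-machine source is a sum of few products of functions of the parts
on the two sides of the cut, up to the event that the head crosses the cut more than `q` times. -/
theorem RandTM.exists_products {Q : ℕ} (M : RandTM Q) (twoWay : Bool) (T ℓ q : ℕ) (W : Finset ℕ)
    (hW : ∀ p ∈ W, 1 ≤ p) (hne : W.Nonempty) :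
    ∃ p ∈ W, ∃ (I : Type) (_ : Fintype I) (A B : I → BitStr ℓ → ℝ),
      Fintype.card I ≤ (T * Q + 1) ^ q ∧ (∀ i u, 0 ≤ A i u) ∧ (∀ i v, 0 ≤ B i v) ∧
      (∀ i, ∑ u, A i u ≤ 1) ∧ (∀ i, ∑ v, B i v ≤ 1) ∧ ∑ i, ∑ u, ∑ v, A i u * B i v ≤ 1 ∧
      ∀ F : BitStr ℓ → ℝ, (∀ x, 0 ≤ F x) → (∀ x, F x ≤ 1) →
        ∑ x, (M.source twoWay T ℓ x).toReal * F x ≤ T / (W.card * (q + 1)) +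
          ∑ i, ∑ u, ∑ v, A i u * B i v * F (mergeAt p u v) := by
  classical
  set c₀ : TMConfig Q := { state := M.start, head := 0, tape := fun _ => false } with hc₀
  have hWc : (0 : ℝ) < W.card := by exact_mod_cast hne.card_pos
  -- a cut that is crossed at most as often as the average one
  obtain ⟨p, hpW, hp⟩ : ∃ p ∈ W, (∑ ω : BitStr T,
      (numCrossings (M.crossings twoWay p c₀ (List.ofFn ω)) : ℝ)) ≤ 2 ^ T * T / W.card := by
    by_contra! hcon
    have h1 := Finset.sum_lt_sum_of_nonempty hne hcon
    rw [Finset.sum_const, nsmul_eq_mul, mul_div_cancel₀ _ hWc.ne', Finset.sum_comm] at h1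
    have h2 : ∑ ω : BitStr T, ∑ p ∈ W,
        (numCrossings (M.crossings twoWay p c₀ (List.ofFn ω)) : ℝ) ≤ ∑ ω : BitStr T, (T : ℝ) :=
      Finset.sum_le_sum fun ω _ => by
        have := M.sum_numCrossings_le twoWay W hW c₀ (List.ofFn ω)
        rw [List.length_ofFn] at this
        exact_mod_cast this
    simp only [Finset.sum_const, Finset.card_univ, nsmul_eq_mul, Fintype.card_pi, Fintype.card_bool,
      Finset.prod_const, Fintype.card_fin, Nat.cast_pow, Nat.cast_ofNat] at h2
    linarith
  have hp1 : (1 : ℤ) ≤ p := by exact_mod_cast hW p hpW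
  let final : List Bool → BitStr ℓ := fun ω i => (ω.foldl (M.step twoWay) c₀).tape (i.val : ℤ)
  let used : BitStr T → BitStr T → List Bool := fun α β =>
    M.usedBits twoWay p c₀ (List.ofFn fun i => (α i, β i))
  let tr : BitStr T → BitStr T → List (Option (Fin Q)) := fun α β =>
    M.crossings twoWay p c₀ (used α β)
  have hlen (l : List (Bool × Bool)) : ∀ c, (M.usedBits twoWay p c l).length = l.length := by
    induction l with
    | nil => exact fun _ => rfl
    | cons x l ih => exact fun c => by simp [usedBits, ih]
  have hcp (α α' β β' : BitStr T) (h : tr α β' = tr α' β) : tr α β = tr α β' ∧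
      final (used α β) = mergeAt p (final (used α β')) (final (used α' β)) := by
    have hrun := Glued.run M twoWay hp1 (List.ofFn fun i => ((α i, β' i), (α' i, β i)))
      (glued_refl (p : ℤ) c₀)
    simp only [List.map_ofFn] at hrun
    obtain ⟨h1, h2⟩ := hrun h
    refine ⟨h2, ?_⟩
    funext i
    by_cases hi : (i : ℕ) < p
    · simp only [mergeAt, if_pos hi]
      exact h1.tape_left i (by exact_mod_cast hi)
    · simp only [mergeAt, if_neg hi]
      exact h1.tape_right i (by exact_mod_cast not_lt.mp hi)
  let I : Finset (List (Option (Fin Q))) :=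
    (Finset.univ.image fun x : BitStr T × BitStr T => tr x.1 x.2).filter fun l =>
      numCrossings l ≤ q
  have hI (α β) : tr α β ∈ I ↔ numCrossings (tr α β) ≤ q := by
    simp only [I, Finset.mem_filter, Finset.mem_image, Finset.mem_univ, true_and,
      and_iff_right_iff_imp]
    exact fun _ => ⟨(α, β), rfl⟩
  obtain ⟨A, B, hA, hB, hA1, hB1, hF⟩ := exists_products_of_cut_paste tr
    (fun α β => final (used α β)) (mergeAt p) hcp I
  have hcardT : (Fintype.card (BitStr T) : ℝ) = 2 ^ T := by simp
  refine ⟨p, hpW, I, inferInstance, A, B, ?_, hA, hB, hA1, hB1, ?_, fun F hF0 hF1 => ?_⟩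
  · rw [Fintype.card_coe]
    refine card_le_of_numCrossings_le I fun l hl => ?_
    obtain ⟨hl1, hl2⟩ := Finset.mem_filter.mp hl
    obtain ⟨x, -, rfl⟩ := Finset.mem_image.mp hl1
    exact ⟨by simp [tr, used, length_crossings, hlen], hl2⟩
  · have := hF fun _ => 1
    simp only [mul_one] at this
    rw [← this, div_le_one (by rw [hcardT]; positivity)]
    calc _ ≤ ∑ α : BitStr T, ∑ β : BitStr T, (1 : ℝ) := Finset.sum_le_sum fun α _ =>
          Finset.sum_le_sum fun β _ => by split_ifs <;> norm_num
      _ = _ := by simp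
  · have hsrc : ∑ x, (M.source twoWay T ℓ x).toReal * F x =
        (∑ ω : BitStr T, F (final (List.ofFn ω))) / 2 ^ T := by
      rw [source, sum_map_uniform, hcardT]
      rfl
    have hsplit (ω : BitStr T) : F (final (List.ofFn ω)) ≤
        numCrossings (M.crossings twoWay p c₀ (List.ofFn ω)) / ((q : ℝ) + 1) +
        (if numCrossings (M.crossings twoWay p c₀ (List.ofFn ω)) ≤ q then F (final (List.ofFn ω))
          else 0) := by
      split_ifs with h
      · have : (0 : ℝ) ≤ numCrossings (M.crossings twoWay p c₀ (List.ofFn ω)) / ((q : ℝ) + 1) := by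
          positivity
        linarith
      · rw [add_zero]
        refine (hF1 _).trans ((one_le_div (by positivity)).mpr ?_)
        exact_mod_cast not_le.mp h
    have hpair : 2 ^ T * ∑ ω : BitStr T, (if numCrossings (M.crossings twoWay p c₀ (List.ofFn ω)) ≤ q
        then F (final (List.ofFn ω)) else 0) =
        ∑ α, ∑ β, if tr α β ∈ I then F (final (used α β)) else 0 := by
      rw [← M.sum_usedBits twoWay p T (fun l => if numCrossings (M.crossings twoWay p c₀ l) ≤ q
        then F (final l) else 0) c₀, ← (Equiv.arrowProdEquivProdArrow (Fin T) (fun _ => Bool)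
        fun _ => Bool).symm.sum_comp, Fintype.sum_prod_type]
      refine Finset.sum_congr rfl fun α _ => Finset.sum_congr rfl fun β _ => ?_
      simp only [hI]
      rfl
    rw [← hF F, ← hpair, hcardT, hsrc]
    have h1 := Finset.sum_le_sum fun (ω : BitStr T) (_ : ω ∈ Finset.univ) => hsplit ω
    rw [Finset.sum_add_distrib, ← Finset.sum_div] at h1
    rw [mul_div_mul_left _ _ (by positivity)]
    refine (div_le_div_of_nonneg_right h1 (by positivity)).trans ?_
    rw [add_div]
    refine add_le_add_left ?_ _
    rw [div_div, div_le_div_iff₀ (by positivity) (by positivity)]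
    rw [le_div_iff₀ hWc] at hp
    nlinarith [hp]

/-! ### Tests that distinguish the hard distributions from Turing-machine sources -/

theorem sub_le_tvDist {Ω : Type} [Fintype Ω] (P R : PMF Ω) (F : Ω → ℝ) (h0 : ∀ x, 0 ≤ F x)
    (h1 : ∀ x, F x ≤ 1) :
    ∑ x, (P x).toReal * F x - ∑ x, (R x).toReal * F x ≤ tvDist P R := by
  have hsum : ∑ x, ((P x).toReal - (R x).toReal) = 0 := by
    rw [Finset.sum_sub_distrib, sum_toReal_pmf, sum_toReal_pmf, sub_self]
  calc ∑ x, (P x).toReal * F x - ∑ x, (R x).toReal * F x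
      = ∑ x, ((P x).toReal - (R x).toReal) * F x := by
        rw [← Finset.sum_sub_distrib]
        exact Finset.sum_congr rfl fun x _ => by ring
    _ ≤ ∑ x, (1 / 2 * |(P x).toReal - (R x).toReal| + 1 / 2 * ((P x).toReal - (R x).toReal)) := by
        refine Finset.sum_le_sum fun x _ => ?_
        rcases abs_cases ((P x).toReal - (R x).toReal) with ⟨h, h'⟩ | ⟨h, h'⟩
        · rw [h]
          nlinarith [h1 x]
        · rw [h]
          nlinarith [h0 x]
    _ = tvDist P R := by
        rw [Finset.sum_add_distrib, ← Finset.mul_sum, ← Finset.mul_sum, hsum, mul_zero, add_zero,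
          tvDist]

theorem Mixes.beq {X Y : Type} [Fintype X] [Fintype Y] {f : X → Y → Bool} {ε : ℝ}
    (h : Mixes f (1 / 2) ε) (z : Bool) : Mixes (fun x y => f x y == z) (1 / 2) ε := by
  cases z
  · intro a P R ha hP hR hP1 hR1 hPa hRa
    have := h a P R ha hP hR hP1 hR1 hPa hRa
    rw [← abs_neg] at this
    convert this using 2
    simp only [← Finset.sum_neg_distrib]
    refine Finset.sum_congr rfl fun x _ => Finset.sum_congr rfl fun y _ => ?_
    have e : (if (f x y == false) = true then (1 : ℝ) else 0) - 1 / 2 =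
        -((if f x y = true then 1 else 0) - 1 / 2) := by
      by_cases hf : f x y <;> simp [hf] <;> norm_num
    rw [e, mul_neg]
  · simpa using h

/-- A sum of products of functions of `u` and `v` rarely passes a test that evaluates a mixing
function at an index determined by `v` and rejects points that are heavy for one of the factors. -/
theorem sum_products_mul_test_le {O X Y J I : Type} [Fintype O] [Fintype X] [Fintype Y] [Fintype J]
    [DecidableEq J] [Fintype I] {f : J → X → Y → Bool} {μ ε a : ℝ} (hf : ∀ j, Mixes (f j) μ ε)
    (hμ : 0 ≤ μ) (ha : 0 ≤ a) (A B : I → O → ℝ) (hA : ∀ i u, 0 ≤ A i u) (hB : ∀ i v, 0 ≤ B i v)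
    (hA1 : ∀ i, ∑ u, A i u ≤ 1) (hB1 : ∀ i, ∑ v, B i v ≤ 1)
    (hAB : ∑ i, ∑ u, ∑ v, A i u * B i v ≤ 1) (σ : O → Option J) (xd : J → O → X) (yd : J → O → Y)
    (F : O → O → ℝ) (hF1 : ∀ u v, F u v ≤ 1) (hF : ∀ u v, 0 < F u v → ∃ j, σ v = some j ∧
      f j (xd j u) (yd j v) ∧
      ∀ i, pushWeight (xd j) (A i) (xd j u) ≤ a / Fintype.card X ∧
        pushWeight (yd j) (fun v => if σ v = some j then B i v else 0) (yd j v) ≤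
          a / Fintype.card Y) :
    ∑ i, ∑ u, ∑ v, A i u * B i v * F u v ≤ μ + Fintype.card I * (Fintype.card J * (a * ε)) := by
  classical
  let B' : I → J → O → ℝ := fun i j v => if σ v = some j then B i v else 0
  have hB'0 (i j v) : 0 ≤ B' i j v := by
    simp only [B']
    split_ifs
    exacts [hB i v, le_rfl]
  have hB'B (i v) : ∑ j, B' i j v ≤ B i v := by
    simp only [B']
    cases h : σ v with
    | none => simpa using hB i v
    | some j => simp
  let G : I → J → X → Y → ℝ := fun i j x y =>
    if pushWeight (xd j) (A i) x ≤ a / Fintype.card X ∧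
      pushWeight (yd j) (B' i j) y ≤ a / Fintype.card Y ∧ f j x y then 1 else 0
  have hG0 (i j x y) : 0 ≤ G i j x y := by simp only [G]; split_ifs <;> norm_num
  have hpt (i u v) : A i u * B i v * F u v ≤ ∑ j, A i u * B' i j v * G i j (xd j u) (yd j v) := by
    have hnn : ∀ j ∈ Finset.univ, 0 ≤ A i u * B' i j v * G i j (xd j u) (yd j v) := fun j _ =>
      mul_nonneg (mul_nonneg (hA i u) (hB'0 i j v)) (hG0 i j _ _)
    rcases le_or_gt (F u v) 0 with h | h
    · exact (mul_nonpos_of_nonneg_of_nonpos (mul_nonneg (hA i u) (hB i v)) h).trans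
        (Finset.sum_nonneg hnn)
    · obtain ⟨j, hj, hfj, hl⟩ := hF u v h
      refine le_trans ?_ (Finset.single_le_sum hnn (Finset.mem_univ j))
      have e1 : B' i j v = B i v := if_pos hj
      have e2 : G i j (xd j u) (yd j v) = 1 := if_pos ⟨(hl i).1, (hl i).2, hfj⟩
      rw [e1, e2]
      exact mul_le_mul_of_nonneg_left (hF1 u v) (mul_nonneg (hA i u) (hB i v))
  have hij (i : I) (j : J) : ∑ u, ∑ v, A i u * B' i j v * G i j (xd j u) (yd j v) ≤
      μ * ∑ u, ∑ v, A i u * B' i j v + a * ε := by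
    have hB'1 : ∑ v, B' i j v ≤ 1 := (Finset.sum_le_sum fun v _ =>
      (Finset.single_le_sum (fun j _ => hB'0 i j v) (Finset.mem_univ j)).trans (hB'B i v)).trans
      (hB1 i)
    have := (hf j).truncated_le hμ ha (pushWeight (xd j) (A i)) (pushWeight (yd j) (B' i j))
      (pushWeight_nonneg _ _ (hA i)) (pushWeight_nonneg _ _ (hB'0 i j))
      (by rw [sum_pushWeight]; exact hA1 i) (by rw [sum_pushWeight]; exact hB'1)
    rw [← sum_sum_pushWeight_mul (xd j) (yd j) (A i) (B' i j) (G i j)]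
    rw [← Finset.sum_mul_sum, sum_pushWeight, sum_pushWeight, Finset.sum_mul_sum] at this
    refine le_trans (le_of_eq ?_) this
    exact Finset.sum_congr rfl fun x _ => Finset.sum_congr rfl fun y _ => by simp [G]
  calc ∑ i, ∑ u, ∑ v, A i u * B i v * F u v
      ≤ ∑ i, ∑ u, ∑ v, ∑ j, A i u * B' i j v * G i j (xd j u) (yd j v) :=
        Finset.sum_le_sum fun i _ => Finset.sum_le_sum fun u _ => Finset.sum_le_sum fun v _ =>
          hpt i u v
    _ = ∑ i, ∑ j, ∑ u, ∑ v, A i u * B' i j v * G i j (xd j u) (yd j v) := by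
        refine Finset.sum_congr rfl fun i _ => ?_
        symm
        rw [Finset.sum_comm]
        refine Finset.sum_congr rfl fun u _ => ?_
        rw [Finset.sum_comm]
    _ ≤ ∑ i, ∑ j, (μ * ∑ u, ∑ v, A i u * B' i j v + a * ε) :=
        Finset.sum_le_sum fun i _ => Finset.sum_le_sum fun j _ => hij i j
    _ = μ * (∑ i, ∑ j, ∑ u, ∑ v, A i u * B' i j v) +
          Fintype.card I * (Fintype.card J * (a * ε)) := by
        simp only [Finset.sum_add_distrib, Finset.mul_sum, Finset.sum_const, Finset.card_univ,
          nsmul_eq_mul]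
    _ ≤ μ * 1 + Fintype.card I * (Fintype.card J * (a * ε)) := by
        refine add_le_add_left (mul_le_mul_of_nonneg_left (le_trans ?_ hAB) hμ) _
        refine Finset.sum_le_sum fun i _ => ?_
        rw [Finset.sum_comm]
        refine Finset.sum_le_sum fun u _ => ?_
        rw [Finset.sum_comm]
        refine Finset.sum_le_sum fun v _ => ?_
        rw [← Finset.mul_sum]
        exact mul_le_mul_of_nonneg_left (hB'B i v) (hA i u)
    _ = _ := by rw [mul_one]

theorem heavy_le {X : Type} [Fintype X] (P : X → ℝ) (hP : ∀ x, 0 ≤ P x) (hP1 : ∑ x, P x ≤ 1)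
    {a : ℝ} (ha : 0 < a) :
    (∑ x, if P x ≤ a / Fintype.card X then (0 : ℝ) else 1) / Fintype.card X ≤ 1 / a := by
  rcases isEmpty_or_nonempty X with hX | hX
  · simp [ha.le]
  have hc : (0 : ℝ) < Fintype.card X := by exact_mod_cast Fintype.card_pos
  rw [div_le_div_iff₀ hc ha, one_mul, Finset.sum_mul]
  calc ∑ x, (if P x ≤ a / Fintype.card X then (0 : ℝ) else 1) * a
      ≤ ∑ x, P x * Fintype.card X := Finset.sum_le_sum fun x _ => by
        split_ifs with h
        · rw [zero_mul]
          exact mul_nonneg (hP x) hc.le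
        · rw [one_mul]
          exact ((div_lt_iff₀ hc).mp (not_le.mp h)).le
    _ = (∑ x, P x) * Fintype.card X := by rw [Finset.sum_mul]
    _ ≤ Fintype.card X := mul_le_of_le_one_left hc.le hP1

theorem two_le_of_tmParam_pos {Q T : ℕ} (hs : 0 < tmParam Q T) : 2 ≤ Q ∧ 2 ≤ T := by
  have h : ∀ k : ℕ, ¬ 2 ≤ k → Real.logb 2 k = 0 := fun k hk => by
    interval_cases k <;> simp
  constructor
  · by_contra hQ
    simp [tmParam, h Q hQ] at hs
  · by_contra hT
    simp [tmParam, h T hT] at hs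

theorem sq_tmParam {Q T : ℕ} (hQ : 2 ≤ Q) (hT : 2 ≤ T) :
    tmParam Q T ^ 2 = Real.logb 2 Q * (T * Real.logb 2 T) := by
  have h1 : 0 ≤ Real.logb 2 Q := Real.logb_nonneg (by norm_num) (by exact_mod_cast (by omega))
  have h2 : 0 ≤ Real.logb 2 T := Real.logb_nonneg (by norm_num) (by exact_mod_cast (by omega))
  rw [tmParam, Real.sq_sqrt (by positivity)]

theorem time_mul_logb_le {Q T : ℕ} (hs : 0 < tmParam Q T) :
    T * Real.logb 2 (T * Q + 1 : ℕ) ≤ 3 * tmParam Q T ^ 2 := by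
  obtain ⟨hQ, hT⟩ := two_le_of_tmParam_pos hs
  have hQ' : (2 : ℝ) ≤ Q := by exact_mod_cast hQ
  have hT' : (2 : ℝ) ≤ T := by exact_mod_cast hT
  have hQ1 : 1 ≤ Real.logb 2 Q := by
    rw [Real.le_logb_iff_rpow_le (by norm_num) (by linarith)]
    simpa using hQ'
  have hT1 : 1 ≤ Real.logb 2 T := by
    rw [Real.le_logb_iff_rpow_le (by norm_num) (by linarith)]
    simpa using hT'
  have h1 : Real.logb 2 (T * Q + 1 : ℕ) ≤ Real.logb 2 T + Real.logb 2 Q + 1 := by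
    rw [← Real.logb_mul (by positivity) (by positivity)]
    have h2 : (1 : ℝ) = Real.logb 2 2 := (Real.logb_self_eq_one (by norm_num)).symm
    rw [h2]
    rw [← Real.logb_mul (by positivity) (by norm_num)]
    refine Real.logb_le_logb_of_le (by norm_num) (by positivity) ?_
    push_cast
    nlinarith
  rw [sq_tmParam hQ hT]
  nlinarith [mul_nonneg (sub_nonneg.mpr hQ1) (sub_nonneg.mpr hT1),
    mul_le_mul_of_nonneg_left h1 (by linarith : (0 : ℝ) ≤ T),
    mul_nonneg (by linarith : (0 : ℝ) ≤ T) (mul_nonneg (sub_nonneg.mpr hQ1) (sub_nonneg.mpr hT1)),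
    mul_nonneg (by linarith : (0 : ℝ) ≤ T) (sub_nonneg.mpr hQ1),
    mul_nonneg (by linarith : (0 : ℝ) ≤ T) (sub_nonneg.mpr hT1)]

/-- A number of crossings that is exceeded with small probability and leaves few sequences of
crossings. -/
theorem exists_crossing_bound {Q T b : ℕ} (hb : 0 < b) (hs : 0 < tmParam Q T) :
    ∃ q : ℕ, (((T * Q + 1) ^ q : ℕ) : ℝ) ≤ 2 ^ b ∧ T / (q + 1 : ℝ) ≤ 3 * tmParam Q T ^ 2 / b := by
  obtain ⟨hQ, hT⟩ := two_le_of_tmParam_pos hs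
  have hb' : (0 : ℝ) < b := by exact_mod_cast hb
  set L := Real.logb 2 (T * Q + 1 : ℕ) with hL
  have hTQ : (1 : ℝ) < (T * Q + 1 : ℕ) := by
    have : 0 < T * Q := by positivity
    exact_mod_cast (by omega : 1 < T * Q + 1)
  have hL0 : 0 < L := Real.logb_pos (by norm_num) hTQ
  refine ⟨⌊b / L⌋₊, ?_, ?_⟩
  · have h1 : (⌊b / L⌋₊ : ℝ) ≤ b / L := Nat.floor_le (by positivity)
    rw [le_div_iff₀ hL0] at h1
    have h2 : ((T * Q + 1 : ℕ) : ℝ) = 2 ^ L :=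
      (Real.rpow_logb (by norm_num) (by norm_num) (by linarith)).symm
    rw [Nat.cast_pow, h2, ← Real.rpow_natCast, ← Real.rpow_mul (by norm_num), ← Real.rpow_natCast]
    exact rpow_two_mono (by linarith)
  · have h1 : b / L < ⌊b / L⌋₊ + 1 := Nat.lt_floor_add_one _
    rw [div_lt_iff₀ hL0] at h1
    rw [div_le_div_iff₀ (by positivity) hb']
    have h2 := time_mul_logb_le hs
    have hT0 : (0 : ℝ) ≤ T := Nat.cast_nonneg _
    calc (T : ℝ) * b ≤ T * ((⌊b / L⌋₊ + 1) * L) := mul_le_mul_of_nonneg_left h1.le hT0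
      _ = T * L * (⌊b / L⌋₊ + 1) := by ring
      _ ≤ 3 * tmParam Q T ^ 2 * (⌊b / L⌋₊ + 1) := mul_le_mul_of_nonneg_right h2 (by positivity)

/-! ### The distance for a single block -/

theorem sum_bitStr_comp {κ : Type} [Fintype κ] [DecidableEq κ] {n : ℕ} (e : κ → Fin n)
    (he : Function.Injective e) (g : (κ → Bool) → ℝ) :
    (∑ u : BitStr n, g (u ∘ e)) / Fintype.card (BitStr n) =
      (∑ x, g x) / Fintype.card (κ → Bool) := by
  have h : (PMF.uniformOfFintype (BitStr n)).map (fun u => u ∘ e) =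
      PMF.uniformOfFintype (κ → Bool) := map_uniform_comp e he (Equiv.refl _)
  rw [← sum_map_uniform (fun u : BitStr n => u ∘ e) g, h, Finset.sum_div]
  refine Finset.sum_congr rfl fun x _ => ?_
  rw [PMF.uniformOfFintype_apply, ENNReal.toReal_inv, ENNReal.toReal_natCast]
  ring

/-- For a single block, a test that compares the last bit with the isolator value separates the
hard distribution from a Turing-machine source; the cut lies in the middle third. -/
theorem quarter_le_tvDist_hardDistOne {Q T b : ℕ} (hb : 0 < b) (hs : 0 < tmParam Q T)
    (hsb : tmParam Q T ≤ b) {Y : PMF (BitStr (96 * b + 1))} (hY : Y ∈ tmSources Q T (96 * b + 1)) :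
    1 / 4 ≤ tvDist (hardDistOne (96 * b) (isoThirds b)) Y := by
  classical
  obtain ⟨twoWay, M, rfl⟩ := hY
  obtain ⟨q, hq1, hq2⟩ := exists_crossing_bound hb hs
  have hb' : (1 : ℝ) ≤ b := by exact_mod_cast hb
  obtain ⟨p, hpW, I, hI, A, B, hcard, hA, hB, hA1, hB1, hAB, hF⟩ := M.exists_products twoWay T
    (96 * b + 1) q (Finset.Ioc (32 * b) (64 * b)) (fun p hp => by
      have := (Finset.mem_Ioc.mp hp).1
      omega) ⟨64 * b, by simp; omega⟩
  rw [Finset.mem_Ioc] at hpW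
  let X := BitStr (32 * b)
  let e₁ : Fin (32 * b) → Fin (96 * b) := fun k => ⟨k, by omega⟩
  let e₂ : Fin (32 * b) → Fin (96 * b) := fun k => ⟨64 * b + k, by omega⟩
  have he₁ : Function.Injective e₁ := fun i j h => by simpa [e₁, Fin.ext_iff] using h
  have he₂ : Function.Injective e₂ := fun i j h => by simpa [e₂, Fin.ext_iff] using h
  let xd : BitStr (96 * b + 1) → X := fun w k => w (e₁ k).castSucc
  let yd : BitStr (96 * b + 1) → X := fun w k => w (e₂ k).castSucc
  let zd : BitStr (96 * b + 1) → Bool := fun w => w (Fin.last _)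
  have hx (u v : BitStr (96 * b + 1)) : xd (mergeAt p u v) = xd u := by
    funext k
    exact if_pos (show (k : ℕ) < p by omega)
  have hy (u v : BitStr (96 * b + 1)) : yd (mergeAt p u v) = yd v := by
    funext k
    exact if_neg (show ¬ 64 * b + (k : ℕ) < p by omega)
  have hz (u v : BitStr (96 * b + 1)) : zd (mergeAt p u v) = zd v :=
    if_neg (show ¬ 96 * b < p by omega)
  have hmix : ∀ z, Mixes (fun x y => isoFun (32 * b) 1 (x, y) == z) (1 / 2)
      (Real.sqrt (2 ^ 1 / 2 ^ (32 * b))) := by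
    have := mixes_isoFun (n := 32 * b) (m := 1) (by omega)
    rw [pow_one] at this
    exact fun z => Mixes.beq (by simpa using this) z
  set a : ℝ := 2 ^ (8 * b) with ha
  have ha0 : 0 < a := by positivity
  let P : I → X → ℝ := fun i => pushWeight xd (A i)
  let R : I → Bool → X → ℝ := fun i z =>
    pushWeight yd fun v => if some (zd v) = some z then B i v else 0
  let good : BitStr (96 * b + 1) → Prop := fun w => isoFun (32 * b) 1 (xd w, yd w) = zd w ∧
    ∀ i, P i (xd w) ≤ a / Fintype.card X ∧ R i (zd w) (yd w) ≤ a / Fintype.card X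
  let F : BitStr (96 * b + 1) → ℝ := fun w => if good w then 1 else 0
  have hF0 (w) : 0 ≤ F w := by simp only [F]; split_ifs <;> norm_num
  have hF1 (w) : F w ≤ 1 := by simp only [F]; split_ifs <;> norm_num
  have hsrc := hF F hF0 hF1
  have htest := sum_products_mul_test_le hmix (by norm_num) ha0.le A B hA hB hA1 hB1 hAB
    (fun v => some (zd v)) (fun _ => xd) (fun _ => yd) (fun u v => F (mergeAt p u v))
    (fun u v => hF1 _) fun u v huv => by
      have hg : good (mergeAt p u v) := by
        by_contra h
        simp [F, h] at huv
      simp only [good, hx, hy, hz] at hg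
      exact ⟨zd v, rfl, by simpa using hg.1, hg.2⟩
  have hI2 : (Fintype.card I : ℝ) ≤ 2 ^ b := le_trans (by exact_mod_cast hcard) hq1
  -- the acceptance probability under the hard distribution
  have hhard : 1 - 3 * (2 ^ b / a) ≤
      ∑ w, (hardDistOne (96 * b) (isoThirds b) w).toReal * F w := by
    rw [hardDistOne, sum_map_uniform]
    have hpt (u : BitStr (96 * b)) : 1 - ∑ i, ((if P i (u ∘ e₁) ≤ a / Fintype.card X then 0 else 1) +
        ∑ z, if R i z (u ∘ e₂) ≤ a / Fintype.card X then (0 : ℝ) else 1) ≤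
        F (Fin.append u fun _ : Fin 1 => isoThirds b u) := by
      have e1 : xd (Fin.append u fun _ : Fin 1 => isoThirds b u) = u ∘ e₁ := by
        funext k
        exact Fin.append_left u (fun _ : Fin 1 => isoThirds b u) (e₁ k)
      have e2 : yd (Fin.append u fun _ : Fin 1 => isoThirds b u) = u ∘ e₂ := by
        funext k
        exact Fin.append_left u (fun _ : Fin 1 => isoThirds b u) (e₂ k)
      have e3 : zd (Fin.append u fun _ : Fin 1 => isoThirds b u) = isoThirds b u :=
        Fin.append_right u (fun _ : Fin 1 => isoThirds b u) 0
      have hn1 (i : I) : (0 : ℝ) ≤ (if P i (u ∘ e₁) ≤ a / Fintype.card X then 0 else 1) := by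
        split_ifs <;> norm_num
      have hn2 (i : I) (z : Bool) : (0 : ℝ) ≤
          (if R i z (u ∘ e₂) ≤ a / Fintype.card X then (0 : ℝ) else 1) := by
        split_ifs <;> norm_num
      have hn (i : I) := add_nonneg (hn1 i) (Finset.sum_nonneg fun z (_ : z ∈ Finset.univ) => hn2 i z)
      by_cases h : good (Fin.append u fun _ : Fin 1 => isoThirds b u)
      · simp only [F, if_pos h]
        have := Finset.sum_nonneg fun i (_ : i ∈ Finset.univ) => hn i
        linarith
      · refine le_trans ?_ (hF0 _)
        rw [sub_nonpos]
        simp only [good, e1, e2, e3] at h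
        rw [not_and] at h
        obtain ⟨i, hi⟩ := not_forall.mp (h (isoThirds_apply b u).symm)
        refine le_trans ?_ (Finset.single_le_sum (fun i _ => hn i) (Finset.mem_univ i))
        by_cases h1 : P i (u ∘ e₁) ≤ a / Fintype.card X
        · rw [if_pos h1, zero_add]
          refine le_trans ?_ (Finset.single_le_sum (fun z _ => hn2 i z)
            (Finset.mem_univ (isoThirds b u)))
          rw [if_neg fun h2 => hi ⟨h1, h2⟩]
        · rw [if_neg h1]
          have := Finset.sum_nonneg fun z (_ : z ∈ Finset.univ) => hn2 i z
          linarith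
    have hcu : (0 : ℝ) < Fintype.card (BitStr (96 * b)) := by exact_mod_cast Fintype.card_pos
    refine le_trans ?_ (div_le_div_of_nonneg_right (Finset.sum_le_sum fun u _ => hpt u) hcu.le)
    rw [Finset.sum_sub_distrib, Finset.sum_comm, sub_div]
    simp only [Finset.sum_add_distrib, Fintype.sum_bool, add_div, Finset.sum_div]
    simp only [← Finset.sum_div]
    have hB' (i z) : ∀ v, 0 ≤ (if some (zd v) = some z then B i v else 0) := fun v => by
      split_ifs
      exacts [hB i v, le_rfl]
    have hheavy (P : X → ℝ) (hP : ∀ x, 0 ≤ P x) (hP1 : ∑ x, P x ≤ 1)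
        (e : Fin (32 * b) → Fin (96 * b)) (he : Function.Injective e) :
        (∑ u : BitStr (96 * b), if P (u ∘ e) ≤ a / Fintype.card X then (0 : ℝ) else 1) /
          Fintype.card (BitStr (96 * b)) ≤ 1 / a := by
      rw [sum_bitStr_comp e he fun x => if P x ≤ a / Fintype.card X then (0 : ℝ) else 1]
      exact heavy_le P hP hP1 ha0
    have hR1 (i z) : ∑ y, R i z y ≤ 1 := by
      rw [sum_pushWeight]
      refine le_trans (Finset.sum_le_sum fun v _ => ?_) (hB1 i)
      split_ifs
      exacts [le_rfl, hB i v]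
    have h1 := Finset.sum_le_sum fun i (_ : i ∈ Finset.univ) => hheavy (P i)
      (pushWeight_nonneg _ _ (hA i)) (by rw [sum_pushWeight]; exact hA1 i) e₁ he₁
    have h2 (z) := Finset.sum_le_sum fun i (_ : i ∈ Finset.univ) => hheavy (R i z)
      (pushWeight_nonneg _ _ (hB' i z)) (hR1 i z) e₂ he₂
    have h3 : ∑ _ : I, 1 / a ≤ 2 ^ b / a := by
      rw [Finset.sum_const, Finset.card_univ, nsmul_eq_mul, mul_one_div]
      exact div_le_div_of_nonneg_right hI2 ha0.le
    have h4 : (∑ _ : BitStr (96 * b), (1 : ℝ)) / Fintype.card (BitStr (96 * b)) = 1 := by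
      rw [Finset.sum_const, Finset.card_univ, nsmul_eq_mul, mul_one, div_self hcu.ne']
    rw [← Finset.sum_div] at h1
    have h2t := h2 true
    have h2f := h2 false
    rw [← Finset.sum_div] at h2t h2f
    rw [h4]
    linarith
  have hlast := sub_le_tvDist (hardDistOne (96 * b) (isoThirds b)) (M.source twoWay T (96 * b + 1)) F
    hF0 hF1
  have hW : (T : ℝ) / ((Finset.Ioc (32 * b) (64 * b)).card * (q + 1)) ≤ 3 / 32 := by
    rw [Nat.card_Ioc, show 64 * b - 32 * b = 32 * b by omega, mul_comm, ← div_div]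
    have h3 : tmParam Q T ^ 2 ≤ b ^ 2 := pow_le_pow_left₀ hs.le hsb 2
    calc T / (q + 1 : ℝ) / (32 * b : ℕ) ≤ 3 * b ^ 2 / b / (32 * b : ℕ) := by
          refine div_le_div_of_nonneg_right (hq2.trans ?_) (by positivity)
          gcongr
      _ = 3 / 32 := by
          push_cast
          field_simp
  have h7 : (2 : ℝ) ^ b / a ≤ 1 / 128 := by
    rw [ha, show 8 * b = b + 7 * b by ring, pow_add, ← div_div, div_self (by positivity)]
    refine one_div_le_one_div_of_le (by norm_num) ?_
    calc (128 : ℝ) = 2 ^ 7 := by norm_num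
      _ ≤ 2 ^ (7 * b) := pow_le_pow_right₀ (by norm_num) (by omega)
  have hsmall : (Fintype.card I : ℝ) * (Fintype.card Bool * (a * Real.sqrt (2 ^ 1 / 2 ^ (32 * b)))) ≤
      4 / 128 := by
    have hsq : Real.sqrt (2 ^ 1 / 2 ^ (32 * b)) ≤ 2 / a ^ 2 := by
      rw [Real.sqrt_le_left (by positivity), ha, ← pow_mul, div_pow, ← pow_mul,
        show 8 * b * 2 * 2 = 32 * b by ring]
      gcongr <;> norm_num
    calc (Fintype.card I : ℝ) * (Fintype.card Bool * (a * Real.sqrt (2 ^ 1 / 2 ^ (32 * b))))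
        ≤ 2 ^ b * (2 * (a * (2 / a ^ 2))) := by
          rw [Fintype.card_bool]
          gcongr
          norm_num
      _ = 4 * (2 ^ b / a) := by field_simp; norm_num
      _ ≤ 4 / 128 := by linarith
  linarith

/-! ### The distance for many blocks -/

theorem sum_prod_pi {Z : Type} [Fintype Z] {t : ℕ} (g : Fin t → Z → ℝ) :
    (∑ w : Fin t → Z, ∏ j, g j (w j)) / Fintype.card (Fin t → Z) =
      ∏ j, (∑ z, g j z) / Fintype.card Z := by
  have := Finset.prod_univ_sum (fun _ : Fin t => (Finset.univ : Finset Z)) g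
  rw [Fintype.piFinset_univ] at this
  rw [← this, Finset.prod_div_distrib]
  simp

theorem sum_pi_apply {Z : Type} [Fintype Z] [Nonempty Z] {t : ℕ} (j : Fin t) (g : Z → ℝ) :
    (∑ w : Fin t → Z, g (w j)) / Fintype.card (Fin t → Z) = (∑ z, g z) / Fintype.card Z := by
  have hZ : (Fintype.card Z : ℝ) ≠ 0 := by exact_mod_cast Fintype.card_ne_zero
  have := sum_prod_pi fun j' z => if j' = j then g z else 1
  simp only [Finset.prod_ite_eq', Finset.mem_univ, if_true] at this
  rw [this, Finset.prod_eq_single j]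
  · simp
  · intro j' _ h
    simp [h, hZ]
  · simp

theorem sum_add_div {X Y : Type} [Fintype X] [Fintype Y] [Nonempty X] [Nonempty Y] (g : X → ℝ)
    (h : Y → ℝ) : (∑ p : X × Y, (g p.1 + h p.2)) / Fintype.card (X × Y) =
      (∑ x, g x) / Fintype.card X + (∑ y, h y) / Fintype.card Y := by
  have hX : (Fintype.card X : ℝ) ≠ 0 := by exact_mod_cast Fintype.card_ne_zero
  have hY : (Fintype.card Y : ℝ) ≠ 0 := by exact_mod_cast Fintype.card_ne_zero
  simp only [Fintype.sum_prod_type, Finset.sum_add_distrib, Finset.sum_const, Finset.card_univ,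
    nsmul_eq_mul, Fintype.card_prod, Nat.cast_mul, ← Finset.mul_sum]
  field_simp

theorem prod_ite_val_lt {t' t : ℕ} (h : t' ≤ t) (c : ℝ) :
    ∏ j : Fin t, (if (j : ℕ) < t' then c else 1) = c ^ t' := by
  rw [Finset.prod_ite, Finset.prod_const_one, mul_one, Finset.prod_const]
  congr 1
  rw [Fin.card_filter_val_lt, min_eq_right h]

/-- Positions of the blocks of the first party. -/
def posA {n t : ℕ} (j : Fin t) (k : Fin n) : Fin (t * n + t * n + t) :=
  Fin.castAdd t (Fin.castAdd (t * n) (finProdFinEquiv (j, k)))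

/-- Positions of the blocks of the second party. -/
def posB {n t : ℕ} (j : Fin t) (k : Fin n) : Fin (t * n + t * n + t) :=
  Fin.castAdd t (Fin.natAdd (t * n) (finProdFinEquiv (j, k)))

theorem posA_lt {n t t' : ℕ} (j : Fin t) (k : Fin n) (hj : (j : ℕ) < t') :
    (posA j k : ℕ) < t' * n := by
  have h : (posA j k : ℕ) = k + n * j := rfl
  have hk := k.isLt
  rw [h]
  nlinarith

theorem le_posB {n t : ℕ} (j : Fin t) (k : Fin n) : t * n ≤ (posB j k : ℕ) := by
  have h : (posB j k : ℕ) = t * n + (k + n * j) := rfl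
  omega

theorem concatBits_finProdFinEquiv {n t : ℕ} (x : Fin t → BitStr n) (j : Fin t) (k : Fin n) :
    concatBits x (finProdFinEquiv (j, k)) = x j k := by
  have h := finProdFinEquiv.symm_apply_apply (j, k)
  rw [finProdFinEquiv_symm_apply, Prod.mk.injEq] at h
  rw [concatBits, h.1, h.2]

theorem sum_ite_not_le {X Y : Type} [Fintype X] [Fintype Y] [Nonempty X] [Nonempty Y]
    {Iso : X × Y → Bool} {μ ε : ℝ} (h : Mixes (fun x y => Iso (x, y)) μ ε) :
    (∑ p : X × Y, if Iso p then (0 : ℝ) else 1) / Fintype.card (X × Y) ≤ 1 - (μ - ε) := by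
  have hu := neg_le_of_abs_le h.uniform
  have hc : (0 : ℝ) < Fintype.card (X × Y) := by exact_mod_cast Fintype.card_pos
  have e : ∑ p : X × Y, (if Iso p then (0 : ℝ) else 1) =
      Fintype.card (X × Y) - ∑ p : X × Y, if Iso p then (1 : ℝ) else 0 := by
    rw [eq_sub_iff_add_eq, ← Finset.sum_add_distrib, ← Finset.card_univ, Finset.cast_card]
    exact Finset.sum_congr rfl fun p _ => by split_ifs <;> simp
  have e2 : ∑ x, ∑ y, (if Iso (x, y) then 1 / (Fintype.card X * Fintype.card Y : ℝ) else 0) =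
      (∑ p : X × Y, if Iso p then (1 : ℝ) else 0) / Fintype.card (X × Y) := by
    rw [Fintype.sum_prod_type, Finset.sum_div, Fintype.card_prod]
    refine Finset.sum_congr rfl fun x _ => ?_
    rw [Finset.sum_div]
    exact Finset.sum_congr rfl fun y _ => by split_ifs <;> simp
  rw [e2] at hu
  rw [e, sub_div, div_self hc.ne']
  linarith

/-- For many blocks, the test checks the isolator values of the first `t'` blocks, one of which
has to be one; the cut lies in one of the remaining blocks of the first party. -/
theorem le_tvDist_hardDist {Q T n t t' : ℕ} (q : ℕ) (hn : 0 < n) (ht : t' < t)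
    {Iso : BitStr n × BitStr n → Bool} {μ ε a : ℝ} (hmix : Mixes (fun x y => Iso (x, y)) μ ε)
    (hμ : 0 ≤ μ) (ha : 0 < a) {X : PMF (BitStr (t * n + t * n + t))}
    (hX : X ∈ tmSources Q T (t * n + t * n + t)) :
    1 - (1 - (μ - ε)) ^ t' - ((T * Q + 1) ^ q : ℕ) * (t' * (1 / a + 1 / a)) -
      (T / (((t - t') * n : ℕ) * (q + 1)) + (μ + ((T * Q + 1) ^ q : ℕ) * (t' * (a * ε)))) ≤
      tvDist (hardDist n t Iso) X := by
  classical
  obtain ⟨twoWay, M, rfl⟩ := hX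
  have htn : t' * n < t * n := Nat.mul_lt_mul_of_pos_right ht hn
  obtain ⟨p, hpW, I, hI, A, B, hcard, hA, hB, hA1, hB1, hAB, hF⟩ := M.exists_products twoWay T
    (t * n + t * n + t) q (Finset.Ioc (t' * n) (t * n)) (fun p hp => by
      have := (Finset.mem_Ioc.mp hp).1
      omega) ⟨t * n, by simp [htn]⟩
  rw [Finset.mem_Ioc] at hpW
  have hcard' : (Fintype.card I : ℝ) ≤ ((T * Q + 1) ^ q : ℕ) := by exact_mod_cast hcard
  have hε : 0 ≤ ε := (abs_nonneg _).trans hmix.uniform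
  let c : Fin t' → Fin t := Fin.castLE ht.le
  let xd : Fin t' → BitStr (t * n + t * n + t) → BitStr n := fun j w k => w (posA (c j) k)
  let yd : Fin t' → BitStr (t * n + t * n + t) → BitStr n := fun j w k => w (posB (c j) k)
  let zd : Fin t' → BitStr (t * n + t * n + t) → Bool := fun j w => w (Fin.natAdd _ (c j))
  have hx (j u v) : xd j (mergeAt p u v) = xd j u := by
    funext k
    exact if_pos ((posA_lt (c j) k j.isLt).trans hpW.1)
  have hy (j u v) : yd j (mergeAt p u v) = yd j v := by
    funext k
    exact if_neg (not_lt.mpr (hpW.2.trans (le_posB (c j) k)))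
  have hz (j u v) : zd j (mergeAt p u v) = zd j v :=
    if_neg (show ¬ t * n + t * n + (c j : ℕ) < p by omega)
  let σ : BitStr (t * n + t * n + t) → Option (Fin t') := fun v =>
    if h : ∃ j, zd j v = true then some h.choose else none
  let P : I → Fin t' → BitStr n → ℝ := fun i j => pushWeight (xd j) (A i)
  let R : I → Fin t' → BitStr n → ℝ := fun i j =>
    pushWeight (yd j) fun v => if σ v = some j then B i v else 0
  let good : BitStr (t * n + t * n + t) → Prop := fun w => (∃ j, zd j w = true) ∧
    (∀ j, Iso (xd j w, yd j w) = zd j w) ∧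
    ∀ i j, P i j (xd j w) ≤ a / Fintype.card (BitStr n) ∧
      R i j (yd j w) ≤ a / Fintype.card (BitStr n)
  let F : BitStr (t * n + t * n + t) → ℝ := fun w => if good w then 1 else 0
  have hF0 (w) : 0 ≤ F w := by simp only [F]; split_ifs <;> norm_num
  have hF1 (w) : F w ≤ 1 := by simp only [F]; split_ifs <;> norm_num
  have hsrc := hF F hF0 hF1
  have htest := sum_products_mul_test_le (J := Fin t') (fun _ => hmix) hμ ha.le A B hA hB hA1 hB1
    hAB σ xd yd (fun u v => F (mergeAt p u v)) (fun u v => hF1 _) fun u v huv => by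
      have hg : good (mergeAt p u v) := by
        by_contra h
        simp [F, h] at huv
      simp only [good, hx, hy, hz] at hg
      obtain ⟨h1, h2, h3⟩ := hg
      exact ⟨h1.choose, dif_pos h1, (h2 _).trans h1.choose_spec, fun i => h3 i _⟩
  -- the rejection probability under the hard distribution
  have hhard : 1 - (1 - (μ - ε)) ^ t' - Fintype.card I * (t' * (1 / a + 1 / a)) ≤
      ∑ w, (hardDist n t Iso w).toReal * F w := by
    rw [hardDist, sum_map_uniform, ← (Equiv.arrowProdEquivProdArrow (Fin t) (fun _ => BitStr n)
      fun _ => BitStr n).sum_comp, ← Fintype.card_congr (Equiv.arrowProdEquivProdArrow (Fin t)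
      (fun _ => BitStr n) fun _ => BitStr n)]
    let enc : (Fin t → BitStr n × BitStr n) → BitStr (t * n + t * n + t) := fun w =>
      Fin.append (Fin.append (concatBits fun j => (w j).1) (concatBits fun j => (w j).2))
        fun j => Iso ((w j).1, (w j).2)
    change _ ≤ (∑ w, F (enc w)) / _
    have e1 (w j) : xd j (enc w) = (w (c j)).1 := by
      funext k
      refine (Fin.append_left _ _ _).trans ((Fin.append_left _ _ _).trans ?_)
      rw [concatBits_finProdFinEquiv]
    have e2 (w j) : yd j (enc w) = (w (c j)).2 := by
      funext k
      refine (Fin.append_left _ _ _).trans ((Fin.append_right _ _ _).trans ?_)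
      rw [concatBits_finProdFinEquiv]
    have e3 (w j) : zd j (enc w) = Iso (w (c j)) := Fin.append_right _ _ _
    let G : Fin t' → I → BitStr n × BitStr n → ℝ := fun j i z =>
      (if P i j z.1 ≤ a / Fintype.card (BitStr n) then 0 else 1) +
        if R i j z.2 ≤ a / Fintype.card (BitStr n) then 0 else 1
    have hG (j i z) : 0 ≤ G j i z := by
      simp only [G]
      split_ifs <;> norm_num
    have hGs (w : Fin t → BitStr n × BitStr n) := Finset.sum_nonneg fun i (_ : i ∈ Finset.univ) =>
      Finset.sum_nonneg fun j (_ : j ∈ Finset.univ) => hG j i (w (c j))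
    have hprod (w : Fin t → BitStr n × BitStr n) : 0 ≤ ∏ j : Fin t,
        if (j : ℕ) < t' then (if Iso (w j) then (0 : ℝ) else 1) else 1 :=
      Finset.prod_nonneg fun j _ => by split_ifs <;> norm_num
    have hpt (w : Fin t → BitStr n × BitStr n) :
        1 - (∏ j : Fin t, if (j : ℕ) < t' then (if Iso (w j) then (0 : ℝ) else 1) else 1) -
          ∑ i, ∑ j, G j i (w (c j)) ≤ F (enc w) := by
      by_cases h : good (enc w)
      · simp only [F, if_pos h]
        linarith [hGs w, hprod w]
      · refine le_trans ?_ (hF0 _)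
        rw [sub_sub, sub_nonpos]
        simp only [good, e1, e2, e3] at h
        by_cases h1 : ∃ j : Fin t', Iso (w (c j)) = true
        · obtain ⟨i, hi⟩ := not_forall.mp fun h3 => h ⟨h1, fun _ => trivial, h3⟩
          obtain ⟨j, hj⟩ := not_forall.mp hi
          have h4 : 1 ≤ G j i (w (c j)) := by
            simp only [G]
            by_cases k1 : P i j (w (c j)).1 ≤ a / Fintype.card (BitStr n)
            · rw [if_pos k1, if_neg fun k2 => hj ⟨k1, k2⟩, zero_add]
            · rw [if_neg k1]
              split_ifs <;> norm_num
          have h5 := (Finset.single_le_sum (fun j _ => hG j i (w (c j))) (Finset.mem_univ j)).trans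
            (Finset.single_le_sum (f := fun i => ∑ j, G j i (w (c j))) (fun i _ =>
              Finset.sum_nonneg fun j _ => hG j i (w (c j))) (Finset.mem_univ i))
          linarith [hprod w]
        · rw [Finset.prod_eq_one fun j _ => ?_]
          · linarith [hGs w]
          · split_ifs with k1 k2
            · exact absurd ⟨⟨j, k1⟩, k2⟩ h1
            · simp
            · simp
    have hcu : (0 : ℝ) < Fintype.card (Fin t → BitStr n × BitStr n) := by
      exact_mod_cast Fintype.card_pos
    refine le_trans ?_ (div_le_div_of_nonneg_right (Finset.sum_le_sum fun w _ => hpt w) hcu.le)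
    rw [Finset.sum_sub_distrib, Finset.sum_sub_distrib, sub_div, sub_div]
    have k0 : (∑ _ : Fin t → BitStr n × BitStr n, (1 : ℝ)) /
        Fintype.card (Fin t → BitStr n × BitStr n) = 1 := by
      rw [Finset.sum_const, Finset.card_univ, nsmul_eq_mul, mul_one, div_self hcu.ne']
    have k1 : (∑ w : Fin t → BitStr n × BitStr n, ∏ j : Fin t,
        if (j : ℕ) < t' then (if Iso (w j) then (0 : ℝ) else 1) else 1) /
        Fintype.card (Fin t → BitStr n × BitStr n) ≤ (1 - (μ - ε)) ^ t' := by
      rw [sum_prod_pi fun j z => if (j : ℕ) < t' then (if Iso z then (0 : ℝ) else 1) else 1,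
        ← prod_ite_val_lt ht.le]
      refine Finset.prod_le_prod (fun j _ => ?_) fun j _ => ?_
      · refine div_nonneg (Finset.sum_nonneg fun z _ => ?_) (Nat.cast_nonneg _)
        split_ifs <;> norm_num
      · split_ifs
        · exact sum_ite_not_le hmix
        · rw [Finset.sum_const, Finset.card_univ, nsmul_eq_mul, mul_one]
          exact div_self_le_one _
    have hR1 (i j) : ∑ y, R i j y ≤ 1 := by
      rw [sum_pushWeight]
      refine le_trans (Finset.sum_le_sum fun v _ => ?_) (hB1 i)
      split_ifs
      exacts [le_rfl, hB i v]
    have hR0 (i j) : ∀ y, 0 ≤ R i j y := pushWeight_nonneg _ _ fun v => by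
      split_ifs
      exacts [hB i v, le_rfl]
    have k2 (i j) : (∑ w : Fin t → BitStr n × BitStr n, G j i (w (c j))) /
        Fintype.card (Fin t → BitStr n × BitStr n) ≤ 1 / a + 1 / a := by
      have hX := heavy_le (P i j) (pushWeight_nonneg _ _ (hA i))
        (by rw [sum_pushWeight]; exact hA1 i) ha
      have hY := heavy_le (R i j) (hR0 i j) (hR1 i j) ha
      rw [sum_pi_apply (c j) (G j i)]
      exact (le_of_eq (sum_add_div _ _)).trans (add_le_add hX hY)
    have k3 : (∑ w : Fin t → BitStr n × BitStr n, ∑ i, ∑ j, G j i (w (c j))) /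
        Fintype.card (Fin t → BitStr n × BitStr n) ≤ Fintype.card I * (t' * (1 / a + 1 / a)) := by
      have := Finset.sum_le_sum fun i (_ : i ∈ Finset.univ) =>
        Finset.sum_le_sum fun j (_ : j ∈ Finset.univ) => k2 i j
      simp only [← Finset.sum_div] at this
      rw [Finset.sum_comm]
      refine le_trans (le_of_eq ?_) (this.trans (le_of_eq ?_))
      · congr 1
        exact Finset.sum_congr rfl fun i _ => Finset.sum_comm
      · simp only [Finset.sum_const, Finset.card_univ, nsmul_eq_mul, Fintype.card_fin]
    rw [k0]
    linarith
  have hlast := sub_le_tvDist (hardDist n t Iso) (M.source twoWay T (t * n + t * n + t)) F hF0 hF1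
  rw [Nat.card_Ioc, ← Nat.sub_mul] at hsrc
  rw [Fintype.card_fin] at htest
  have m1 := mul_le_mul_of_nonneg_right hcard' (show (0 : ℝ) ≤ t' * (1 / a + 1 / a) by positivity)
  have m2 := mul_le_mul_of_nonneg_right hcard' (show (0 : ℝ) ≤ t' * (a * ε) by positivity)
  linarith

/-! ### The parameters -/

theorem bounds_of_admissible {N b : ℕ} (h : Admissible 10 (1 / 10000) N b) :
    10 ≤ b ∧ 10000 * b ≤ N ∧ Real.logb 2 N ≤ b / 10 ∧ (N : ℝ) ≤ 2 ^ b := by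
  obtain ⟨h1, h2, h3⟩ := h
  have hN : (2 : ℝ) ≤ N := by exact_mod_cast h1
  have hlog : 1 ≤ Real.logb 2 N := by
    rw [Real.le_logb_iff_rpow_le (by norm_num) (by linarith)]
    simpa using hN
  refine ⟨?_, ?_, by linarith, ?_⟩
  · have : (10 : ℝ) ≤ b := by linarith
    exact_mod_cast this
  · have : (10000 : ℝ) * b ≤ N := by linarith
    exact_mod_cast this
  · rw [← Real.rpow_natCast, ← Real.logb_le_iff_le_rpow (by norm_num) (by linarith)]
    linarith

theorem bounds_of_numShifts {N b : ℕ} (h : Admissible 10 (1 / 10000) N b) :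
    3 ≤ numShifts N (96 * b) ∧
    N < (numShifts N (96 * b) + 1) * 2 ^ (numShifts N (96 * b) + 1) * (96 * b) ∧
    2 ^ numShifts N (96 * b) * b ≤ N ∧
    (numShifts N (96 * b) : ℝ) ≤ 1 / 100 * (96 * b : ℕ) := by
  obtain ⟨hb, hbN, hlog, -⟩ := bounds_of_admissible h
  have hn : 0 < 96 * b := by omega
  set m := numShifts N (96 * b) with hm
  have h3 : 3 ≤ m := le_numShifts hn (by norm_num; omega)
  have hspec := numShifts_spec N (96 * b)
  rw [← hm] at hspec
  have hle : 2 ^ m * b ≤ N := by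
    refine le_trans ?_ hspec
    rw [mul_comm m, mul_assoc]
    refine Nat.mul_le_mul_left _ ?_
    nlinarith
  refine ⟨h3, ?_, hle, ?_⟩
  · by_contra hcon
    have := le_numShifts hn (not_lt.mp hcon)
    omega
  · have h2 : 2 ^ m ≤ N := le_trans (Nat.le_mul_of_pos_right _ (by omega)) hle
    have hN : 0 < N := by omega
    have h4 : (m : ℝ) ≤ Real.logb 2 N := by
      rw [Real.le_logb_iff_rpow_le (by norm_num) (by exact_mod_cast hN), Real.rpow_natCast]
      exact_mod_cast h2
    have hb' : (10 : ℝ) ≤ b := by exact_mod_cast hb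
    push_cast
    linarith

theorem one_sub_pow_le {m r : ℕ} {ε : ℝ} (hε0 : 0 ≤ ε) (hr : 8 * r = m * 2 ^ m)
    (hε : (8 * r : ℝ) * ε ≤ 1) : (1 - (1 / 2 ^ m - ε)) ^ (7 * r) ≤ 3 * (1 / 2 ^ m) := by
  have hm1 : (1 : ℝ) / 2 ^ m ≤ 1 := by
    rw [div_le_one (by positivity)]
    exact one_le_pow₀ (by norm_num)
  have hr' : (8 * r : ℝ) = m * 2 ^ m := by exact_mod_cast hr
  have hlog : Real.log 2 ≤ 7 / 8 := by linarith [Real.log_two_lt_d9]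
  have hexp : ((7 * r : ℕ) : ℝ) * (-(1 / 2 ^ m - ε)) ≤ -(m * Real.log 2) + 1 := by
    have e : ((7 * r : ℕ) : ℝ) * (1 / 2 ^ m) = 7 / 8 * m := by
      have : (7 * r : ℝ) = 7 / 8 * (m * 2 ^ m) := by linarith
      push_cast
      rw [this]
      field_simp
    have h1 : (m : ℝ) * Real.log 2 ≤ m * (7 / 8) :=
      mul_le_mul_of_nonneg_left hlog (Nat.cast_nonneg m)
    have h2 : ((7 * r : ℕ) : ℝ) * ε ≤ 8 * r * ε := by
      push_cast
      nlinarith [mul_nonneg (Nat.cast_nonneg r : (0 : ℝ) ≤ r) hε0]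
    nlinarith
  calc (1 - (1 / 2 ^ m - ε)) ^ (7 * r) ≤ (Real.exp (-(1 / 2 ^ m - ε))) ^ (7 * r) :=
        pow_le_pow_left₀ (by linarith) (by linarith [Real.add_one_le_exp (-(1 / 2 ^ m - ε))]) _
    _ = Real.exp (((7 * r : ℕ) : ℝ) * (-(1 / 2 ^ m - ε))) := (Real.exp_nat_mul _ _).symm
    _ ≤ Real.exp (-(m * Real.log 2) + 1) := Real.exp_le_exp.mpr hexp
    _ = Real.exp 1 * (1 / 2 ^ m) := by
        rw [Real.exp_add, Real.exp_neg, Real.exp_nat_mul, Real.exp_log (by norm_num), one_div,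
          mul_comm]
    _ ≤ 3 * (1 / 2 ^ m) := by
        refine mul_le_mul_of_nonneg_right ?_ (by positivity)
        linarith [Real.exp_one_lt_d9]

/-- The distance of the distribution with many blocks from Turing-machine sources, for the chosen
parameters. -/
theorem le_tvDist_hardDist_numShifts {Q T N b m t : ℕ} (hadm : Admissible 10 (1 / 10000) N b)
    (hb : b = ⌈tmParam Q T⌉₊) (hm : m = numShifts N (96 * b))
    (ht : t = m * 2 ^ m) {X : PMF (BitStr (t * (96 * b) + t * (96 * b) + t))}
    (hX : X ∈ tmSources Q T (t * (96 * b) + t * (96 * b) + t)) :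
    1 - 4000 * (tmParam Q T / N * Real.logb 2 (N / tmParam Q T)) ≤
      tvDist (hardDist (96 * b) t (isoFun (96 * b) m)) X := by
  obtain ⟨hb10, hbN, -, hNu⟩ := bounds_of_admissible hadm
  obtain ⟨hm3, hNlt, h2m, hmn⟩ := bounds_of_numShifts hadm
  have hspec := numShifts_spec N (96 * b)
  rw [← hm] at hm3 hNlt h2m hmn hspec
  set s := tmParam Q T with hs_def
  have hs0 : 0 < s := Nat.ceil_pos.mp (hb ▸ (by omega : 0 < b))
  have hsb : s ≤ b := hb ▸ Nat.le_ceil s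
  have hbs : (b : ℝ) < s + 1 := hb ▸ Nat.ceil_lt_add_one hs0.le
  have hb' : (10 : ℝ) ≤ b := by exact_mod_cast hb10
  have hs1 : 1 ≤ s := by linarith
  have hbs2 : (b : ℝ) ≤ 2 * s := by linarith
  have hN0 : (0 : ℝ) < N := by exact_mod_cast (by omega : 0 < N)
  have hN1 : (1 : ℝ) ≤ N := by exact_mod_cast (by omega : 1 ≤ N)
  obtain ⟨q, hq1, hq2⟩ := exists_crossing_bound (by omega : 0 < b) hs0
  obtain ⟨r, hr⟩ : ∃ r, m * 2 ^ m = 8 * r := by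
    obtain ⟨k, rfl⟩ := Nat.exists_eq_add_of_le hm3
    exact ⟨(3 + k) * 2 ^ k, by rw [pow_add]; ring⟩
  have hr0 : 0 < r := by
    have : 0 < m * 2 ^ m := by positivity
    omega
  have hr0' : (0 : ℝ) < r := by exact_mod_cast hr0
  have hrm : (8 * r : ℝ) = m * 2 ^ m := by exact_mod_cast hr.symm
  set u : ℝ := 2 ^ b with hu
  have hu1 : 1 ≤ u := hN1.trans hNu
  have hu2 : 2 ≤ u := by
    calc (2 : ℝ) = 2 ^ 1 := by norm_num
      _ ≤ u := pow_le_pow_right₀ (by norm_num) (by omega)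
  set ε := Real.sqrt (2 ^ m / 2 ^ (96 * b)) with hε
  have hε0 : 0 ≤ ε := Real.sqrt_nonneg _
  have h2mN : (2 : ℝ) ^ m ≤ N := by
    exact_mod_cast le_trans (Nat.le_mul_of_pos_right _ (by omega)) h2m
  have hεu : ε ≤ 1 / u ^ 47 := by
    have e : (2 : ℝ) ^ (96 * b) = u ^ 96 := by rw [hu, ← pow_mul, mul_comm]
    have e2 : (u ^ 47) ^ 2 = u ^ (47 * 2) := (pow_mul u 47 2).symm
    rw [hε, Real.sqrt_le_left (by positivity), div_pow, one_pow, e, e2,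
      div_le_div_iff₀ (by positivity) (by positivity)]
    calc (2 : ℝ) ^ m * u ^ (47 * 2) ≤ u * u ^ (47 * 2) :=
          mul_le_mul_of_nonneg_right (h2mN.trans hNu) (by positivity)
      _ = u ^ 95 := by ring
      _ ≤ 1 * u ^ 96 := by
          rw [one_mul]
          exact pow_le_pow_right₀ hu1 (by norm_num)
  have hrN : (8 * r : ℝ) ≤ N := by
    have : 8 * r ≤ N := hr ▸ le_trans (Nat.le_mul_of_pos_right _ (by omega)) hspec
    exact_mod_cast this
  have hr7 : (7 * r : ℝ) ≤ N := by linarith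
  -- `1 / t` is at most a multiple of `s / N`
  have htN : 1 / (8 * r : ℝ) ≤ 768 * (s / N) := by
    have h1 : (N : ℝ) ≤ (m + 1) * 2 ^ (m + 1) * (96 * b) := by exact_mod_cast hNlt.le
    have hm1 : (m : ℝ) + 1 ≤ 2 * m := by exact_mod_cast (by omega : m + 1 ≤ 2 * m)
    have h2 : (N : ℝ) ≤ 384 * (8 * r) * b := by
      calc (N : ℝ) ≤ (m + 1) * 2 ^ (m + 1) * (96 * b) := h1
        _ ≤ (2 * m) * 2 ^ (m + 1) * (96 * b) := by gcongr
        _ = 384 * (m * 2 ^ m) * b := by ring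
        _ = 384 * (8 * r) * b := by rw [hrm]
    rw [← mul_div_assoc, div_le_div_iff₀ (by positivity) hN0]
    nlinarith
  have hlog : (m : ℝ) ≤ Real.logb 2 (N / s) := by
    rw [Real.le_logb_iff_rpow_le (by norm_num) (by positivity), Real.rpow_natCast,
      le_div_iff₀ hs0]
    have : (2 : ℝ) ^ m * b ≤ N := by exact_mod_cast h2m
    exact (mul_le_mul_of_nonneg_left hsb (by positivity)).trans this
  have hm3' : (3 : ℝ) ≤ m := by exact_mod_cast hm3
  set Y := s / N * Real.logb 2 (N / s) with hY
  have hsN : 0 < s / N := by positivity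
  have hmY : m * (s / N) ≤ Y := by
    rw [hY, mul_comm]
    exact mul_le_mul_of_nonneg_left hlog hsN.le
  have hsY : s / N ≤ Y := le_trans (by nlinarith) hmY
  have hE4 : 1 / (2 : ℝ) ^ m ≤ 768 * Y := by
    have : 1 / (2 : ℝ) ^ m = m * (1 / (8 * r : ℝ)) := by
      rw [hrm]
      field_simp
    rw [this]
    calc m * (1 / (8 * r : ℝ)) ≤ m * (768 * (s / N)) :=
          mul_le_mul_of_nonneg_left htN (by linarith)
      _ = 768 * (m * (s / N)) := by ring
      _ ≤ 768 * Y := by linarith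
  have hinvN : 1 / (N : ℝ) ≤ Y := le_trans (div_le_div_of_nonneg_right hs1 hN0.le) hsY
  have hNuk (k : ℕ) (hk : 3 ≤ k) (c : ℝ) (hc : c ≤ 2) (hc0 : 0 ≤ c) : c * N / u ^ k ≤ 1 / N := by
    rw [div_le_div_iff₀ (by positivity) hN0, one_mul]
    calc c * N * N ≤ 2 * u * u := by gcongr
      _ ≤ u * u * u := by gcongr
      _ = u ^ 3 := by ring
      _ ≤ u ^ k := pow_le_pow_right₀ hu1 hk
  have hE1 : (1 - (1 / 2 ^ m - ε)) ^ (7 * r) ≤ 3 * (1 / 2 ^ m) := by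
    refine one_sub_pow_le hε0 hr.symm ?_
    calc (8 * r : ℝ) * ε ≤ N * (1 / u ^ 47) := by gcongr
      _ = 1 * N / u ^ 47 := by ring
      _ ≤ 1 / N := hNuk 47 (by norm_num) 1 (by norm_num) (by norm_num)
      _ ≤ 1 := by rw [div_le_one hN0]; exact hN1
  have hE2 : (((T * Q + 1) ^ q : ℕ) : ℝ) * ((7 * r : ℕ) * (1 / u ^ 24 + 1 / u ^ 24)) ≤ Y := by
    calc (((T * Q + 1) ^ q : ℕ) : ℝ) * ((7 * r : ℕ) * (1 / u ^ 24 + 1 / u ^ 24))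
        ≤ u * (N * (1 / u ^ 24 + 1 / u ^ 24)) := by
          push_cast at hq1 ⊢
          gcongr
      _ = 2 * N / u ^ 23 := by field_simp; norm_num
      _ ≤ 1 / N := hNuk 23 (by norm_num) 2 le_rfl (by norm_num)
      _ ≤ Y := hinvN
  have hE5 : (((T * Q + 1) ^ q : ℕ) : ℝ) * ((7 * r : ℕ) * (u ^ 24 * ε)) ≤ Y := by
    calc (((T * Q + 1) ^ q : ℕ) : ℝ) * ((7 * r : ℕ) * (u ^ 24 * ε))
        ≤ u * (N * (u ^ 24 * (1 / u ^ 47))) := by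
          push_cast at hq1 ⊢
          gcongr
      _ = 1 * N / u ^ 22 := by field_simp
      _ ≤ 1 / N := hNuk 22 (by norm_num) 1 (by norm_num) (by norm_num)
      _ ≤ Y := hinvN
  have hE3 : (T : ℝ) / (((8 * r - 7 * r) * (96 * b) : ℕ) * (q + 1)) ≤ 192 * Y := by
    rw [show 8 * r - 7 * r = r by omega, mul_comm, ← div_div]
    have h3 : s ^ 2 ≤ b ^ 2 := pow_le_pow_left₀ hs0.le hsb 2
    calc (T : ℝ) / (q + 1) / (r * (96 * b) : ℕ) ≤ 3 * b ^ 2 / b / (r * (96 * b) : ℕ) := by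
          refine div_le_div_of_nonneg_right (hq2.trans ?_) (by positivity)
          gcongr
      _ = 1 / 4 * (1 / (8 * r)) := by
          push_cast
          field_simp
          norm_num
      _ ≤ 1 / 4 * (768 * (s / N)) := by gcongr
      _ ≤ 192 * Y := by linarith
  obtain rfl : t = 8 * r := ht.trans hr
  have hmain := le_tvDist_hardDist (Q := Q) (T := T) (n := 96 * b) (t := 8 * r) (t' := 7 * r)
    (a := u ^ 24) q (by omega) (by omega)
    (mixes_isoFun (n := 96 * b) (m := m) (by
      have : (m : ℝ) ≤ (96 * b : ℕ) := by push_cast at hmn ⊢; linarith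
      exact_mod_cast this)) (by positivity) (by positivity) hX
  rw [← hε] at hmain
  linarith

theorem corollary3p27 :
    ∃ δ δ₁ C K γ : ℝ, 0 < δ ∧ 0 < δ₁ ∧ 0 < C ∧ 0 < K ∧ 0 < γ ∧
    ∃ (n t m : ℕ → ℕ → ℕ) (Iso : (n m : ℕ) → BitStr n × BitStr n → Bool)
      (Iso' : (N b : ℕ) → BitStr (n N b) → Bool),
      IsExplicit Iso ∧
      IsPolySamplable (Admissible C δ₁) (fun N b => t N b * n N b + t N b * n N b + t N b)
        (fun N b => hardDist (n N b) (t N b) (Iso (n N b) (m N b))) ∧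
      IsPolySamplable (Admissible C δ₁) (fun N b => n N b + 1)
        (fun N b => hardDistOne (n N b) (Iso' N b)) ∧
      ∀ Q T N b : ℕ, 0 < Q → 0 < T → b = ⌈tmParam Q T⌉₊ → Admissible C δ₁ N b →
        0 < n N b ∧ 0 < t N b ∧ n N b * t N b ≤ N ∧
        (m N b : ℝ) ≤ δ * n N b ∧
        m N b * 2 ^ m N b ≤ t N b ∧ t N b < (m N b + 1) * 2 ^ (m N b + 1) ∧
        IsIsolator ((2 : ℝ) ^ (-(m N b : ℝ)) - (2 : ℝ) ^ (-(γ * n N b)))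
          ((2 : ℝ) ^ (-(m N b : ℝ)) + (2 : ℝ) ^ (-(γ * n N b)))
          ((1 - γ) * (2 * n N b))
          (Iso (n N b) (m N b))
          (commSources (BitStr (n N b)) (BitStr (n N b)) (δ * n N b)) ∧
        (∀ X ∈ tmSources Q T (t N b * n N b + t N b * n N b + t N b),
          1 - K * (tmParam Q T / N * Real.logb 2 (N / tmParam Q T)) ≤
            tvDist (hardDist (n N b) (t N b) (Iso (n N b) (m N b))) X) ∧
        IsIsolator (1 / 2 - (2 : ℝ) ^ (-(γ * n N b))) (1 / 2 + (2 : ℝ) ^ (-(γ * n N b)))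
          ((1 - γ) * n N b) (Iso' N b) (halvesCommSources (n N b) (δ * n N b)) ∧
        ∀ Y ∈ tmSources Q T (n N b + 1),
          1 / 4 - (2 : ℝ) ^ (-(γ * n N b)) ≤ tvDist (hardDistOne (n N b) (Iso' N b)) Y := by
  have hadm : ∀ N b, Admissible 10 (1 / 10000) N b → 0 < b ∧ 96 * b ≤ N := fun N b h => by
    obtain ⟨h1, h2, -⟩ := bounds_of_admissible h
    omega
  refine ⟨1 / 100, 1 / 10000, 10, 4000, 1 / 100, by norm_num, by norm_num, by norm_num,
    by norm_num, by norm_num, fun _ b => 96 * b,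
    fun N b => numShifts N (96 * b) * 2 ^ numShifts N (96 * b), fun N b => numShifts N (96 * b),
    isoFun, fun _ b => isoThirds b, Prog.isExplicit_isoFun, isPolySamplable_hardDist _ hadm,
    isPolySamplable_hardDistOne _ fun N b h => (hadm N b h).2, fun Q T N b _ _ hb h => ?_⟩
  obtain ⟨hb10, -⟩ := bounds_of_admissible h
  obtain ⟨hm3, -, -, hmn⟩ := bounds_of_numShifts h
  have hspec := numShifts_spec N (96 * b)
  have hs0 : 0 < tmParam Q T := Nat.ceil_pos.mp (hb ▸ (by omega : 0 < b))
  have hn : 96 ≤ 96 * b := by omega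
  refine ⟨lt_of_lt_of_le (by norm_num) hn, by positivity, by rw [mul_comm]; exact hspec, hmn, le_rfl, ?_,
    isIsolator_isoFun hn hmn, fun X hX => le_tvDist_hardDist_numShifts h hb rfl rfl hX,
    isIsolator_isoThirds (by omega), fun Y hY => ?_⟩
  · exact Nat.mul_lt_mul_of_lt_of_le (Nat.lt_succ_self _)
      (Nat.pow_le_pow_right (by norm_num) (Nat.le_succ _)) (by positivity)
  · have h1 := quarter_le_tvDist_hardDistOne (by omega) hs0 (hb ▸ Nat.le_ceil _) hY
    have h2 : (0 : ℝ) < 2 ^ (-(1 / 100 * (96 * b : ℕ)) : ℝ) := by positivity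
    linarith
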